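/- Let $k$ be a field of characteristic $0$ and let $\pi=(\pi,[\,,],d)$ be a differential graded (dg) Lie algebra over $k$, graded by lower degrees $\pi=\bigoplus_{i\in\mathbb Z}\pi_i$ with $d$ of degree $-1$, such that $\pi_i=0$ for $i\le 0$. Notation. All signs follow the Koszul convention, and homology is $\ker d/\operatorname{im} d$. $\mathrm{Der}\,\pi=\bigoplus_{n\in\mathbb Z}\mathrm{Der}_n\pi$ is the dg Lie algebra of graded derivations of the graded Lie algebra $\pi$, with the graded commutator bracket and the differential $[d,-]$; $\mathrm{ad}\,\pi\subseteq\mathrm{Der}\,\pi$ is the ideal of the inner derivations $\mathrm{ad}\,x=[x,-]$. $s\pi$ is the suspension, $(s\pi)_i=\pi_{i-1}$. The semidirect product $s\pi\,\sharp\,\mathrm{Der}\,\pi$ is the dg Lie algebra with underlying graded vector space $s\pi\oplus\mathrm{Der}\,\pi$, in which $s\pi$ is an abelian subalgebra, $\mathrm{Der}\,\pi$ is a subalgebra, $[\phi,sx]=(-1)^{|\phi|}s\phi(x)$, and the differential is $sx\mapsto -s(dx)+\mathrm{ad}\,x$, $\phi\mapsto[d,\phi]$. $C(\pi)$ is the Chevalley–Eilenberg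 dg coalgebra: the graded symmetric coalgebra $S(s\pi)$ with the unshuffle coproduct (cofree cocommutative on $s\pi$), with counit $\varepsilon$ and projection $p:C(\pi)\to s\pi$ onto the cogenerators, and with the differential that is the coderivation determined by $d(sx)=-s(dx)$ and $$d(sx\wedge sy)=(-1)^{|x|}s[x,y]-s(dx)\wedge sy-(-1)^{|sx|}sx\wedge s(dy)$$ (that is, $p\,d$ vanishes on $S^n(s\pi)$ for $n\neq1,2$). $\mathrm{Der}\,C(\pi)=\bigoplus_n\mathrm{Der}_nC(\pi)$ is the dg Lie algebra of graded coderivations of the graded coalgebra $C(\pi)$, with the graded commutator bracket and the differential $[d,-]$. Theorem. (1) There is a unique map of dg Lie algebras $$\rho: s\pi\,\sharp\,\mathrm{Der}\,\pi\to\mathrm{Der}\,C(\pi)$$ such that $p(\rho(sx)(c))=\varepsilon(c)\,sx$ for all $x\in\pi$, $c\in C(\pi)$, and $p\circ\rho(\theta)=s\theta\circ p$ for every derivation $\theta$ of $\pi$ of degree $n$, where $s\theta:s\pi\to s\pi$ is $s\theta(sx)=(-1)^{n}s(\theta x)$. (2) If $\pi$ is free as a graded Lie algebra, then $\rho$ is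 a quasi-isomorphism, i.e. it induces an isomorphism in homology. (3) If $\pi$ is free as a graded Lie algebra on more than one generator (i.e. on a family of homogeneous generators with at least two members), then the projection $s\pi\,\sharp\,\mathrm{Der}\,\pi\to\mathrm{Der}\,\pi/\mathrm{ad}\,\pi$, $sx+\phi\mapsto[\phi]$, is a map of dg Lie algebras and a quasi-isomorphism; in particular $H(s\pi\,\sharp\,\mathrm{Der}\,\pi)\cong H(\mathrm{Der}\,\pi/\mathrm{ad}\,\pi)$. -/

import Mathlib

open scoped TensorProduct DirectSum

universe u v w

noncomputable section

namespace DGL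

/-! ### Signs -/

/-- The sign `(-1) ^ n` in the ground field. -/
def sgn (k : Type u) [Field k] (n : ℤ) : k := (-1 : k) ^ n

section Sign

variable {k : Type u} [Field k]

theorem sgn_add (m n : ℤ) : sgn k (m + n) = sgn k m * sgn k n := by
  simp [sgn, zpow_add₀]

theorem sgn_neg (n : ℤ) : sgn k (-n) = sgn k n := by
  simp only [sgn, zpow_neg]
  rcases Int.even_or_odd n with h | h
  · simp [h.neg_one_zpow]
  · simp [h.neg_one_zpow]

theorem sgn_sub (m n : ℤ) : sgn k (m - n) = sgn k m * sgn k n := by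
  rw [sub_eq_add_neg, sgn_add, sgn_neg]

theorem sgn_zero : sgn k 0 = 1 := by simp [sgn]

theorem sgn_one : sgn k 1 = -1 := by simp [sgn]

theorem sgn_cases (n : ℤ) : sgn k n = 1 ∨ sgn k n = -1 := by
  simp only [sgn]
  rcases Int.even_or_odd n with h | h
  · exact Or.inl h.neg_one_zpow
  · exact Or.inr h.neg_one_zpow

end Sign

/-! ### Graded vector spaces -/

/-- A `ℤ`-grading (by lower degree) of the vector space `V`. -/
structure Grading (k : Type u) [Field k] (V : Type v) [AddCommGroup V] [Module k V] where
  /-- the homogeneous component of each degree -/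
  gr : ℤ → Submodule k V
  internal : DirectSum.IsInternal gr

section Basic

variable {k : Type u} [Field k] {V : Type v} [AddCommGroup V] [Module k V]
  {W : Type w} [AddCommGroup W] [Module k W]

/-- A family of submodules that spans and has projections is a grading. -/
theorem internal_of_proj (gr : ℤ → Submodule k V) (p : ℤ → V →ₗ[k] V)
    (hsame : ∀ n, ∀ x ∈ gr n, p n x = x) (hne : ∀ m n, m ≠ n → ∀ x ∈ gr m, p n x = 0)
    (htop : ∀ x : V, x ∈ ⨆ n, gr n) : DirectSum.IsInternal gr := by
  constructor
  · have key : ∀ (z : ⨁ n, gr n) (n : ℤ), ((z n : gr n) : V) = p n (DirectSum.coeLinearMap gr z) := by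
      intro z n
      induction z using DirectSum.induction_on with
      | zero => simp
      | of i x =>
        rw [DirectSum.coeLinearMap_of]
        by_cases h : i = n
        · subst h
          rw [DirectSum.of_eq_same, hsame _ _ x.2]
        · rw [DirectSum.of_eq_of_ne _ _ _ (Ne.symm h), hne _ _ h _ x.2]
          rfl
      | add x y hx hy => simp [hx, hy]
    intro x y hxy
    have hxy' : DirectSum.coeLinearMap gr x = DirectSum.coeLinearMap gr y := hxy
    refine DFinsupp.ext fun n => Subtype.ext ?_
    exact (key x n).trans ((congrArg (p n) hxy').trans (key y n).symm)
  · intro x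
    have h : x ∈ LinearMap.range (DirectSum.coeLinearMap gr) := by
      rw [DirectSum.range_coeLinearMap]; exact htop x
    exact h

namespace Grading

variable (G : Grading k V)

/-- The linear map on `V` that is `f i` on the component of degree `i`. -/
def glue (f : ∀ i, G.gr i →ₗ[k] W) : V →ₗ[k] W :=
  DirectSum.toModule k ℤ W f ∘ₗ
    (LinearEquiv.ofBijective (DirectSum.coeLinearMap G.gr) G.internal).symm.toLinearMap

theorem glue_apply (f : ∀ i, G.gr i →ₗ[k] W) {i : ℤ} {x : V} (hx : x ∈ G.gr i) :
    G.glue f x = f i ⟨x, hx⟩ := by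
  have h : (LinearEquiv.ofBijective (DirectSum.coeLinearMap G.gr) G.internal).symm x =
      DirectSum.lof k ℤ (fun i => G.gr i) i ⟨x, hx⟩ := by
    rw [LinearEquiv.symm_apply_eq]
    exact (DirectSum.coeLinearMap_lof (R := k) G.gr i ⟨x, hx⟩).symm
  simp only [glue, LinearMap.comp_apply, LinearEquiv.coe_coe, h, DirectSum.toModule_lof]

theorem mem_iSup (x : V) : x ∈ ⨆ n, G.gr n := by
  rw [G.internal.submodule_iSup_eq_top]; trivial

theorem induction {P : V → Prop} (hom : ∀ i, ∀ x ∈ G.gr i, P x)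
    (add : ∀ x y, P x → P y → P (x + y)) (x : V) : P x :=
  Submodule.iSup_induction G.gr (motive := P) (G.mem_iSup x) hom (hom 0 0 (Submodule.zero_mem _)) add

/-- Linear maps that agree on homogeneous elements are equal. -/
theorem ext_hom {f g : V →ₗ[k] W} (h : ∀ i, ∀ x ∈ G.gr i, f x = g x) : f = g := by
  refine LinearMap.ext fun x => G.induction (P := fun x => f x = g x) h ?_ x
  intro x y hx hy
  simp [hx, hy]

/-- The projection onto the component of degree `n`. -/
def proj (n : ℤ) : V →ₗ[k] V := G.glue fun i => if i = n then (G.gr i).subtype else 0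

theorem proj_same {n : ℤ} {x : V} (hx : x ∈ G.gr n) : G.proj n x = x := by
  simp [proj, G.glue_apply _ hx]

theorem proj_ne {m n : ℤ} (h : m ≠ n) {x : V} (hx : x ∈ G.gr m) : G.proj n x = 0 := by
  simp [proj, G.glue_apply _ hx, h]

theorem proj_mem (n : ℤ) (x : V) : G.proj n x ∈ G.gr n := by
  refine G.induction (P := fun x => G.proj n x ∈ G.gr n) ?_ ?_ x
  · intro i x hx
    by_cases h : i = n
    · subst h; rwa [G.proj_same hx]
    · rw [G.proj_ne h hx]; exact Submodule.zero_mem _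
  · intro x y hx hy
    rw [map_add]; exact Submodule.add_mem _ hx hy

/-- The sign operator `x ↦ (-1) ^ (n |x|) x`: the Koszul sign for moving an operator of degree `n`
past `x`. -/
def sign (n : ℤ) : V →ₗ[k] V := G.glue fun i => sgn k (n * i) • (G.gr i).subtype

theorem sign_apply (n : ℤ) {i : ℤ} {x : V} (hx : x ∈ G.gr i) :
    G.sign n x = sgn k (n * i) • x := by
  simp [sign, G.glue_apply _ hx]

theorem sign_sign (m n : ℤ) (x : V) : G.sign m (G.sign n x) = G.sign (m + n) x := by
  have : G.sign m ∘ₗ G.sign n = G.sign (m + n) := G.ext_hom fun i x hx => by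
    simp [G.sign_apply _ hx, add_mul, sgn_add, smul_smul, mul_comm (sgn k (n * i))]
  exact LinearMap.congr_fun this x

/-- The suspension of a graded vector space: `(sV)_i = V_{i-1}`. The underlying vector space is
`V`, and the element `sx` is represented by `x`. -/
def shift : Grading k V where
  gr i := G.gr (i - 1)
  internal := by
    refine internal_of_proj _ (fun n => G.proj (n - 1)) (fun n x hx => G.proj_same hx)
      (fun m n h x hx => G.proj_ne (by omega) hx) ?_
    intro x
    have h := G.mem_iSup x
    have h2 : ⨆ n, G.gr n ≤ ⨆ n, G.gr (n - 1) := iSup_le fun n =>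
      (le_of_eq (by simp)).trans (le_iSup (fun n => G.gr (n - 1)) (n + 1))
    exact h2 h

/-- The direct sum of two graded vector spaces. -/
def prod (H : Grading k W) : Grading k (V × W) where
  gr i := (G.gr i).prod (H.gr i)
  internal := by
    refine internal_of_proj _ (fun n => LinearMap.prodMap (G.proj n) (H.proj n)) ?_ ?_ ?_
    · rintro n ⟨x, y⟩ ⟨hx, hy⟩
      exact Prod.ext (G.proj_same hx) (H.proj_same hy)
    · rintro m n h ⟨x, y⟩ ⟨hx, hy⟩
      exact Prod.ext (G.proj_ne h hx) (H.proj_ne h hy)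
    · rintro ⟨x, y⟩
      have hx : (x, (0 : W)) ∈ ⨆ n, (G.gr n).prod (H.gr n) := by
        refine G.induction (P := fun x => (x, (0 : W)) ∈ ⨆ n, (G.gr n).prod (H.gr n)) ?_ ?_ x
        · intro i x hx
          exact Submodule.mem_iSup_of_mem i ⟨hx, Submodule.zero_mem _⟩
        · intro x y hx hy
          simpa using Submodule.add_mem _ hx hy
      have hy : ((0 : V), y) ∈ ⨆ n, (G.gr n).prod (H.gr n) := by
        refine H.induction (P := fun y => ((0 : V), y) ∈ ⨆ n, (G.gr n).prod (H.gr n)) ?_ ?_ y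
        · intro i x hx
          exact Submodule.mem_iSup_of_mem i ⟨Submodule.zero_mem _, hx⟩
        · intro x y hx hy
          simpa using Submodule.add_mem _ hx hy
      simpa using Submodule.add_mem _ hx hy

/-- The quotient of a graded vector space by a homogeneous subspace. -/
def quotient (I : Submodule k V) (hI : ∀ n, ∀ x ∈ I, G.proj n x ∈ I) : Grading k (V ⧸ I) where
  gr i := (G.gr i).map I.mkQ
  internal := by
    refine internal_of_proj _ (fun n => I.mapQ I (G.proj n) (hI n)) ?_ ?_ ?_
    · rintro n _ ⟨x, hx, rfl⟩
      simp [G.proj_same hx]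
    · rintro m n h _ ⟨x, hx, rfl⟩
      simp [G.proj_ne h hx]
    · intro y
      obtain ⟨x, rfl⟩ := I.mkQ_surjective y
      refine G.induction (P := fun x => I.mkQ x ∈ ⨆ n, (G.gr n).map I.mkQ) ?_ ?_ x
      · intro i x hx
        exact Submodule.mem_iSup_of_mem i ⟨x, hx, rfl⟩
      · intro x y hx hy
        rw [map_add]; exact Submodule.add_mem _ hx hy

/-- The linear endomorphisms of degree `n`. -/
def homDeg (n : ℤ) : Submodule k (Module.End k V) where
  carrier := {f | ∀ i, ∀ x ∈ G.gr i, f x ∈ G.gr (n + i)}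
  add_mem' hf hg i x hx := Submodule.add_mem _ (hf i x hx) (hg i x hx)
  zero_mem' i x _ := Submodule.zero_mem _
  smul_mem' c f hf i x hx := Submodule.smul_mem _ c (hf i x hx)

theorem sign_comp {n : ℤ} {f : Module.End k V} (hf : f ∈ G.homDeg n) (m : ℤ) (x : V) :
    G.sign m (f x) = sgn k (m * n) • f (G.sign m x) := by
  have : G.sign m ∘ₗ f = sgn k (m * n) • f ∘ₗ G.sign m := G.ext_hom fun i x hx => by
    simp [G.sign_apply _ hx, G.sign_apply _ (hf i x hx), mul_add, sgn_add, smul_smul]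
  exact LinearMap.congr_fun this x

theorem sign_mem (n : ℤ) {i : ℤ} {x : V} (hx : x ∈ G.gr i) : G.sign n x ∈ G.gr i := by
  rw [G.sign_apply n hx]; exact Submodule.smul_mem _ _ hx

/-- For an operator `f` of degree `n`, the operator `f ⊗ 1 + 1 ⊗ f` on `V ⊗ V`, with the Koszul
sign `(1 ⊗ f) (a ⊗ b) = (-1) ^ (n |a|) a ⊗ f b`. -/
def tensorOp (n : ℤ) : Module.End k V →ₗ[k] Module.End k (V ⊗[k] V) :=
  LinearMap.rTensorHom V + TensorProduct.mapBilinear (RingHom.id k) V V V V (G.sign n)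

theorem tensorOp_tmul (n : ℤ) (f : Module.End k V) (a b : V) :
    G.tensorOp n f (a ⊗ₜ b) = f a ⊗ₜ b + G.sign n a ⊗ₜ f b := by
  simp [tensorOp]

/-- The symmetry `a ⊗ b ↦ (-1) ^ (|a| |b|) b ⊗ a` of `V ⊗ V`. -/
def braid : V ⊗[k] V →ₗ[k] V ⊗[k] V :=
  TensorProduct.lift (G.glue fun i =>
    ((TensorProduct.mk k V V).compl₁₂ (G.sign i) LinearMap.id).flip ∘ₗ (G.gr i).subtype)

theorem braid_tmul {i : ℤ} {a : V} (ha : a ∈ G.gr i) (b : V) :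
    G.braid (a ⊗ₜ b) = G.sign i b ⊗ₜ a := by
  simp [braid, G.glue_apply _ ha]

theorem tensorOp_commutator {m n : ℤ} {f g : Module.End k V} (hf : f ∈ G.homDeg m)
    (hg : g ∈ G.homDeg n) :
    G.tensorOp m f * G.tensorOp n g - sgn k (m * n) • (G.tensorOp n g * G.tensorOp m f) =
      G.tensorOp (m + n) (f * g - sgn k (m * n) • (g * f)) := by
  refine TensorProduct.ext' fun a b => ?_
  simp only [LinearMap.sub_apply, LinearMap.smul_apply, Module.End.mul_apply, tensorOp_tmul,
    map_add, G.sign_comp hf, G.sign_comp hg, G.sign_sign, add_comm n m,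
    TensorProduct.sub_tmul, TensorProduct.tmul_sub, ← TensorProduct.smul_tmul',
    TensorProduct.tmul_smul, smul_add, smul_smul, mul_comm n m]
  rcases sgn_cases (k := k) (m * n) with h | h <;> simp only [h] <;> module

end Grading

end Basic

/-! ### External direct sums of families of subspaces -/

section Tot

variable {k : Type u} [Field k] {V : Type v} [AddCommGroup V] [Module k V]
  {W : Type w} [AddCommGroup W] [Module k W]

/-- The external direct sum `⨁ n, D n` of a family of subspaces. -/
def Tot (D : ℤ → Submodule k V) : Type v := ⨁ n, D n

instance (D : ℤ → Submodule k V) : AddCommGroup (Tot D) :=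
  inferInstanceAs (AddCommGroup (⨁ n, D n))

instance (D : ℤ → Submodule k V) : Module k (Tot D) :=
  inferInstanceAs (Module k (⨁ n, D n))

namespace Tot

variable (D : ℤ → Submodule k V)

/-- The inclusion of the summand of degree `i`. -/
def of (i : ℤ) : D i →ₗ[k] Tot D := DirectSum.lof k ℤ (fun n => D n) i

/-- The linear map out of the direct sum that is `f i` on the summand of degree `i`. -/
def lift (f : ∀ i, D i →ₗ[k] W) : Tot D →ₗ[k] W := DirectSum.toModule k ℤ W f

theorem lift_of (f : ∀ i, D i →ₗ[k] W) {i : ℤ} (x : D i) : lift D f (of D i x) = f i x :=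
  DirectSum.toModule_lof (M := fun n => D n) (φ := f) k i x

theorem induction {P : Tot D → Prop} (hom : ∀ i x, P (of D i x))
    (add : ∀ x y, P x → P y → P (x + y)) (x : Tot D) : P x := by
  refine DirectSum.induction_on (β := fun n => D n) x ?_ (fun i x => hom i x) add
  have := hom 0 0
  rwa [map_zero] at this

/-- The tautological grading of the direct sum. -/
def grading : Grading k (Tot D) where
  gr i := LinearMap.range (of D i)
  internal := by
    classical
    refine internal_of_proj _
      (fun n => lift D fun i => if i = n then of D i else 0) ?_ ?_ ?_
    · rintro n _ ⟨x, rfl⟩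
      simp [lift_of]
    · rintro m n h _ ⟨x, rfl⟩
      simp [lift_of, h]
    · intro x
      exact induction D (P := fun x => x ∈ ⨆ n, LinearMap.range (of D n))
        (fun i x => Submodule.mem_iSup_of_mem i ⟨x, rfl⟩)
        (fun x y hx hy => Submodule.add_mem _ hx hy) x

theorem of_congr {m n : ℤ} (h : m = n) {a : D m} {b : D n} (hab : (a : V) = b) :
    of D m a = of D n b := by
  subst h
  rw [Subtype.ext hab]

theorem of_congr_add {m n l : ℤ} (h : m = n) (h' : m = l) {c : k}
    {a : D m} {b : D n} {e : D l} (hab : (a : V) = b + c • (e : V)) :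
    of D m a = of D n b + c • of D l e := by
  subst h
  subst h'
  rw [← map_smul, ← map_add]
  exact of_congr D rfl hab

/-- The element of the ambient space underlying an element of the direct sum. -/
def toAmbient : Tot D →ₗ[k] V := lift D fun i => (D i).subtype

theorem toAmbient_of {i : ℤ} (x : D i) : toAmbient D (of D i x) = x := lift_of D _ x

end Tot

end Tot

/-! ### Differential graded Lie algebras -/

/-- A graded Lie algebra (over a field, which is of characteristic zero in all applications). -/
structure GradedLieAlgebra (k : Type u) [Field k] (L : Type v) [AddCommGroup L] [Module k L]
    extends Grading k L where
  bracket : L →ₗ[k] L →ₗ[k] L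
  bracket_mem : ∀ {i j x y}, x ∈ gr i → y ∈ gr j → bracket x y ∈ gr (i + j)
  skew : ∀ {i j x y}, x ∈ gr i → y ∈ gr j → bracket x y = -(sgn k (i * j) • bracket y x)
  jacobi : ∀ {i j x y}, x ∈ gr i → y ∈ gr j → ∀ z,
    bracket x (bracket y z) = bracket (bracket x y) z + sgn k (i * j) • bracket y (bracket x z)

/-- A differential graded Lie algebra, with lower grading and differential of degree `-1`. -/
structure DGLieAlgebra (k : Type u) [Field k] (L : Type v) [AddCommGroup L] [Module k L]
    extends GradedLieAlgebra k L where
  d : L →ₗ[k] L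
  d_mem : ∀ {i x}, x ∈ gr i → d x ∈ gr (i - 1)
  d_d : ∀ x, d (d x) = 0
  leibniz : ∀ {i x}, x ∈ gr i → ∀ y, d (bracket x y) = bracket (d x) y + sgn k i • bracket x (d y)

section Lie

variable {k : Type u} [Field k] {L : Type v} [AddCommGroup L] [Module k L]
  {M : Type w} [AddCommGroup M] [Module k M]

/-- Homomorphisms of graded Lie algebras (of degree zero). -/
structure GradedLieAlgebra.IsHom (A : GradedLieAlgebra k L) (B : GradedLieAlgebra k M)
    (f : L →ₗ[k] M) : Prop where
  map_mem : ∀ {i x}, x ∈ A.gr i → f x ∈ B.gr i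
  map_bracket : ∀ x y, f (A.bracket x y) = B.bracket (f x) (f y)

namespace DGLieAlgebra

/-- Homomorphisms of dg Lie algebras. -/
structure Hom (A : DGLieAlgebra k L) (B : DGLieAlgebra k M) where
  toLin : L →ₗ[k] M
  isHom : A.toGradedLieAlgebra.IsHom B.toGradedLieAlgebra toLin
  map_d : ∀ x, toLin (A.d x) = B.d (toLin x)

/-- The homology `ker d / im d`. -/
abbrev Homology (A : DGLieAlgebra k L) : Type v :=
  LinearMap.ker A.d ⧸ (LinearMap.range A.d).comap (LinearMap.ker A.d).subtype

/-- The map induced in homology. -/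
def Hom.homologyMap {A : DGLieAlgebra k L} {B : DGLieAlgebra k M} (f : Hom A B) :
    A.Homology →ₗ[k] B.Homology :=
  Submodule.mapQ _ _
    (f.toLin.restrict (p := LinearMap.ker A.d) (q := LinearMap.ker B.d) (fun x hx => by
      rw [LinearMap.mem_ker] at hx ⊢
      rw [← f.map_d, hx, map_zero]))
    (by
      rintro ⟨x, hx⟩ ⟨y, hy⟩
      exact ⟨f.toLin y, by rw [← f.map_d, hy]; rfl⟩)

/-- Quasi-isomorphisms: maps of dg Lie algebras inducing an isomorphism in homology. -/
def Hom.IsQuasiIso {A : DGLieAlgebra k L} {B : DGLieAlgebra k M} (f : Hom A B) : Prop :=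
  Function.Bijective f.homologyMap

end DGLieAlgebra

/-- The graded Lie algebra `A` is free on the family `gen` of homogeneous generators,
`gen x` being of degree `deg x`. -/
def GradedLieAlgebra.IsFreeOn (A : GradedLieAlgebra k L) {X : Type v} (deg : X → ℤ) (gen : X → L) :
    Prop :=
  (∀ x, gen x ∈ A.gr (deg x)) ∧
    ∀ (L' : Type (max u v)) [AddCommGroup L'] [Module k L'] (B : GradedLieAlgebra k L')
      (g : X → L'), (∀ x, g x ∈ B.gr (deg x)) →
        ∃! f : L →ₗ[k] L', A.IsHom B f ∧ ∀ x, f (gen x) = g x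

/-! ### The dg Lie algebra of a graded family of operators under the graded commutator -/

section Commutator

variable {A : Type v} [Ring A] [Algebra k A] (D : ℤ → Submodule k A)
  (hD : ∀ {i j f g}, f ∈ D i → g ∈ D j → f * g - sgn k (i * j) • (g * f) ∈ D (i + j))

/-- The graded commutator `[f, g] = f g - (-1) ^ (|f| |g|) g f`, on homogeneous elements. -/
def commHom (i j : ℤ) : D i →ₗ[k] D j →ₗ[k] Tot D :=
  LinearMap.mk₂ k
    (fun f g => Tot.of D (i + j)
      ⟨(f : A) * g - sgn k (i * j) • ((g : A) * f), hD f.2 g.2⟩)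
    (fun f f' g => by
      rw [← map_add]; congr 1; ext; simp [add_mul, mul_add]; abel)
    (fun c f g => by
      rw [← map_smul]; congr 1; ext; simp [smul_sub, smul_comm c])
    (fun f g g' => by
      rw [← map_add]; congr 1; ext; simp [add_mul, mul_add]; abel)
    (fun c f g => by
      rw [← map_smul]; congr 1; ext; simp [smul_sub, smul_comm c])

/-- The graded commutator, extended bilinearly to the direct sum. -/
def commBracket : (Tot D) →ₗ[k] (Tot D) →ₗ[k] Tot D :=
  Tot.lift D fun i => (Tot.lift D fun j => (commHom D hD i j).flip).flip

theorem commBracket_lof {i j : ℤ} (f : D i) (g : D j) :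
    commBracket D hD (Tot.of D i f)
        (Tot.of D j g) =
      Tot.of D (i + j)
        ⟨(f : A) * g - sgn k (i * j) • ((g : A) * f), hD f.2 g.2⟩ := by
  simp [commBracket, commHom, Tot.lift_of]

/-- The differential `[δ, f] = δ f - (-1) ^ |f| f δ`, for `δ` of degree `-1`. -/
def commDiff {δ : A} (hδ : δ ∈ D (-1)) : (Tot D) →ₗ[k] Tot D :=
  commBracket D hD (Tot.of D (-1) ⟨δ, hδ⟩)

theorem commBracket_jacobi {i j : ℤ} (f : D i) (g : D j) (z : Tot D) :
    commBracket D hD (Tot.of D i f)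
        (commBracket D hD (Tot.of D j g) z) =
      commBracket D hD (commBracket D hD (Tot.of D i f)
        (Tot.of D j g)) z +
      sgn k (i * j) • commBracket D hD (Tot.of D j g)
        (commBracket D hD (Tot.of D i f) z) := by
  refine (Tot.grading D).induction (P := fun z =>
    commBracket D hD (Tot.of D i f)
        (commBracket D hD (Tot.of D j g) z) =
      commBracket D hD (commBracket D hD (Tot.of D i f)
        (Tot.of D j g)) z +
      sgn k (i * j) • commBracket D hD (Tot.of D j g)
        (commBracket D hD (Tot.of D i f) z)) ?_ (fun x y hx hy => ?_) z
  swap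
  · simp only [map_add, smul_add, hx, hy]
    abel
  rintro l _ ⟨h, rfl⟩
  simp only [commBracket_lof]
  refine Tot.of_congr_add D (by ring) (by ring) ?_
  simp only [mul_add, add_mul, sgn_add, mul_sub, sub_mul, smul_sub, mul_smul_comm, smul_mul_assoc,
    ← mul_assoc, mul_comm j i, mul_comm l i, mul_comm l j, smul_smul]
  rcases sgn_cases (k := k) (i * j) with h1 | h1 <;>
    rcases sgn_cases (k := k) (i * l) with h2 | h2 <;>
    rcases sgn_cases (k := k) (j * l) with h3 | h3 <;> simp only [h1, h2, h3] <;> module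

/-- The dg Lie algebra formed by a family `D n` of operators of degree `n` that is closed under
graded commutators, with the differential `[δ, -]` for some `δ` in `D (-1)` with `δ ^ 2 = 0`. -/
def commDGLie (δ : A) (hδ : δ ∈ D (-1)) (hδδ : δ * δ = 0) : DGLieAlgebra k (Tot D) where
  toGrading := Tot.grading D
  bracket := commBracket D hD
  bracket_mem := by
    rintro i j _ _ ⟨f, rfl⟩ ⟨g, rfl⟩
    exact ⟨_, (commBracket_lof D hD f g).symm⟩
  skew := by
    rintro i j _ _ ⟨f, rfl⟩ ⟨g, rfl⟩
    rw [commBracket_lof, commBracket_lof, ← map_smul, ← map_neg]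
    refine Tot.of_congr D (add_comm i j) ?_
    simp only [Submodule.coe_neg, Submodule.coe_smul, mul_comm j i, smul_sub, smul_smul]
    rcases sgn_cases (k := k) (i * j) with h | h <;> simp only [h] <;> module
  jacobi := by
    rintro i j _ _ ⟨f, rfl⟩ ⟨g, rfl⟩ z
    exact commBracket_jacobi D hD f g z
  d := commDiff D hD hδ
  d_mem := by
    rintro i _ ⟨f, rfl⟩
    rw [commDiff, commBracket_lof]
    exact ⟨⟨_, by simpa [sub_eq_neg_add] using hD hδ f.2⟩, Tot.of_congr D (by ring) rfl⟩
  d_d := by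
    intro x
    refine (Tot.grading D).induction (P := fun x => commDiff D hD hδ (commDiff D hD hδ x) = 0)
      ?_ ?_ x
    · rintro i _ ⟨f, rfl⟩
      rw [commDiff, commBracket_lof, commBracket_lof,
        ← map_zero (Tot.of D (-1 + (-1 + i)))]
      refine Tot.of_congr D rfl ?_
      have h1 : δ * (δ * f) = 0 := by rw [← mul_assoc, hδδ, zero_mul]
      have h2 : (f : A) * δ * δ = 0 := by rw [mul_assoc, hδδ, mul_zero]
      simp only [neg_mul, one_mul, mul_sub, sub_mul, mul_smul_comm, smul_mul_assoc, h1, h2,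
        sgn_add, sgn_neg, sgn_one, neg_add, neg_neg, ← mul_assoc, smul_zero, smul_sub, smul_smul,
        hδδ, zero_mul, Submodule.coe_zero]
      rcases sgn_cases (k := k) i with h | h <;> simp only [h] <;> module
    · intro x y hx hy
      rw [map_add, map_add, hx, hy, add_zero]
  leibniz := by
    rintro i _ ⟨f, rfl⟩ y
    have := commBracket_jacobi D hD ⟨δ, hδ⟩ f y
    rw [neg_mul, one_mul, sgn_neg] at this
    exact this

end Commutator

end Lie

/-! ### Derivations, the semidirect product and outer derivations -/

section Derivations

variable {k : Type u} [Field k] {L : Type v} [AddCommGroup L] [Module k L]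

/-- The derivations of degree `n` of a graded Lie algebra. -/
def GradedLieAlgebra.der (A : GradedLieAlgebra k L) (n : ℤ) : Submodule k (Module.End k L) where
  carrier := {θ | θ ∈ A.homDeg n ∧ ∀ i, ∀ x ∈ A.gr i, ∀ y,
    θ (A.bracket x y) = A.bracket (θ x) y + sgn k (n * i) • A.bracket x (θ y)}
  add_mem' hf hg := ⟨Submodule.add_mem _ hf.1 hg.1, fun i x hx y => by
    simp only [LinearMap.add_apply, hf.2 i x hx y, hg.2 i x hx y, map_add, smul_add]
    abel⟩
  zero_mem' := ⟨Submodule.zero_mem _, fun i x _ y => by simp⟩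
  smul_mem' c f hf := ⟨Submodule.smul_mem _ c hf.1, fun i x hx y => by
    simp only [LinearMap.smul_apply, hf.2 i x hx y, map_smul, smul_add, smul_comm c]⟩

theorem GradedLieAlgebra.der_commutator (A : GradedLieAlgebra k L) {i j : ℤ}
    {f g : Module.End k L} (hf : f ∈ A.der i) (hg : g ∈ A.der j) :
    f * g - sgn k (i * j) • (g * f) ∈ A.der (i + j) := by
  refine ⟨?_, fun l x hx y => ?_⟩
  · refine Submodule.sub_mem _ ?_ (Submodule.smul_mem _ _ ?_)
    · intro l x hx
      simpa [add_assoc] using hf.1 _ _ (hg.1 l x hx)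
    · intro l x hx
      simpa [add_assoc, add_left_comm] using hg.1 _ _ (hf.1 l x hx)
  · simp only [LinearMap.sub_apply, LinearMap.smul_apply, Module.End.mul_apply, hg.2 l x hx,
      hf.2 l x hx, map_add, map_smul, hf.2 _ _ (hg.1 l x hx), hg.2 _ _ (hf.1 l x hx), map_sub,
      mul_add, add_mul, sgn_add, smul_add, smul_sub, smul_smul, mul_comm j i]
    rcases sgn_cases (k := k) (i * j) with h1 | h1 <;>
      rcases sgn_cases (k := k) (i * l) with h2 | h2 <;>
      rcases sgn_cases (k := k) (j * l) with h3 | h3 <;> simp only [h1, h2, h3] <;> module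

namespace DGLieAlgebra

variable (π : DGLieAlgebra k L)

theorem d_mem_der : π.d ∈ π.der (-1) :=
  ⟨fun i x hx => by simpa [sub_eq_neg_add] using π.d_mem hx, fun i x hx y => by
    simpa [sgn_neg] using π.leibniz hx y⟩

/-- The underlying space of `Der π`: the direct sum over `n` of the derivations of degree `n`. -/
abbrev DerSpace : Type v := Tot π.der

/-- The dg Lie algebra `Der π` of derivations of `π`: graded commutator, differential `[d, -]`. -/
def Der : DGLieAlgebra k π.DerSpace :=
  commDGLie π.der (fun hf hg => π.der_commutator hf hg) π.d π.d_mem_der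
    (LinearMap.ext π.d_d)

/-- The underlying linear operator of an element of `Der π`. -/
def derToEnd : π.DerSpace →ₗ[k] Module.End k L := Tot.toAmbient π.der

theorem derToEnd_lof {n : ℤ} (θ : π.der n) :
    π.derToEnd (Tot.of π.der n θ) = θ :=
  Tot.toAmbient_of π.der θ

theorem derToEnd_mem {n : ℤ} {f : π.DerSpace} (hf : f ∈ π.Der.gr n) : π.derToEnd f ∈ π.der n := by
  obtain ⟨θ, rfl⟩ := hf
  rw [derToEnd_lof]
  exact θ.2

theorem derToEnd_inj {n : ℤ} {f g : π.DerSpace} (hf : f ∈ π.Der.gr n) (hg : g ∈ π.Der.gr n)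
    (h : π.derToEnd f = π.derToEnd g) : f = g := by
  obtain ⟨θ, rfl⟩ := hf
  obtain ⟨φ, rfl⟩ := hg
  rw [derToEnd_lof, derToEnd_lof] at h
  exact Tot.of_congr _ rfl h

theorem derToEnd_bracket {i j : ℤ} {f g : π.DerSpace} (hf : f ∈ π.Der.gr i)
    (hg : g ∈ π.Der.gr j) : π.derToEnd (π.Der.bracket f g) =
      π.derToEnd f * π.derToEnd g - sgn k (i * j) • (π.derToEnd g * π.derToEnd f) := by
  obtain ⟨θ, rfl⟩ := hf
  obtain ⟨φ, rfl⟩ := hg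
  have := commBracket_lof π.der (fun hf hg => π.der_commutator hf hg) θ φ
  rw [show π.Der.bracket = commBracket π.der (fun hf hg => π.der_commutator hf hg) from rfl, this]
  simp only [derToEnd_lof]

theorem derToEnd_d {i : ℤ} {f : π.DerSpace} (hf : f ∈ π.Der.gr i) : π.derToEnd (π.Der.d f) =
      π.d * π.derToEnd f - sgn k i • (π.derToEnd f * π.d) := by
  have := π.derToEnd_bracket (i := -1) (f := Tot.of π.der (-1)
    ⟨π.d, π.d_mem_der⟩) ⟨_, rfl⟩ hf
  rw [derToEnd_lof, neg_mul, one_mul, sgn_neg] at this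
  exact this

theorem bracket_mem_der {i : ℤ} {x : L} (hx : x ∈ π.gr i) : π.bracket x ∈ π.der i :=
  ⟨fun _ _ hy => π.bracket_mem hx hy, fun _ _ hy z => π.jacobi hx hy z⟩

/-- The adjoint map `ad : π → Der π`, `ad x = [x, -]`. -/
def ad : L →ₗ[k] π.DerSpace :=
  π.glue fun i => Tot.of π.der i ∘ₗ
    (π.bracket ∘ₗ (π.gr i).subtype).codRestrict (π.der i) (fun x => π.bracket_mem_der x.2)

theorem ad_mem {i : ℤ} {x : L} (hx : x ∈ π.gr i) : π.ad x ∈ π.Der.gr i := by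
  rw [ad, π.glue_apply _ hx]
  exact ⟨_, rfl⟩

theorem derToEnd_ad (x : L) : π.derToEnd (π.ad x) = π.bracket x := by
  have : π.derToEnd ∘ₗ π.ad = π.bracket := π.ext_hom fun i x hx => by
    rw [LinearMap.comp_apply, ad, π.glue_apply _ hx, LinearMap.comp_apply, derToEnd_lof]
    rfl
  exact LinearMap.congr_fun this x

/-- `[f, ad x] = ad (f x)`. -/
theorem bracket_ad (f : π.DerSpace) (x : L) : π.Der.bracket f (π.ad x) = π.ad (π.derToEnd f x) := by
  refine π.Der.induction (P := fun f => π.Der.bracket f (π.ad x) = π.ad (π.derToEnd f x))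
    (fun i f hf => ?_) (fun f g hf hg => ?_) f
  · refine π.induction (P := fun x => π.Der.bracket f (π.ad x) = π.ad (π.derToEnd f x))
      (fun j x hx => ?_) (fun x y hx hy => ?_) x
    · refine π.derToEnd_inj (π.Der.bracket_mem hf (π.ad_mem hx))
        (π.ad_mem ((π.derToEnd_mem hf).1 j x hx)) ?_
      rw [π.derToEnd_bracket hf (π.ad_mem hx), derToEnd_ad, derToEnd_ad]
      refine LinearMap.ext fun y => ?_
      simp [(π.derToEnd_mem hf).2 j x hx y]
    · simp only [map_add, hx, hy]
  · simp only [map_add, LinearMap.add_apply, hf, hg]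

/-- `[d, ad x] = ad (d x)`. -/
theorem d_ad (x : L) : π.Der.d (π.ad x) = π.ad (π.d x) := by
  have := π.bracket_ad (Tot.of π.der (-1) ⟨π.d, π.d_mem_der⟩) x
  rw [derToEnd_lof] at this
  exact this

theorem ad_bracket {i j : ℤ} {x : L} {f : π.DerSpace} (hx : x ∈ π.gr i) (hf : f ∈ π.Der.gr j) :
    π.Der.bracket (π.ad x) f = -(sgn k (i * j) • π.ad (π.derToEnd f x)) := by
  rw [π.Der.skew (π.ad_mem hx) hf, bracket_ad]

/-- The action `[φ, sx] = (-1) ^ |φ| s (φ x)` of `Der π` on `sπ`. -/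
def actLeft : π.DerSpace →ₗ[k] L →ₗ[k] L :=
  Tot.lift π.der fun n => sgn k n • (π.der n).subtype

/-- The map `(φ, x) ↦ -[sx, φ] = (-1) ^ (|sx| |φ|) [φ, sx] = (-1) ^ (|x| |φ|) s (φ x)`. -/
def actRight : π.DerSpace →ₗ[k] L →ₗ[k] L :=
  Tot.lift π.der fun n => LinearMap.lcomp k L (π.sign n) ∘ₗ (π.der n).subtype

theorem actLeft_apply {n : ℤ} {f : π.DerSpace} (hf : f ∈ π.Der.gr n) (x : L) :
    π.actLeft f x = sgn k n • π.derToEnd f x := by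
  obtain ⟨θ, rfl⟩ := hf
  rw [derToEnd_lof, actLeft, Tot.lift_of]
  rfl

theorem actRight_apply {n i : ℤ} {f : π.DerSpace} (hf : f ∈ π.Der.gr n) {x : L}
    (hx : x ∈ π.gr i) : π.actRight f x = sgn k (i * n) • π.derToEnd f x := by
  obtain ⟨θ, rfl⟩ := hf
  rw [derToEnd_lof, actRight, Tot.lift_of]
  simp [π.sign_apply n hx, mul_comm i n]

/-- The underlying space of `sπ ♯ Der π`; the element `sx + φ` is the pair `(x, φ)`. -/
abbrev SemidirectSpace : Type v := L × π.DerSpace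

/-- The bracket of `sπ ♯ Der π`: `[sx + φ, sy + ψ] = [φ, sy] + [sx, ψ] + [φ, ψ]`. -/
def semidirectBracket : π.SemidirectSpace →ₗ[k] π.SemidirectSpace →ₗ[k] π.SemidirectSpace :=
  LinearMap.mk₂ k
    (fun a b => (π.actLeft a.2 b.1 - π.actRight b.2 a.1, π.Der.bracket a.2 b.2))
    (fun a a' b => by
      refine Prod.ext ?_ ?_ <;> simp
      abel)
    (fun c a b => by refine Prod.ext ?_ ?_ <;> simp [smul_sub])
    (fun a b b' => by
      refine Prod.ext ?_ ?_ <;> simp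
      abel)
    (fun c a b => by refine Prod.ext ?_ ?_ <;> simp [smul_sub])

/-- The differential of `sπ ♯ Der π`: `d (sx + φ) = -s (d x) + ad x + [d, φ]`. -/
def semidirectDiff : π.SemidirectSpace →ₗ[k] π.SemidirectSpace :=
  LinearMap.prod (-(π.d ∘ₗ LinearMap.fst k _ _))
    (π.ad ∘ₗ LinearMap.fst k _ _ + π.Der.d ∘ₗ LinearMap.snd k _ _)

theorem semidirectBracket_apply {i j : ℤ} {x y : L} {f g : π.DerSpace} (hx : x ∈ π.gr (i - 1))
    (hf : f ∈ π.Der.gr i) (hg : g ∈ π.Der.gr j) :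
    π.semidirectBracket (x, f) (y, g) =
      (sgn k i • π.derToEnd f y - sgn k ((i - 1) * j) • π.derToEnd g x, π.Der.bracket f g) := by
  rw [← π.actLeft_apply hf, ← π.actRight_apply hg hx]
  rfl

theorem semidirectDiff_apply (x : L) (f : π.DerSpace) :
    π.semidirectDiff (x, f) = (-π.d x, π.ad x + π.Der.d f) := rfl

theorem semidirectBracket_mem {i j : ℤ} {x y : L} {f g : π.DerSpace} (hx : x ∈ π.gr (i - 1))
    (hf : f ∈ π.Der.gr i) (hy : y ∈ π.gr (j - 1)) (hg : g ∈ π.Der.gr j) :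
    sgn k i • π.derToEnd f y - sgn k ((i - 1) * j) • π.derToEnd g x ∈ π.gr (i + j - 1) := by
  refine Submodule.sub_mem _ (Submodule.smul_mem _ _ ?_) (Submodule.smul_mem _ _ ?_)
  · have := (π.derToEnd_mem hf).1 _ y hy
    rwa [show i + j - 1 = i + (j - 1) by ring]
  · have := (π.derToEnd_mem hg).1 _ x hx
    rwa [show i + j - 1 = j + (i - 1) by ring]

/-- The semidirect product dg Lie algebra `sπ ♯ Der π`. -/
def semidirect : DGLieAlgebra k π.SemidirectSpace where
  toGrading := π.shift.prod π.Der.toGrading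
  bracket := π.semidirectBracket
  bracket_mem := by
    rintro i j ⟨x, f⟩ ⟨y, g⟩ ⟨hx, hf⟩ ⟨hy, hg⟩
    rw [π.semidirectBracket_apply hx hf hg]
    exact ⟨π.semidirectBracket_mem hx hf hy hg, π.Der.bracket_mem hf hg⟩
  skew := by
    rintro i j ⟨x, f⟩ ⟨y, g⟩ ⟨hx, hf⟩ ⟨hy, hg⟩
    rw [π.semidirectBracket_apply hx hf hg, π.semidirectBracket_apply hy hg hf]
    refine Prod.ext ?_ (π.Der.skew hf hg)
    simp only [Prod.fst_neg, Prod.smul_fst, smul_sub, smul_smul, sub_mul, sgn_sub, one_mul,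
      mul_comm j i]
    rcases sgn_cases (k := k) (i * j) with h1 | h1 <;>
      rcases sgn_cases (k := k) i with h2 | h2 <;>
      rcases sgn_cases (k := k) j with h3 | h3 <;> simp only [h1, h2, h3] <;> module
  jacobi := by
    rintro i j ⟨x, f⟩ ⟨y, g⟩ ⟨hx, hf⟩ ⟨hy, hg⟩ c
    refine (π.shift.prod π.Der.toGrading).induction (P := fun c =>
      π.semidirectBracket (x, f) (π.semidirectBracket (y, g) c) =
        π.semidirectBracket (π.semidirectBracket (x, f) (y, g)) c +
          sgn k (i * j) • π.semidirectBracket (y, g) (π.semidirectBracket (x, f) c))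
      ?_ (fun a b ha hb => ?_) c
    · rintro l ⟨z, h⟩ ⟨hz, hh⟩
      rw [π.semidirectBracket_apply hy hg hh, π.semidirectBracket_apply hx hf hh,
        π.semidirectBracket_apply hx hf hg,
        π.semidirectBracket_apply hx hf (π.Der.bracket_mem hg hh),
        π.semidirectBracket_apply hy hg (π.Der.bracket_mem hf hh),
        π.semidirectBracket_apply (π.semidirectBracket_mem hx hf hy hg)
          (π.Der.bracket_mem hf hg) hh]
      refine Prod.ext ?_ (π.Der.jacobi hf hg h)
      simp only [Prod.fst_add, Prod.smul_fst, π.derToEnd_bracket hf hg, π.derToEnd_bracket hf hh,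
        π.derToEnd_bracket hg hh, LinearMap.sub_apply, LinearMap.smul_apply,
        Module.End.mul_apply, map_sub, map_smul, smul_sub, smul_smul, sub_mul, add_mul, mul_add,
        sgn_sub, sgn_add, one_mul, mul_comm j i, mul_comm l i, mul_comm l j]
      rcases sgn_cases (k := k) (i * j) with h1 | h1 <;>
        rcases sgn_cases (k := k) (i * l) with h2 | h2 <;>
        rcases sgn_cases (k := k) (j * l) with h3 | h3 <;>
        rcases sgn_cases (k := k) i with h4 | h4 <;>
        rcases sgn_cases (k := k) j with h5 | h5 <;>
        rcases sgn_cases (k := k) l with h6 | h6 <;>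
        simp only [h1, h2, h3, h4, h5, h6] <;> module
    · simp only [map_add, smul_add, ha, hb]
      abel
  d := π.semidirectDiff
  d_mem := by
    rintro i ⟨x, f⟩ ⟨hx, hf⟩
    exact ⟨Submodule.neg_mem _ (π.d_mem hx),
      Submodule.add_mem _ (π.ad_mem hx) (π.Der.d_mem hf)⟩
  d_d := by
    rintro ⟨x, f⟩
    rw [semidirectDiff_apply, semidirectDiff_apply]
    refine Prod.ext ?_ ?_
    · simp [π.d_d]
    · simp [π.Der.d_d, d_ad]
  leibniz := by
    rintro i ⟨x, f⟩ ⟨hx, hf⟩ c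
    refine (π.shift.prod π.Der.toGrading).induction (P := fun c =>
      π.semidirectDiff (π.semidirectBracket (x, f) c) =
        π.semidirectBracket (π.semidirectDiff (x, f)) c +
          sgn k i • π.semidirectBracket (x, f) (π.semidirectDiff c))
      ?_ (fun a b ha hb => ?_) c
    · rintro j ⟨y, g⟩ ⟨hy, hg⟩
      rw [π.semidirectBracket_apply hx hf hg, semidirectDiff_apply, semidirectDiff_apply,
        semidirectDiff_apply,
        π.semidirectBracket_apply (i := i - 1) (Submodule.neg_mem _ (π.d_mem hx))
          (Submodule.add_mem _ (π.ad_mem hx) (π.Der.d_mem hf)) hg,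
        π.semidirectBracket_apply (j := j - 1) hx hf
          (Submodule.add_mem _ (π.ad_mem hy) (π.Der.d_mem hg))]
      refine Prod.ext ?_ ?_
      · have hs : π.bracket y x = -(sgn k ((j - 1) * (i - 1)) • π.bracket x y) := π.skew hy hx
        simp only [Prod.fst_add, Prod.smul_fst, map_add, π.derToEnd_d hf, π.derToEnd_d hg,
          derToEnd_ad, LinearMap.sub_apply, LinearMap.smul_apply, LinearMap.add_apply, hs, map_neg,
          Module.End.mul_apply, map_sub, map_smul, smul_sub, smul_smul, sub_mul, mul_sub,
          sgn_sub, sgn_one, one_mul, mul_one, mul_comm j i, smul_neg, smul_add]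
        rcases sgn_cases (k := k) (i * j) with h1 | h1 <;>
          rcases sgn_cases (k := k) i with h4 | h4 <;>
          rcases sgn_cases (k := k) j with h5 | h5 <;>
          simp only [h1, h4, h5] <;> module
      · have h1 := π.ad_bracket hx hg
        have h2 := π.bracket_ad f y
        simp only [Prod.snd_add, Prod.smul_snd, map_add, map_sub, map_smul, LinearMap.add_apply,
          h1, h2, π.Der.leibniz hf, smul_add]
        abel
    · simp only [map_add, smul_add, ha, hb]
      abel

/-- The ideal `ad π` of `Der π`. -/
def adRange : Submodule k π.DerSpace := LinearMap.range π.ad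

/-- The quotient of a dg Lie algebra by a (homogeneous, differential) ideal. -/
def quotient (I : Submodule k L) (hI : ∀ n, ∀ x ∈ I, π.proj n x ∈ I)
    (hl : ∀ x, ∀ y ∈ I, π.bracket x y ∈ I) (hr : ∀ x ∈ I, ∀ y, π.bracket x y ∈ I)
    (hd : ∀ x ∈ I, π.d x ∈ I) : DGLieAlgebra k (L ⧸ I) where
  toGrading := π.toGrading.quotient I hI
  bracket := I.liftQ (Submodule.mapQLinear I I ∘ₗ
    π.bracket.codRestrict (Submodule.compatibleMaps I I) hl) (by
      intro x hx
      rw [LinearMap.mem_ker]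
      refine LinearMap.ext fun y => ?_
      obtain ⟨y, rfl⟩ := I.mkQ_surjective y
      exact (Submodule.Quotient.mk_eq_zero I).2 (hr x hx y))
  bracket_mem := by
    rintro i j _ _ ⟨x, hx, rfl⟩ ⟨y, hy, rfl⟩
    exact ⟨π.bracket x y, π.bracket_mem hx hy, rfl⟩
  skew := by
    rintro i j _ _ ⟨x, hx, rfl⟩ ⟨y, hy, rfl⟩
    exact congrArg I.mkQ (π.skew hx hy)
  jacobi := by
    rintro i j _ _ ⟨x, hx, rfl⟩ ⟨y, hy, rfl⟩ z
    obtain ⟨z, rfl⟩ := I.mkQ_surjective z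
    exact congrArg I.mkQ (π.jacobi hx hy z)
  d := I.mapQ I π.d hd
  d_mem := by
    rintro i _ ⟨x, hx, rfl⟩
    exact ⟨π.d x, π.d_mem hx, rfl⟩
  d_d := by
    intro x
    obtain ⟨x, rfl⟩ := I.mkQ_surjective x
    exact (congrArg I.mkQ (π.d_d x)).trans (map_zero _)
  leibniz := by
    rintro i _ ⟨x, hx, rfl⟩ y
    obtain ⟨y, rfl⟩ := I.mkQ_surjective y
    exact congrArg I.mkQ (π.leibniz hx y)

theorem proj_ad (n : ℤ) (x : L) : π.Der.proj n (π.ad x) = π.ad (π.proj n x) := by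
  have : π.Der.proj n ∘ₗ π.ad = π.ad ∘ₗ π.proj n := π.ext_hom fun i x hx => by
    by_cases h : i = n
    · subst h
      simp [π.proj_same hx, π.Der.proj_same (π.ad_mem hx)]
    · simp [π.proj_ne h hx, π.Der.proj_ne h (π.ad_mem hx)]
  exact LinearMap.congr_fun this x

theorem ad_bracket_mem (x : L) (f : π.DerSpace) : π.Der.bracket (π.ad x) f ∈ π.adRange := by
  refine π.induction (P := fun x => π.Der.bracket (π.ad x) f ∈ π.adRange)
    (fun i x hx => ?_) (fun x y hx hy => ?_) x
  · refine π.Der.induction (P := fun f => π.Der.bracket (π.ad x) f ∈ π.adRange)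
      (fun j f hf => ?_) (fun f g hf hg => ?_) f
    · rw [π.ad_bracket hx hf]
      exact Submodule.neg_mem _ (Submodule.smul_mem _ _ ⟨_, rfl⟩)
    · rw [map_add]
      exact Submodule.add_mem _ hf hg
  · rw [map_add, map_add]
    exact Submodule.add_mem _ hx hy

/-- The dg Lie algebra `Der π / ad π` of outer derivations. -/
def outer : DGLieAlgebra k (π.DerSpace ⧸ π.adRange) :=
  π.Der.quotient π.adRange
    (by rintro n _ ⟨x, rfl⟩; exact ⟨_, (π.proj_ad n x).symm⟩)
    (by rintro f _ ⟨x, rfl⟩; exact ⟨_, (π.bracket_ad f x).symm⟩)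
    (by rintro _ ⟨x, rfl⟩ f; exact π.ad_bracket_mem x f)
    (by rintro _ ⟨x, rfl⟩; exact ⟨_, (π.d_ad x).symm⟩)

/-- The projection `sπ ♯ Der π → Der π / ad π`, `sx + φ ↦ [φ]`. -/
def toOuter : Hom π.semidirect π.outer where
  toLin := π.adRange.mkQ ∘ₗ LinearMap.snd k L π.DerSpace
  isHom :=
    { map_mem := by
        rintro i ⟨x, f⟩ ⟨_, hf⟩
        exact ⟨f, hf, rfl⟩
      map_bracket := fun _ _ => rfl }
  map_d := by
    rintro ⟨x, f⟩
    have h : π.adRange.mkQ (π.ad x) = 0 := (Submodule.Quotient.mk_eq_zero _).2 ⟨x, rfl⟩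
    exact (map_add π.adRange.mkQ (π.ad x) (π.Der.d f)).trans (by rw [h, zero_add]; rfl)

end DGLieAlgebra

end Derivations

/-! ### The symmetric coalgebra of a graded vector space -/

section GSym

variable {k : Type u} [Field k] {V : Type v} [AddCommGroup V] [Module k V]
  {W : Type w} [AddCommGroup W] [Module k W]

/-- Graded commutativity relations in the tensor algebra. -/
inductive Grading.CommRel (G : Grading k V) : TensorAlgebra k V → TensorAlgebra k V → Prop
  | intro (i j : ℤ) (x y : V) (hx : x ∈ G.gr i) (hy : y ∈ G.gr j) :
      CommRel G (TensorAlgebra.ι k x * TensorAlgebra.ι k y)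
        (sgn k (i * j) • (TensorAlgebra.ι k y * TensorAlgebra.ι k x))

/-- The graded symmetric algebra `S(V)` of a graded vector space: the quotient of the tensor
algebra by the relations `x y = (-1) ^ (|x| |y|) y x`. -/
def GSym (G : Grading k V) : Type (max u v) := RingQuot G.CommRel

namespace GSym

variable (G : Grading k V)

instance : Ring (GSym G) := inferInstanceAs (Ring (RingQuot G.CommRel))

instance : Algebra k (GSym G) := inferInstanceAs (Algebra k (RingQuot G.CommRel))

/-- The quotient map from the tensor algebra. -/
def mk : TensorAlgebra k V →ₐ[k] GSym G := RingQuot.mkAlgHom k G.CommRel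

/-- The inclusion `V → S(V)`. -/
def ι : V →ₗ[k] GSym G := (mk G).toLinearMap ∘ₗ TensorAlgebra.ι k

theorem ι_comm {i j : ℤ} {x y : V} (hx : x ∈ G.gr i) (hy : y ∈ G.gr j) :
    ι G x * ι G y = sgn k (i * j) • (ι G y * ι G x) := by
  have := RingQuot.mkAlgHom_rel k (Grading.CommRel.intro (G := G) i j x y hx hy)
  rwa [map_smul, map_mul, map_mul] at this

/-- The universal property of `S(V)`. -/
def lift {A : Type w} [Ring A] [Algebra k A] (f : V →ₗ[k] A)
    (hf : ∀ i j x y, x ∈ G.gr i → y ∈ G.gr j → f x * f y = sgn k (i * j) • (f y * f x)) :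
    GSym G →ₐ[k] A :=
  RingQuot.liftAlgHom k ⟨TensorAlgebra.lift k f, by
    rintro _ _ ⟨i, j, x, y, hx, hy⟩
    simp only [map_smul, map_mul, TensorAlgebra.lift_ι_apply]
    exact hf i j x y hx hy⟩

theorem lift_ι {A : Type w} [Ring A] [Algebra k A] (f : V →ₗ[k] A)
    (hf : ∀ i j x y, x ∈ G.gr i → y ∈ G.gr j → f x * f y = sgn k (i * j) • (f y * f x)) (x : V) :
    lift G f hf (ι G x) = f x := by
  have := RingQuot.liftAlgHom_mkAlgHom_apply k (TensorAlgebra.lift k f) (s := G.CommRel) (by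
    rintro _ _ ⟨i, j, x, y, hx, hy⟩
    simp only [map_smul, map_mul, TensorAlgebra.lift_ι_apply]
    exact hf i j x y hx hy) (TensorAlgebra.ι k x)
  rw [TensorAlgebra.lift_ι_apply] at this
  exact this

theorem induction {P : GSym G → Prop} (one : P 1) (smul : ∀ (c : k) a, P a → P (c • a))
    (add : ∀ a b, P a → P b → P (a + b))
    (mul : ∀ i, ∀ x ∈ G.gr i, ∀ a, P a → P (ι G x * a)) (a : GSym G) : P a := by
  have mul' : ∀ x a, P a → P (ι G x * a) := fun x a ha =>
    G.induction (P := fun x => P (ι G x * a)) (fun i x hx => mul i x hx a ha)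
      (fun x y hx hy => by rw [map_add, add_mul]; exact add _ _ hx hy) x
  obtain ⟨t, rfl⟩ : ∃ t, mk G t = a := RingQuot.mkAlgHom_surjective k G.CommRel a
  have key : ∀ t : TensorAlgebra k V, ∀ a : GSym G, P a → P (mk G t * a) := by
    intro t
    refine TensorAlgebra.induction (C := fun t => ∀ a : GSym G, P a → P (mk G t * a)) ?_ ?_ ?_ ?_ t
    · intro r a ha
      rw [AlgHom.commutes, ← Algebra.smul_def]
      exact smul r a ha
    · intro x a ha
      exact mul' x a ha
    · intro s t hs ht a ha
      rw [map_mul, mul_assoc]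
      exact hs _ (ht _ ha)
    · intro s t hs ht a ha
      rw [map_add, add_mul]
      exact add _ _ (hs _ ha) (ht _ ha)
  have := key t 1 one
  rwa [mul_one] at this

variable {G} in
/-- Linear maps out of `S(V)` satisfying the same recursion are equal. -/
theorem ext_rec {f g : GSym G →ₗ[k] W} (one : f 1 = g 1)
    (mul : ∀ i, ∀ x ∈ G.gr i, ∀ a, f a = g a → f (ι G x * a) = g (ι G x * a)) : f = g :=
  LinearMap.ext fun a => induction G (P := fun a => f a = g a) one
    (fun c a h => by rw [map_smul, map_smul, h]) (fun a b ha hb => by rw [map_add, map_add, ha, hb])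
    mul a

/-- The component of degree `n` of `S(V)`: the span of the products of homogeneous elements of `V`
whose degrees add up to `n`. -/
def deg (n : ℤ) : Submodule k (GSym G) :=
  Submodule.span k {a | ∃ l : List (ℤ × V), (∀ p ∈ l, p.2 ∈ G.gr p.1) ∧
    (l.map Prod.fst).sum = n ∧ (l.map fun p => ι G p.2).prod = a}

theorem one_mem : (1 : GSym G) ∈ deg G 0 :=
  Submodule.subset_span ⟨[], by simp, rfl, rfl⟩

variable {G} in
theorem ι_mul_mem {i n : ℤ} {x : V} (hx : x ∈ G.gr i) {a : GSym G} (ha : a ∈ deg G n) :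
    ι G x * a ∈ deg G (i + n) := by
  have h : deg G n ≤ (deg G (i + n)).comap (LinearMap.mulLeft k (ι G x)) := by
    refine Submodule.span_le.2 ?_
    rintro _ ⟨l, hl, hn, rfl⟩
    refine Submodule.subset_span ⟨(i, x) :: l, ?_, by simp [hn], by simp⟩
    rintro p hp
    rcases List.mem_cons.1 hp with rfl | hp
    · exact hx
    · exact hl p hp
  exact h ha

variable {G} in
theorem deg_induction {P : ℤ → GSym G → Prop} (zero : ∀ n, P n 0) (one : P 0 1)
    (smul : ∀ n (c : k) a, P n a → P n (c • a)) (add : ∀ n a b, P n a → P n b → P n (a + b))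
    (mul : ∀ i, ∀ x ∈ G.gr i, ∀ n, ∀ a ∈ deg G n, P n a → P (i + n) (ι G x * a))
    {n : ℤ} {a : GSym G} (ha : a ∈ deg G n) : P n a := by
  refine Submodule.span_induction (p := fun a _ => P n a) ?_ (zero n)
    (fun a b _ _ => add n a b) (fun c a _ => smul n c a) ha
  rintro _ ⟨l, hl, rfl, rfl⟩
  clear ha
  induction l with
  | nil => exact one
  | cons p l ih =>
    simp only [List.map_cons, List.sum_cons, List.prod_cons]
    have hl' : ∀ q ∈ l, q.2 ∈ G.gr q.1 := fun q hq => hl q (List.mem_cons_of_mem _ hq)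
    have hmem : (l.map fun p => ι G p.2).prod ∈ deg G (l.map Prod.fst).sum :=
      Submodule.subset_span ⟨l, hl', rfl, rfl⟩
    exact mul p.1 p.2 (hl p List.mem_cons_self) _ _ hmem (ih hl')

/-- Auxiliary: the algebra map `x ↦ x t ^ |x|` to Laurent polynomials, used to separate degrees. -/
def coact : GSym G →ₐ[k] AddMonoidAlgebra (GSym G) ℤ :=
  lift G (G.glue fun i => AddMonoidAlgebra.lsingle (R := k) i ∘ₗ ι G ∘ₗ (G.gr i).subtype) (by
    intro i j x y hx hy
    rw [G.glue_apply _ hx, G.glue_apply _ hy]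
    change AddMonoidAlgebra.single i (ι G x) * AddMonoidAlgebra.single j (ι G y) =
      sgn k (i * j) • (AddMonoidAlgebra.single j (ι G y) * AddMonoidAlgebra.single i (ι G x))
    rw [AddMonoidAlgebra.single_mul_single, AddMonoidAlgebra.single_mul_single, add_comm j i,
      AddMonoidAlgebra.smul_single, ι_comm G hx hy])

theorem coact_ι {i : ℤ} {x : V} (hx : x ∈ G.gr i) :
    coact G (ι G x) = AddMonoidAlgebra.single i (ι G x) :=
  (lift_ι G _ _ x).trans (G.glue_apply _ hx)

theorem coact_of_mem {n : ℤ} {a : GSym G} (ha : a ∈ deg G n) :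
    coact G a = AddMonoidAlgebra.single n a := by
  refine deg_induction (P := fun n a => coact G a = AddMonoidAlgebra.single n a) ?_ ?_ ?_ ?_ ?_ ha
  · intro n; simp
  · rw [map_one]; rfl
  · intro n c a h
    rw [map_smul, h, AddMonoidAlgebra.smul_single]
  · intro n a b ha hb
    rw [map_add, ha, hb, AddMonoidAlgebra.single_add]
  · intro i x hx n a _ h
    rw [map_mul, h, coact_ι G hx]
    exact AddMonoidAlgebra.single_mul_single _ _ _ _

/-- Auxiliary: the coefficient of `t ^ n` of a Laurent polynomial. -/
def coeffAt (n : ℤ) : AddMonoidAlgebra (GSym G) ℤ →ₗ[k] GSym G where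
  toFun f := f.coeff n
  map_add' f g := by rw [AddMonoidAlgebra.coeff_add]; rfl
  map_smul' c f := AddMonoidAlgebra.coeff_smul_apply c f n

/-- The grading of `S(V)` by total degree. -/
def grading : Grading k (GSym G) where
  gr := deg G
  internal := by
    refine internal_of_proj _ (fun n => coeffAt G n ∘ₗ (coact G).toLinearMap) ?_ ?_ ?_
    · intro n x hx
      change coeffAt G n (coact G x) = x
      rw [coact_of_mem G hx]
      exact Finsupp.single_eq_same
    · intro m n h x hx
      change coeffAt G n (coact G x) = 0
      rw [coact_of_mem G hx]
      exact Finsupp.single_eq_of_ne (Ne.symm h)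
    · intro a
      refine induction G (P := fun a => a ∈ ⨆ n, deg G n)
        (Submodule.mem_iSup_of_mem 0 (one_mem G)) (fun c a h => Submodule.smul_mem _ c h)
        (fun a b ha hb => Submodule.add_mem _ ha hb) ?_ a
      intro i x hx a ha
      refine Submodule.iSup_induction (deg G) (motive := fun a => ι G x * a ∈ ⨆ n, deg G n) ha
        (fun n a ha => Submodule.mem_iSup_of_mem (i + n) (ι_mul_mem hx ha)) (by simp) ?_
      intro a b ha hb
      rw [mul_add]
      exact Submodule.add_mem _ ha hb

/-- Left multiplication by elements of `V`. -/
def mulL : V →ₗ[k] Module.End k (GSym G) := LinearMap.mul k (GSym G) ∘ₗ ι G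

theorem mulL_apply (x : V) (a : GSym G) : mulL G x a = ι G x * a := rfl

variable {G} in
theorem mulL_mem {i : ℤ} {x : V} (hx : x ∈ G.gr i) : mulL G x ∈ (grading G).homDeg i :=
  fun _ _ ha => ι_mul_mem hx ha

variable {G} in
theorem mulL_comm {i j : ℤ} {x y : V} (hx : x ∈ G.gr i) (hy : y ∈ G.gr j) :
    mulL G x * mulL G y = sgn k (i * j) • (mulL G y * mulL G x) := by
  refine LinearMap.ext fun a => ?_
  simp only [Module.End.mul_apply, LinearMap.smul_apply, mulL_apply, ← mul_assoc,
    ι_comm G hx hy, smul_mul_assoc]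

/-- Multiplication by `x ⊗ 1 + 1 ⊗ x` (with Koszul signs) on `S(V) ⊗ S(V)`, for `x` in `V`. -/
def comulOp : V →ₗ[k] Module.End k (GSym G ⊗[k] GSym G) :=
  G.glue fun i => (grading G).tensorOp i ∘ₗ mulL G ∘ₗ (G.gr i).subtype

theorem comulOp_apply {i : ℤ} {x : V} (hx : x ∈ G.gr i) :
    comulOp G x = (grading G).tensorOp i (mulL G x) := G.glue_apply _ hx

/-- The algebra of operators on `S(V) ⊗ S(V)` generated by the `x ⊗ 1 + 1 ⊗ x`. -/
def comulHom : GSym G →ₐ[k] Module.End k (GSym G ⊗[k] GSym G) :=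
  lift G (comulOp G) (by
    intro i j x y hx hy
    rw [comulOp_apply G hx, comulOp_apply G hy, ← sub_eq_zero,
      Grading.tensorOp_commutator _ (mulL_mem hx) (mulL_mem hy), mulL_comm hx hy, sub_self,
      map_zero])

/-- The coproduct of `S(V)`: the multiplicative map with `Δ x = x ⊗ 1 + 1 ⊗ x` for `x` in `V`
(the unshuffle coproduct). -/
def comul : GSym G →ₗ[k] GSym G ⊗[k] GSym G :=
  LinearMap.applyₗ (R := k) (1 ⊗ₜ[k] 1 : GSym G ⊗[k] GSym G) ∘ₗ (comulHom G).toLinearMap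

theorem comul_one : comul G 1 = 1 ⊗ₜ[k] 1 := by
  simp [comul]

variable {G} in
/-- `Δ (x a) = (x ⊗ 1 + 1 ⊗ x) Δ a`. -/
theorem comul_ι_mul {i : ℤ} {x : V} (hx : x ∈ G.gr i) (a : GSym G) :
    comul G (ι G x * a) = (grading G).tensorOp i (mulL G x) (comul G a) := by
  have h : comulHom G (ι G x) = comulOp G x := lift_ι G _ _ x
  simp [comul, map_mul, h, comulOp_apply G hx]

/-- The counit of `S(V)`: the augmentation that vanishes on `V`. -/
def counit : GSym G →ₐ[k] k := lift G 0 (by simp)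

theorem counit_ι_mul (x : V) (a : GSym G) : counit G (ι G x * a) = 0 := by
  have h : counit G (ι G x) = 0 := lift_ι G _ _ x
  rw [map_mul, h, zero_mul]

/-- Auxiliary operators on `k × V`: `x` acts by `(c, v) ↦ (0, c x)`. -/
def coprojOp : V →ₗ[k] Module.End k (k × V) where
  toFun x := LinearMap.prod 0 ((LinearMap.fst k k V).smulRight x)
  map_add' x y := by ext <;> simp
  map_smul' c x := by ext <;> simp

/-- Auxiliary: the action of `S(V)` on `k × V`. -/
def coprojHom : GSym G →ₐ[k] Module.End k (k × V) :=
  lift G coprojOp (by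
    intro i j x y _ _
    ext <;> simp [coprojOp])

/-- The projection `S(V) → V` of the cofree coalgebra onto its cogenerators: it is the identity on
`V` and vanishes on `1` and on products of at least two elements of `V`. -/
def coproj : GSym G →ₗ[k] V :=
  LinearMap.snd k k V ∘ₗ LinearMap.applyₗ (R := k) ((1, 0) : k × V) ∘ₗ
    (coprojHom G).toLinearMap

theorem coproj_one : coproj G 1 = 0 := by
  simp [coproj]

theorem coproj_ι_mul (x : V) (a : GSym G) : coproj G (ι G x * a) = counit G a • x := by
  have h : ∀ x, coprojHom G (ι G x) = coprojOp x := fun x => lift_ι G _ _ x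
  have h1 : ∀ a, (coprojHom G a (1, 0)).1 = counit G a := fun a =>
    LinearMap.congr_fun (f := LinearMap.fst k k V ∘ₗ LinearMap.applyₗ (R := k) ((1, 0) : k × V) ∘ₗ
      (coprojHom G).toLinearMap) (g := (counit G).toLinearMap)
      (ext_rec (by simp) (fun i x hx a _ => by simp [h, coprojOp, counit_ι_mul])) a
  simp [coproj, h, coprojOp, h1]

theorem coproj_ι (x : V) : coproj G (ι G x) = x := by
  have := coproj_ι_mul G x 1
  rwa [mul_one, map_one, one_smul] at this

variable {G} in
theorem sign_one (n : ℤ) : (grading G).sign n 1 = 1 := by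
  rw [(grading G).sign_apply n (one_mem G), mul_zero, sgn_zero, one_smul]

variable {G} in
theorem sign_ι_mul (n : ℤ) {i : ℤ} {x : V} (hx : x ∈ G.gr i) (a : GSym G) :
    (grading G).sign n (ι G x * a) = sgn k (n * i) • (ι G x * (grading G).sign n a) :=
  (grading G).sign_comp (mulL_mem hx) n a

theorem comul_sign (n : ℤ) : comul G ∘ₗ (grading G).sign n =
    TensorProduct.map ((grading G).sign n) ((grading G).sign n) ∘ₗ comul G := by
  refine ext_rec ?_ ?_
  · simp [sign_one, comul_one]
  · intro i x hx a h
    simp only [LinearMap.comp_apply] at h ⊢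
    rw [sign_ι_mul n hx, map_smul, comul_ι_mul hx, comul_ι_mul hx, h]
    refine LinearMap.congr_fun (f := sgn k (n * i) • ((grading G).tensorOp i (mulL G x) ∘ₗ
      TensorProduct.map ((grading G).sign n) ((grading G).sign n)))
      (g := TensorProduct.map ((grading G).sign n) ((grading G).sign n) ∘ₗ
        (grading G).tensorOp i (mulL G x)) (TensorProduct.ext' fun a b => ?_) _
    simp only [LinearMap.smul_apply, LinearMap.comp_apply, TensorProduct.map_tmul,
      Grading.tensorOp_tmul, map_add, mulL_apply, sign_ι_mul n hx, Grading.sign_sign,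
      TensorProduct.smul_tmul, TensorProduct.tmul_smul, smul_add, add_comm n i]

theorem counit_sign (n : ℤ) (a : GSym G) : counit G ((grading G).sign n a) = counit G a :=
  LinearMap.congr_fun (f := (counit G).toLinearMap ∘ₗ (grading G).sign n)
    (g := (counit G).toLinearMap)
    (ext_rec (by simp [sign_one]) (fun i x hx a _ => by
      simp [sign_ι_mul n hx, counit_ι_mul])) a

/-- Auxiliary: the operator `x ⊗ 1 ⊗ 1 + 1 ⊗ x ⊗ 1 + 1 ⊗ 1 ⊗ x`, with Koszul signs. -/
def tripleOp (i : ℤ) (x : V) : Module.End k (GSym G ⊗[k] (GSym G ⊗[k] GSym G)) :=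
  (mulL G x).rTensor _ +
    TensorProduct.map ((grading G).sign i) ((grading G).tensorOp i (mulL G x))

/-- `S(V)` is a coassociative, counital coalgebra. -/
instance : Coalgebra k (GSym G) where
  comul := comul G
  counit := (counit G).toLinearMap
  coassoc := by
    refine ext_rec ?_ ?_
    · simp [comul_one]
    · intro i x hx a h
      simp only [LinearMap.comp_apply, LinearEquiv.coe_coe] at h ⊢
      rw [comul_ι_mul hx]
      have h1 : ∀ z : GSym G ⊗[k] GSym G,
          TensorProduct.assoc k _ _ _ ((comul G).rTensor _
            ((grading G).tensorOp i (mulL G x) z)) = tripleOp G i x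
            (TensorProduct.assoc k _ _ _ ((comul G).rTensor _ z)) := by
        intro z
        induction z using TensorProduct.induction_on with
        | zero => simp
        | add z w hz hw => simp only [map_add, hz, hw]
        | tmul b c =>
          have hs := LinearMap.congr_fun (comul_sign G i) b
          simp only [LinearMap.comp_apply] at hs
          simp only [Grading.tensorOp_tmul, map_add, LinearMap.rTensor_tmul, mulL_apply,
            comul_ι_mul hx, hs]
          generalize comul G b = w
          induction w using TensorProduct.induction_on with
          | zero => simp
          | add z w hz hw =>
            simp only [map_add, TensorProduct.add_tmul] at hz hw ⊢
            rw [← hz, ← hw]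
            abel
          | tmul p q =>
            simp only [Grading.tensorOp_tmul, TensorProduct.add_tmul, map_add,
              TensorProduct.assoc_tmul, TensorProduct.map_tmul, tripleOp, LinearMap.add_apply,
              LinearMap.rTensor_tmul, mulL_apply, TensorProduct.tmul_add]
            abel
      have h2 : ∀ z : GSym G ⊗[k] GSym G,
          (comul G).lTensor _ ((grading G).tensorOp i (mulL G x) z) = tripleOp G i x
            ((comul G).lTensor _ z) := by
        intro z
        induction z using TensorProduct.induction_on with
        | zero => simp
        | add z w hz hw => simp only [map_add, hz, hw]
        | tmul b c =>
          simp only [Grading.tensorOp_tmul, map_add, LinearMap.lTensor_tmul, mulL_apply,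
            comul_ι_mul hx, tripleOp, LinearMap.add_apply, LinearMap.rTensor_tmul,
            TensorProduct.map_tmul]
      rw [h1, h2, h]
  rTensor_counit_comp_comul := by
    refine ext_rec ?_ ?_
    · simp [comul_one]
    · intro i x hx a h
      simp only [LinearMap.comp_apply] at h ⊢
      rw [comul_ι_mul hx]
      have h1 : ∀ z : GSym G ⊗[k] GSym G,
          (counit G).toLinearMap.rTensor _ ((grading G).tensorOp i (mulL G x) z) =
            (mulL G x).lTensor _ ((counit G).toLinearMap.rTensor _ z) := by
        intro z
        induction z using TensorProduct.induction_on with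
        | zero => simp
        | add z w hz hw => simp only [map_add, hz, hw]
        | tmul b c =>
          simp [Grading.tensorOp_tmul, mulL_apply, counit_ι_mul, counit_sign]
      rw [h1, h]
      simp [mulL_apply]
  lTensor_counit_comp_comul := by
    refine ext_rec ?_ ?_
    · simp [comul_one]
    · intro i x hx a h
      simp only [LinearMap.comp_apply] at h ⊢
      rw [comul_ι_mul hx]
      have h1 : ∀ z : GSym G ⊗[k] GSym G,
          (counit G).toLinearMap.lTensor _ ((grading G).tensorOp i (mulL G x) z) =
            (mulL G x).rTensor _ ((counit G).toLinearMap.lTensor _ z) := by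
        intro z
        induction z using TensorProduct.induction_on with
        | zero => simp
        | add z w hz hw => simp only [map_add, hz, hw]
        | tmul b c =>
          simp [Grading.tensorOp_tmul, mulL_apply, counit_ι_mul]
      rw [h1, h]
      simp [mulL_apply]

end GSym

end GSym

/-! ### Differential graded coalgebras and coderivations -/

section Coalg

variable {k : Type u} [Field k]

/-- The component of degree `n` of `V ⊗ V`. -/
def Grading.tensorDeg {V : Type v} [AddCommGroup V] [Module k V] (G : Grading k V) (n : ℤ) :
    Submodule k (V ⊗[k] V) :=
  Submodule.span k {z | ∃ i j : ℤ, i + j = n ∧ ∃ a ∈ G.gr i, ∃ b ∈ G.gr j, a ⊗ₜ[k] b = z}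

/-- A counital cocommutative differential graded coalgebra, with lower grading and differential of
degree `-1`. -/
structure DGCoalgebra (k : Type u) [Field k] (C : Type v) [AddCommGroup C] [Module k C]
    [Coalgebra k C] extends Grading k C where
  comul_mem : ∀ {n c}, c ∈ gr n → Coalgebra.comul (R := k) c ∈ toGrading.tensorDeg n
  counit_eq_zero : ∀ {n c}, c ∈ gr n → n ≠ 0 → Coalgebra.counit (R := k) c = 0
  cocomm : ∀ c, toGrading.braid (Coalgebra.comul (R := k) c) = Coalgebra.comul c
  d : C →ₗ[k] C
  d_mem : ∀ {n c}, c ∈ gr n → d c ∈ gr (n - 1)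
  d_d : ∀ c, d (d c) = 0
  comul_d : ∀ c, Coalgebra.comul (R := k) (d c) = toGrading.tensorOp (-1) d (Coalgebra.comul c)

namespace DGCoalgebra

variable {C : Type v} [AddCommGroup C] [Module k C] [Coalgebra k C] (A : DGCoalgebra k C)

/-- The coderivations of degree `n`: maps `θ` of degree `n` with
`Δ θ = (θ ⊗ 1 + 1 ⊗ θ) Δ`. -/
def coder (n : ℤ) : Submodule k (Module.End k C) where
  carrier := {θ | θ ∈ A.homDeg n ∧
    ∀ c, Coalgebra.comul (R := k) (θ c) = A.tensorOp n θ (Coalgebra.comul c)}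
  add_mem' hf hg := ⟨Submodule.add_mem _ hf.1 hg.1, fun c => by
    simp only [LinearMap.add_apply, map_add, hf.2, hg.2]⟩
  zero_mem' := ⟨Submodule.zero_mem _, fun c => by simp⟩
  smul_mem' r f hf := ⟨Submodule.smul_mem _ r hf.1, fun c => by
    simp only [LinearMap.smul_apply, map_smul, hf.2]⟩

theorem coder_commutator {i j : ℤ} {f g : Module.End k C} (hf : f ∈ A.coder i)
    (hg : g ∈ A.coder j) : f * g - sgn k (i * j) • (g * f) ∈ A.coder (i + j) := by
  refine ⟨?_, fun c => ?_⟩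
  · refine Submodule.sub_mem _ ?_ (Submodule.smul_mem _ _ ?_)
    · intro l x hx
      simpa [add_assoc] using hf.1 _ _ (hg.1 l x hx)
    · intro l x hx
      simpa [add_assoc, add_left_comm] using hg.1 _ _ (hf.1 l x hx)
  · rw [← Grading.tensorOp_commutator _ hf.1 hg.1]
    simp only [LinearMap.sub_apply, LinearMap.smul_apply, Module.End.mul_apply, map_sub, map_smul,
      hf.2, hg.2]

theorem d_mem_coder : A.d ∈ A.coder (-1) :=
  ⟨fun i x hx => by simpa [sub_eq_neg_add] using A.d_mem hx, A.comul_d⟩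

/-- The underlying space of `Der C`: the direct sum over `n` of the coderivations of degree `n`. -/
abbrev CoderSpace : Type v := Tot A.coder

/-- The dg Lie algebra `Der C` of coderivations of `C`: graded commutator, differential
`[d, -]`. -/
def Coder : DGLieAlgebra k A.CoderSpace :=
  commDGLie A.coder (fun hf hg => A.coder_commutator hf hg) A.d A.d_mem_coder
    (LinearMap.ext A.d_d)

/-- The underlying linear operator of an element of `Der C`. -/
def coderToEnd : A.CoderSpace →ₗ[k] Module.End k C := Tot.toAmbient A.coder

end DGCoalgebra

end Coalg

/-! ### Extending operators from `V` to `S(V)` -/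

namespace GSym

section Ext

variable {k : Type u} [Field k] {V : Type v} [AddCommGroup V] [Module k V]
  {S : Type w} [AddCommGroup S] [Module k S]

/-- Auxiliary lower triangular operators `(c, e) ↦ (A x c, B x c + D x e)` on `S × S`. -/
def tri (A B D : V →ₗ[k] Module.End k S) : V →ₗ[k] Module.End k (S × S) where
  toFun x := LinearMap.prod (A x ∘ₗ LinearMap.fst k S S)
    (B x ∘ₗ LinearMap.fst k S S + D x ∘ₗ LinearMap.snd k S S)
  map_add' x y := by
    refine LinearMap.ext fun p => Prod.ext (by simp) ?_
    simp
    abel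
  map_smul' c x := by
    refine LinearMap.ext fun p => Prod.ext (by simp) (by simp)

theorem tri_apply (A B D : V →ₗ[k] Module.End k S) (x : V) (c e : S) :
    tri A B D x (c, e) = (A x c, B x c + D x e) := rfl

variable (G : Grading k V)

/-- The operator `T` on `S(V)` determined by `T 1 = 0` and the recursion
`T (x a) = B x a + (-1) ^ (n |x|) x T a`, for `x` in `V`. -/
def recHom (n : ℤ) (B : V →ₗ[k] Module.End k (GSym G))
    (hB : ∀ i j x y, x ∈ G.gr i → y ∈ G.gr j →
      B x * mulL G y + sgn k (n * i) • (mulL G x * B y) =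
        sgn k (i * j) • (B y * mulL G x + sgn k (n * j) • (mulL G y * B x))) :
    GSym G →ₐ[k] Module.End k (GSym G × GSym G) :=
  lift G (tri (mulL G) B (mulL G ∘ₗ G.sign n)) (by
    intro i j x y hx hy
    have h1 := mulL_comm hx hy
    have h2 := hB i j x y hx hy
    refine LinearMap.ext fun ⟨c, e⟩ => ?_
    have h1c := LinearMap.congr_fun h1 c
    have h1e := LinearMap.congr_fun h1 e
    have h2c := LinearMap.congr_fun h2 c
    simp only [Module.End.mul_apply, LinearMap.smul_apply, LinearMap.add_apply] at h1c h1e h2c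
    simp only [Module.End.mul_apply, LinearMap.smul_apply, tri_apply, LinearMap.comp_apply,
      G.sign_apply n hx, G.sign_apply n hy, map_smul, map_add]
    refine Prod.ext h1c ?_
    rw [Prod.smul_snd, ← add_assoc, h2c, h1e]
    module)

/-- The operator `T` on `S(V)` determined by `T 1 = 0` and the recursion
`T (x a) = B x a + (-1) ^ (n |x|) x T a`, for `x` in `V`. -/
def recOp (n : ℤ) (B : V →ₗ[k] Module.End k (GSym G))
    (hB : ∀ i j x y, x ∈ G.gr i → y ∈ G.gr j →
      B x * mulL G y + sgn k (n * i) • (mulL G x * B y) =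
        sgn k (i * j) • (B y * mulL G x + sgn k (n * j) • (mulL G y * B x))) :
    Module.End k (GSym G) :=
  LinearMap.snd k _ _ ∘ₗ LinearMap.applyₗ (R := k) ((1, 0) : GSym G × GSym G) ∘ₗ
    (recHom G n B hB).toLinearMap

section

variable {G} {n : ℤ} {B : V →ₗ[k] Module.End k (GSym G)}
    (hB : ∀ i j x y, x ∈ G.gr i → y ∈ G.gr j →
      B x * mulL G y + sgn k (n * i) • (mulL G x * B y) =
        sgn k (i * j) • (B y * mulL G x + sgn k (n * j) • (mulL G y * B x)))

theorem recOp_one : recOp G n B hB 1 = 0 := by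
  simp [recOp]

theorem recOp_ι_mul {i : ℤ} {x : V} (hx : x ∈ G.gr i) (a : GSym G) :
    recOp G n B hB (ι G x * a) = B x a + sgn k (n * i) • (ι G x * recOp G n B hB a) := by
  have h : ∀ x, recHom G n B hB (ι G x) = tri (mulL G) B (mulL G ∘ₗ G.sign n) x :=
    fun x => lift_ι G _ _ x
  have h1 : ∀ a, (recHom G n B hB a (1, 0)).1 = a := fun a =>
    LinearMap.congr_fun (f := LinearMap.fst k _ _ ∘ₗ
      LinearMap.applyₗ (R := k) ((1, 0) : GSym G × GSym G) ∘ₗ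
      (recHom G n B hB).toLinearMap) (g := LinearMap.id)
      (ext_rec (by simp) (fun i x hx a ha => by
        simp only [LinearMap.comp_apply, LinearMap.applyₗ_apply_apply, AlgHom.toLinearMap_apply,
          LinearMap.fst_apply, LinearMap.id_apply] at ha ⊢
        rw [map_mul, h]
        change mulL G x (recHom G n B hB a (1, 0)).1 = _
        rw [ha, mulL_apply])) a
  simp only [recOp, LinearMap.comp_apply, LinearMap.applyₗ_apply_apply, AlgHom.toLinearMap_apply,
    LinearMap.snd_apply]
  rw [map_mul, h]
  change B x (recHom G n B hB a (1, 0)).1 + mulL G (G.sign n x) (recHom G n B hB a (1, 0)).2 = _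
  rw [h1, G.sign_apply n hx, map_smul, LinearMap.smul_apply, mulL_apply]

theorem recOp_mem (hdeg : ∀ i, ∀ x ∈ G.gr i, B x ∈ (grading G).homDeg (n + i)) :
    recOp G n B hB ∈ (grading G).homDeg n := by
  intro m a ha
  refine deg_induction (P := fun m a => recOp G n B hB a ∈ (grading G).gr (n + m)) ?_ ?_ ?_ ?_ ?_ ha
  · intro m; rw [map_zero]; exact Submodule.zero_mem _
  · rw [recOp_one]; exact Submodule.zero_mem _
  · intro m c a h; rw [map_smul]; exact Submodule.smul_mem _ _ h
  · intro m a b ha hb; rw [map_add]; exact Submodule.add_mem _ ha hb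
  · intro i x hx m a ha h
    rw [recOp_ι_mul hB hx]
    refine Submodule.add_mem _ ?_ (Submodule.smul_mem _ _ ?_)
    · have := hdeg i x hx m a ha
      rwa [add_assoc] at this
    · have := ι_mul_mem hx h
      rwa [show n + (i + m) = i + (n + m) by ring]

/-- The commutator of `recOp` with multiplication by `x` is `B x`. -/
theorem recOp_mulL {i : ℤ} {x : V} (hx : x ∈ G.gr i) :
    recOp G n B hB * mulL G x - sgn k (n * i) • (mulL G x * recOp G n B hB) = B x := by
  refine LinearMap.ext fun a => ?_
  simp only [LinearMap.sub_apply, LinearMap.smul_apply, Module.End.mul_apply, mulL_apply,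
    recOp_ι_mul hB hx, add_sub_cancel_right]

theorem comul_recOp (hdeg : ∀ i, ∀ x ∈ G.gr i, B x ∈ (grading G).homDeg (n + i))
    (hco : ∀ i, ∀ x ∈ G.gr i, ∀ a, comul G (B x a) = (grading G).tensorOp (n + i) (B x) (comul G a))
    (a : GSym G) :
    comul G (recOp G n B hB a) = (grading G).tensorOp n (recOp G n B hB) (comul G a) := by
  have hm := recOp_mem hB hdeg
  refine LinearMap.congr_fun (f := comul G ∘ₗ recOp G n B hB)
    (g := (grading G).tensorOp n (recOp G n B hB) ∘ₗ comul G) (ext_rec ?_ ?_) a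
  · simp [recOp_one, comul_one, Grading.tensorOp_tmul]
  · intro i x hx a h
    simp only [LinearMap.comp_apply] at h ⊢
    have key := (grading G).tensorOp_commutator hm (mulL_mem hx)
    rw [recOp_mulL hB hx] at key
    have key2 := LinearMap.congr_fun key (comul G a)
    simp only [LinearMap.sub_apply, LinearMap.smul_apply, Module.End.mul_apply] at key2
    rw [recOp_ι_mul hB hx, map_add, map_smul, comul_ι_mul hx, comul_ι_mul hx, hco i x hx, h,
      ← key2]
    abel

end

/-- The compatibility needed to extend `θ : V → V` of degree `n` to a derivation of `S(V)`. -/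
theorem derExt_aux {n : ℤ} {θ : Module.End k V} (hθ : θ ∈ G.homDeg n) :
    ∀ i j x y, x ∈ G.gr i → y ∈ G.gr j →
      (mulL G ∘ₗ θ) x * mulL G y + sgn k (n * i) • (mulL G x * (mulL G ∘ₗ θ) y) =
        sgn k (i * j) • ((mulL G ∘ₗ θ) y * mulL G x +
          sgn k (n * j) • (mulL G y * (mulL G ∘ₗ θ) x)) := by
  intro i j x y hx hy
  simp only [LinearMap.comp_apply]
  rw [mulL_comm (hθ i x hx) hy, mulL_comm hx (hθ j y hy)]
  simp only [smul_add, smul_smul, add_mul, mul_add, sgn_add, mul_comm i n]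
  rcases sgn_cases (k := k) (i * j) with h1 | h1 <;>
    rcases sgn_cases (k := k) (n * i) with h2 | h2 <;>
    rcases sgn_cases (k := k) (n * j) with h3 | h3 <;> simp only [h1, h2, h3] <;> module

/-- The derivation of the algebra `S(V)` that extends `θ : V → V` of degree `n`; it is also the
coderivation of `S(V)` that extends `θ`. -/
def derExt {n : ℤ} (θ : G.homDeg n) : Module.End k (GSym G) :=
  recOp G n (mulL G ∘ₗ (θ : Module.End k V)) (derExt_aux G θ.2)

variable {G}

theorem derExt_one {n : ℤ} (θ : G.homDeg n) : derExt G θ 1 = 0 := recOp_one _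

theorem derExt_ι_mul {n : ℤ} (θ : G.homDeg n) {i : ℤ} {x : V} (hx : x ∈ G.gr i) (a : GSym G) :
    derExt G θ (ι G x * a) =
      ι G ((θ : Module.End k V) x) * a + sgn k (n * i) • (ι G x * derExt G θ a) :=
  recOp_ι_mul _ hx a

theorem derExt_mem {n : ℤ} (θ : G.homDeg n) : derExt G θ ∈ (grading G).homDeg n :=
  recOp_mem _ fun i x hx => mulL_mem (θ.2 i x hx)

theorem comul_derExt {n : ℤ} (θ : G.homDeg n) (a : GSym G) :
    comul G (derExt G θ a) = (grading G).tensorOp n (derExt G θ) (comul G a) := by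
  unfold derExt
  refine comul_recOp (derExt_aux G θ.2) (fun i x hx => ?_) (fun i x hx a => ?_) a
  · rw [LinearMap.comp_apply]
    exact mulL_mem (θ.2 i x hx)
  · rw [LinearMap.comp_apply, mulL_apply]
    exact comul_ι_mul (θ.2 i x hx) a

/-- `derExt` as a linear map. -/
def derExtLin (n : ℤ) : G.homDeg n →ₗ[k] Module.End k (GSym G) where
  toFun := derExt G
  map_add' θ φ := ext_rec (by simp [derExt_one]) (fun i x hx a h => by
    simp only [LinearMap.add_apply] at h
    simp only [LinearMap.add_apply, derExt_ι_mul _ hx, h, Submodule.coe_add, map_add, add_mul,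
      mul_add, smul_add]
    abel)
  map_smul' c θ := ext_rec (by simp [derExt_one]) (fun i x hx a h => by
    simp only [LinearMap.smul_apply, RingHom.id_apply] at h
    simp only [LinearMap.smul_apply, RingHom.id_apply, derExt_ι_mul _ hx, h, Submodule.coe_smul,
      map_smul, smul_mul_assoc, mul_smul_comm, smul_add, smul_comm c])

theorem comul_mem {n : ℤ} {a : GSym G} (ha : a ∈ deg G n) :
    comul G a ∈ (grading G).tensorDeg n := by
  refine deg_induction (P := fun n a => comul G a ∈ (grading G).tensorDeg n) ?_ ?_ ?_ ?_ ?_ ha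
  · intro n; rw [map_zero]; exact Submodule.zero_mem _
  · rw [comul_one]
    exact Submodule.subset_span ⟨0, 0, rfl, 1, one_mem G, 1, one_mem G, rfl⟩
  · intro n c a h; rw [map_smul]; exact Submodule.smul_mem _ _ h
  · intro n a b ha hb; rw [map_add]; exact Submodule.add_mem _ ha hb
  · intro i x hx n a _ h
    rw [comul_ι_mul hx]
    have h2 : (grading G).tensorDeg n ≤
        ((grading G).tensorDeg (i + n)).comap ((grading G).tensorOp i (mulL G x)) := by
      refine Submodule.span_le.2 ?_
      rintro _ ⟨p, q, rfl, a, ha, b, hb, rfl⟩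
      change (grading G).tensorOp i (mulL G x) (a ⊗ₜ b) ∈ (grading G).tensorDeg (i + (p + q))
      rw [Grading.tensorOp_tmul]
      refine Submodule.add_mem _ (Submodule.subset_span ?_) (Submodule.subset_span ?_)
      · exact ⟨i + p, q, by ring, _, ι_mul_mem hx ha, b, hb, rfl⟩
      · exact ⟨p, i + q, by ring, _, (grading G).sign_mem i ha, _, ι_mul_mem hx hb, rfl⟩
    exact h2 h

theorem counit_eq_zero {n : ℤ} {a : GSym G} (ha : a ∈ deg G n) : n ≠ 0 → counit G a = 0 := by
  refine deg_induction (P := fun n a => n ≠ 0 → counit G a = 0) ?_ ?_ ?_ ?_ ?_ ha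
  · intro n _; rw [map_zero]
  · intro h; exact absurd rfl h
  · intro n c a h hn; rw [map_smul, h hn, smul_zero]
  · intro n a b ha hb hn; rw [map_add, ha hn, hb hn, add_zero]
  · intro i x hx n a _ _ _; exact counit_ι_mul G x a

theorem braid_comul (a : GSym G) : (grading G).braid (comul G a) = comul G a := by
  refine LinearMap.congr_fun (f := (grading G).braid ∘ₗ comul G) (g := comul G) (ext_rec ?_ ?_) a
  · simp [comul_one, (grading G).braid_tmul (one_mem G), sign_one]
  · intro i x hx a h
    simp only [LinearMap.comp_apply] at h ⊢
    rw [comul_ι_mul hx]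
    conv_rhs => rw [← h]
    generalize comul G a = z
    induction z using TensorProduct.induction_on with
    | zero => simp
    | add z w hz hw => simp only [map_add, hz, hw]
    | tmul b c =>
      refine (grading G).induction (P := fun b => (grading G).braid
        ((grading G).tensorOp i (mulL G x) (b ⊗ₜ c)) =
          (grading G).tensorOp i (mulL G x) ((grading G).braid (b ⊗ₜ c))) ?_ ?_ b
      · intro m b hb
        rw [Grading.tensorOp_tmul, map_add, (grading G).braid_tmul hb,
          (grading G).braid_tmul ((mulL_mem hx) m b hb), (grading G).sign_apply i hb,
          ← TensorProduct.smul_tmul', map_smul, (grading G).braid_tmul hb, Grading.tensorOp_tmul,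
          mulL_apply, mulL_apply, mulL_apply, sign_ι_mul m hx, Grading.sign_sign,
          ← TensorProduct.smul_tmul', smul_smul, mul_comm m i]
        rcases sgn_cases (k := k) (i * m) with h1 | h1 <;> simp only [h1] <;> module
      · intro b b' hb hb'
        simp only [TensorProduct.add_tmul, map_add, hb, hb']

end Ext

end GSym

/-! ### The Chevalley–Eilenberg coalgebra -/

namespace DGLieAlgebra

section CE

open GSym

variable {k : Type u} [Field k] {L : Type v} [AddCommGroup L] [Module k L] (π : DGLieAlgebra k L)

/-- The underlying graded coalgebra `S(sπ)` of the Chevalley–Eilenberg coalgebra. -/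
abbrev CESpace : Type (max u v) := GSym π.shift

theorem shift_bracket_mem {i j : ℤ} {x y : L} (hx : x ∈ π.shift.gr i) (hy : y ∈ π.shift.gr j) :
    π.bracket x y ∈ π.shift.gr (i - 1 + j) := by
  have h : π.bracket x y ∈ π.gr (i - 1 + (j - 1)) := π.bracket_mem hx hy
  rwa [← add_sub_assoc] at h

theorem shift_d_mem {i : ℤ} {x : L} (hx : x ∈ π.shift.gr i) : π.d x ∈ π.shift.gr (i - 1) :=
  π.d_mem hx

/-- For `sx` of degree `i`, the operator `sy ↦ (-1) ^ |x| s [x, y]` on `sπ`. -/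
def shiftAd (i : ℤ) : π.shift.gr i →ₗ[k] π.shift.homDeg (i - 1) :=
  (sgn k (i - 1) • π.bracket ∘ₗ (π.shift.gr i).subtype).codRestrict (π.shift.homDeg (i - 1))
    (fun x _ _ hy => Submodule.smul_mem _ _ (π.shift_bracket_mem x.2 hy))

/-- For `sx` in `sπ`, the derivation of `S(sπ)` that extends `sy ↦ (-1) ^ |x| s [x, y]`. -/
def ceAd : L →ₗ[k] Module.End k π.CESpace :=
  π.shift.glue fun i => derExtLin (i - 1) ∘ₗ π.shiftAd i

theorem ceAd_eq {i : ℤ} {x : L} (hx : x ∈ π.shift.gr i) :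
    π.ceAd x = derExt π.shift (π.shiftAd i ⟨x, hx⟩) := by
  rw [ceAd, π.shift.glue_apply _ hx]
  rfl

theorem ceAd_one (x : L) : π.ceAd x 1 = 0 :=
  π.shift.induction (P := fun x => π.ceAd x 1 = 0)
    (fun i x hx => by rw [ceAd_eq π hx, derExt_one])
    (fun x y hx hy => by rw [map_add, LinearMap.add_apply, hx, hy, add_zero]) x

theorem ceAd_ι_mul {i j : ℤ} {x y : L} (hx : x ∈ π.shift.gr i) (hy : y ∈ π.shift.gr j)
    (a : π.CESpace) :
    π.ceAd x (ι π.shift y * a) = sgn k (i - 1) • (ι π.shift (π.bracket x y) * a) +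
      sgn k ((i - 1) * j) • (ι π.shift y * π.ceAd x a) := by
  have h : (π.shiftAd i ⟨x, hx⟩ : Module.End k L) y = sgn k (i - 1) • π.bracket x y := rfl
  rw [ceAd_eq π hx, derExt_ι_mul _ hy, h, map_smul, smul_mul_assoc]

theorem ceAd_mem {i : ℤ} {x : L} (hx : x ∈ π.shift.gr i) :
    π.ceAd x ∈ (grading π.shift).homDeg (i - 1) := by
  rw [ceAd_eq π hx]
  exact derExt_mem _

theorem comul_ceAd {i : ℤ} {x : L} (hx : x ∈ π.shift.gr i) (a : π.CESpace) :
    comul π.shift (π.ceAd x a) =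
      (grading π.shift).tensorOp (i - 1) (π.ceAd x) (comul π.shift a) := by
  rw [ceAd_eq π hx]
  exact comul_derExt _ a

/-- The graded commutator of the differential of `C(π)` with multiplication by `sx`:
multiplication by `-s (d x)` plus the action of `x`. -/
def ceComm : L →ₗ[k] Module.End k π.CESpace := -(mulL π.shift ∘ₗ π.d) + π.ceAd

theorem ceComm_apply (x : L) (a : π.CESpace) :
    π.ceComm x a = -(ι π.shift (π.d x) * a) + π.ceAd x a := rfl

theorem ceComm_aux : ∀ i j x y, x ∈ π.shift.gr i → y ∈ π.shift.gr j →
    π.ceComm x * mulL π.shift y + sgn k (-1 * i) • (mulL π.shift x * π.ceComm y) =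
      sgn k (i * j) • (π.ceComm y * mulL π.shift x +
        sgn k (-1 * j) • (mulL π.shift y * π.ceComm x)) := by
  intro i j x y hx hy
  refine LinearMap.ext fun a => ?_
  have hs : π.bracket y x = -(sgn k ((j - 1) * (i - 1)) • π.bracket x y) := π.skew hy hx
  have h1 : ∀ b, ι π.shift (π.d x) * (ι π.shift y * b) =
      sgn k ((i - 1) * j) • (ι π.shift y * (ι π.shift (π.d x) * b)) := fun b => by
    rw [← mul_assoc, ι_comm π.shift (π.shift_d_mem hx) hy, smul_mul_assoc, mul_assoc]
  have h2 : ∀ b, ι π.shift (π.d y) * (ι π.shift x * b) =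
      sgn k ((j - 1) * i) • (ι π.shift x * (ι π.shift (π.d y) * b)) := fun b => by
    rw [← mul_assoc, ι_comm π.shift (π.shift_d_mem hy) hx, smul_mul_assoc, mul_assoc]
  simp only [LinearMap.add_apply, LinearMap.smul_apply, Module.End.mul_apply, ceComm_apply,
    mulL_apply, π.ceAd_ι_mul hx hy, π.ceAd_ι_mul hy hx, hs, h1, h2, mul_add, mul_neg, smul_add,
    smul_neg, smul_smul, sgn_sub, sgn_neg, sgn_one, neg_mul, one_mul, mul_one, sub_mul, mul_sub,
    mul_comm j i, map_neg, map_smul, smul_mul_assoc]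
  rcases sgn_cases (k := k) (i * j) with h1 | h1 <;>
    rcases sgn_cases (k := k) i with h2 | h2 <;>
    rcases sgn_cases (k := k) j with h3 | h3 <;> simp only [h1, h2, h3] <;> module

/-- The differential of the Chevalley–Eilenberg coalgebra `C(π) = S(sπ)`, determined by `d 1 = 0`
and `d (sx a) = -s(d x) a + ad_x a - (-1) ^ |x| sx (d a)`, where `ad_x` is the derivation of
`S(sπ)` extending `sy ↦ (-1) ^ |x| s [x, y]`. -/
def ceDiff : Module.End k π.CESpace := recOp π.shift (-1) π.ceComm π.ceComm_aux

theorem ceDiff_one : π.ceDiff 1 = 0 := recOp_one _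

theorem ceDiff_ι_mul {i : ℤ} {x : L} (hx : x ∈ π.shift.gr i) (a : π.CESpace) :
    π.ceDiff (ι π.shift x * a) =
      -(ι π.shift (π.d x) * a) + π.ceAd x a + sgn k i • (ι π.shift x * π.ceDiff a) := by
  have h := recOp_ι_mul π.ceComm_aux hx a
  rw [neg_mul, one_mul, sgn_neg] at h
  exact h

/-- `d (sx) = -s (d x)`. -/
theorem ceDiff_ι (x : L) : π.ceDiff (ι π.shift x) = -ι π.shift (π.d x) := by
  refine π.shift.induction (P := fun x => π.ceDiff (ι π.shift x) = -ι π.shift (π.d x)) ?_ ?_ x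
  · intro i x hx
    have h := π.ceDiff_ι_mul hx 1
    rwa [ceAd_one, ceDiff_one, mul_zero, smul_zero, add_zero, add_zero, mul_one, mul_one] at h
  · intro x y hx hy
    simp only [map_add, hx, hy, neg_add]

/-- `d (sx sy) = (-1) ^ |x| s [x, y] - s(d x) sy - (-1) ^ |sx| sx s(d y)`. -/
theorem ceDiff_ι_mul_ι {i : ℤ} {x y : L} (hx : x ∈ π.gr i) :
    π.ceDiff (ι π.shift x * ι π.shift y) = sgn k i • ι π.shift (π.bracket x y) -
      ι π.shift (π.d x) * ι π.shift y -
      sgn k (i + 1) • (ι π.shift x * ι π.shift (π.d y)) := by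
  have hx' : x ∈ π.shift.gr (i + 1) := by
    change x ∈ π.gr (i + 1 - 1)
    rwa [add_sub_cancel_right]
  refine π.shift.induction (P := fun y => π.ceDiff (ι π.shift x * ι π.shift y) =
    sgn k i • ι π.shift (π.bracket x y) - ι π.shift (π.d x) * ι π.shift y -
      sgn k (i + 1) • (ι π.shift x * ι π.shift (π.d y))) ?_ ?_ y
  · intro j y hy
    have h := π.ceAd_ι_mul hx' hy 1
    rw [ceAd_one, mul_zero, smul_zero, add_zero, mul_one, mul_one, add_sub_cancel_right] at h
    rw [π.ceDiff_ι_mul hx', h, ceDiff_ι, mul_neg, smul_neg]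
    abel
  · intro y z hy hz
    simp only [map_add, mul_add, hy, hz, smul_add]
    abel

theorem ceDiff_mem : π.ceDiff ∈ (grading π.shift).homDeg (-1) :=
  recOp_mem _ fun i x hx => by
    rw [neg_add_eq_sub]
    exact Submodule.add_mem _ (Submodule.neg_mem _ (mulL_mem (π.shift_d_mem hx))) (π.ceAd_mem hx)

theorem comul_ceDiff (a : π.CESpace) : comul π.shift (π.ceDiff a) =
    (grading π.shift).tensorOp (-1) π.ceDiff (comul π.shift a) := by
  unfold ceDiff
  refine comul_recOp π.ceComm_aux (fun i x hx => ?_) (fun i x hx a => ?_) a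
  · rw [neg_add_eq_sub]
    exact Submodule.add_mem _ (Submodule.neg_mem _ (mulL_mem (π.shift_d_mem hx))) (π.ceAd_mem hx)
  · rw [neg_add_eq_sub, ceComm_apply, map_add, map_neg, comul_ι_mul (π.shift_d_mem hx),
      π.comul_ceAd hx, ceComm, LinearMap.add_apply, LinearMap.neg_apply, LinearMap.comp_apply,
      map_add, map_neg, LinearMap.add_apply, LinearMap.neg_apply]

theorem ceAd_bracket {i j : ℤ} {x y : L} (hx : x ∈ π.shift.gr i) (hy : y ∈ π.shift.gr j)
    (a : π.CESpace) : π.ceAd x (π.ceAd y a) = π.ceAd (π.bracket x y) a +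
      sgn k ((i - 1) * (j - 1)) • π.ceAd y (π.ceAd x a) := by
  refine LinearMap.congr_fun (f := π.ceAd x ∘ₗ π.ceAd y) (g := π.ceAd (π.bracket x y) +
    sgn k ((i - 1) * (j - 1)) • (π.ceAd y ∘ₗ π.ceAd x)) (ext_rec ?_ ?_) a
  · simp [ceAd_one]
  · intro l z hz a h
    simp only [LinearMap.comp_apply, LinearMap.add_apply, LinearMap.smul_apply] at h ⊢
    have hj : π.bracket x (π.bracket y z) = π.bracket (π.bracket x y) z +
      sgn k ((i - 1) * (j - 1)) • π.bracket y (π.bracket x z) := π.jacobi hx hy z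
    rw [π.ceAd_ι_mul hx hz, π.ceAd_ι_mul hy hz,
      π.ceAd_ι_mul (π.shift_bracket_mem hx hy) hz, map_add, map_add, map_smul, map_smul, map_smul,
      map_smul, π.ceAd_ι_mul hx hz, π.ceAd_ι_mul hy hz,
      π.ceAd_ι_mul hx (π.shift_bracket_mem hy hz), π.ceAd_ι_mul hy (π.shift_bracket_mem hx hz),
      hj, h]
    simp only [map_add, map_smul, add_mul, mul_add, smul_add, smul_smul, sgn_sub, sgn_add, sgn_one,
      sub_mul, mul_sub, one_mul, mul_one, smul_mul_assoc, mul_smul_comm, mul_comm j i]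
    rcases sgn_cases (k := k) (i * j) with h1 | h1 <;>
      rcases sgn_cases (k := k) (i * l) with h2 | h2 <;>
      rcases sgn_cases (k := k) (j * l) with h3 | h3 <;>
      rcases sgn_cases (k := k) i with h4 | h4 <;>
      rcases sgn_cases (k := k) j with h5 | h5 <;>
      rcases sgn_cases (k := k) l with h6 | h6 <;>
      simp only [h1, h2, h3, h4, h5, h6] <;> module

theorem ceDiff_ceAd {i : ℤ} {x : L} (hx : x ∈ π.shift.gr i) (a : π.CESpace) :
    π.ceDiff (π.ceAd x a) = π.ceAd (π.d x) a + sgn k (i - 1) • π.ceAd x (π.ceDiff a) := by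
  refine LinearMap.congr_fun (f := π.ceDiff ∘ₗ π.ceAd x) (g := π.ceAd (π.d x) +
    sgn k (i - 1) • (π.ceAd x ∘ₗ π.ceDiff)) (ext_rec ?_ ?_) a
  · simp [ceAd_one, ceDiff_one]
  · intro l z hz a h
    simp only [LinearMap.comp_apply, LinearMap.add_apply, LinearMap.smul_apply] at h ⊢
    have hj : π.d (π.bracket x z) = π.bracket (π.d x) z + sgn k (i - 1) • π.bracket x (π.d z) :=
      π.leibniz hx z
    rw [π.ceAd_ι_mul hx hz, π.ceAd_ι_mul (π.shift_d_mem hx) hz, π.ceDiff_ι_mul hz, map_add,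
      map_add, map_add, map_smul, map_smul, map_smul, map_neg, π.ceDiff_ι_mul hz,
      π.ceDiff_ι_mul (π.shift_bracket_mem hx hz), π.ceAd_ι_mul hx hz,
      π.ceAd_ι_mul hx (π.shift_d_mem hz), π.ceAd_bracket hx hz, h, hj]
    simp only [map_add, map_smul, add_mul, mul_add, smul_add, smul_neg, smul_smul, sgn_sub,
      sgn_add, sgn_one, neg_add,
      sub_mul, mul_sub, one_mul, mul_one, smul_mul_assoc, mul_smul_comm, mul_comm l i]
    rcases sgn_cases (k := k) (i * l) with h1 | h1 <;>
      rcases sgn_cases (k := k) i with h2 | h2 <;>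
      rcases sgn_cases (k := k) l with h3 | h3 <;>
      simp only [h1, h2, h3] <;> module

theorem ceDiff_ceDiff (a : π.CESpace) : π.ceDiff (π.ceDiff a) = 0 := by
  refine LinearMap.congr_fun (f := π.ceDiff ∘ₗ π.ceDiff) (g := 0) (ext_rec ?_ ?_) a
  · simp [ceDiff_one]
  · intro i x hx a h
    simp only [LinearMap.comp_apply, LinearMap.zero_apply] at h ⊢
    rw [π.ceDiff_ι_mul hx, map_add, map_add, map_neg, map_smul, π.ceDiff_ι_mul hx,
      π.ceDiff_ι_mul (π.shift_d_mem hx), π.ceDiff_ceAd hx, π.d_d, h, map_zero, zero_mul, mul_zero]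
    simp only [smul_add, smul_neg, smul_smul, sgn_sub, sgn_one]
    rcases sgn_cases (k := k) i with h2 | h2 <;> simp only [h2] <;> module

/-- The Chevalley–Eilenberg dg coalgebra `C(π)`: the cofree cocommutative coalgebra `S(sπ)`, with
the differential `ceDiff`. -/
def CE : DGCoalgebra k π.CESpace where
  toGrading := grading π.shift
  comul_mem := comul_mem
  counit_eq_zero := counit_eq_zero
  cocomm := braid_comul
  d := π.ceDiff
  d_mem {n c} hc := by
    rw [sub_eq_neg_add]
    exact π.ceDiff_mem n c hc
  d_d := π.ceDiff_ceDiff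
  comul_d := π.comul_ceDiff

/-- The canonical map `ρ : sπ ♯ Der π → Der C(π)`, characterised through the projection
`p : C(π) → sπ` of the cofree coalgebra onto its cogenerators: `p ∘ ρ(sx)` is the counit followed
by `1 ↦ sx`, and `p ∘ ρ(θ) = sθ ∘ p`, where `sθ (sx) = (-1) ^ |θ| s (θ x)`. -/
structure IsCanonical (ρ : Hom π.semidirect π.CE.Coder) : Prop where
  map_s : ∀ (x : L) (c : π.CESpace),
    coproj π.shift (π.CE.coderToEnd (ρ.toLin (x, 0)) c) = Coalgebra.counit (R := k) c • x
  map_der : ∀ (n : ℤ) (θ : π.der n) (c : π.CESpace),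
    coproj π.shift (π.CE.coderToEnd (ρ.toLin (0, Tot.of π.der n θ)) c) =
      sgn k n • (θ : Module.End k L) (coproj π.shift c)

end CE

end DGLieAlgebra

end DGL

end

noncomputable section

namespace DGL

/-! ### Products, derivations and coderivations of `S(V)` -/

namespace GSym

variable {k : Type u} [Field k] {V : Type v} [AddCommGroup V] [Module k V] {G : Grading k V}

/-! A coderivation of `S(sπ)` is determined by its corestriction, that is, by its composite with `p`
(`coderivation_eq_zero`), and every homogeneous map `S(sπ) → sπ` is a corestriction (`coLift`). This
forces `ρ`: `ρ(sx)` is multiplication by `sx`, and `ρ(θ)` is `(-1)^|θ|` times the derivation of the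
algebra `S(sπ)` extending `θ`, which is also a coderivation. Compatibility with brackets and
differentials is checked on words, letter by letter.

For (2), `ρ` is injective, so it suffices that a coderivation `θ` with `[d, θ]` in the image of `ρ`
lies in that image up to some `[d, ξ]` (`exists_coder_homotopy`). Filter `S(sπ)` by weight, the sum
of the degrees in `π` of the letters. The quadratic part of `d` preserves the weight, while the
linear part lowers it, so the lowest weight where the corestriction `g` of `θ` is nonzero sees only
the quadratic part. When `π` is free, the complex with the quadratic differential contracts, by some
`s`, onto the unit and the suspended generators (`exists_contraction`). Correcting `θ` by the
commutator of `d` with the coderivation of corestriction `± g s` leaves only the values of `g` on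
generators, and freeness gives a derivation of `π` with these values (`exists_coder_step`). All
weights are nonnegative and each correction vanishes in smaller weights, so the infinite sum of
corrections is locally finite.

The contraction is explicit. Let `E` be the derivation of `π` that is the identity on generators,
and `N` its extension to `S(sπ)`. Freeness gives a map `Q` from `π` to words of length two that
vanishes on generators and is a derivation up to the cocycle `2 (-1)^|x| s(E x) s(E y)`. The algebra
derivation `T` of degree one with `T(sx) = Q x` satisfies `dT + Td = N² - N` for the quadratic `d`.
As `E` has positive integral eigenvalues, `N(N - 1)` is invertible away from the eigenvalues 0 and
1, whose eigenspaces are the scalars and the suspended span of the generators. Dividing uses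
characteristic zero.

For (3), the kernel of the projection to `Der π / ad π` is the cone of `ad : π → ad π`, which is
acyclic as soon as `ad` is injective (`toOuter_isQuasiIso`). The centre of a free graded Lie algebra
on at least two generators vanishes (`eq_zero_of_central`): a derivation with values in words, of
Fox type, shows that a central `z` acts as zero on the empty word, and a map of Dynkin type sends
that action to `E z`. -/

theorem mul_mem_deg {m n : ℤ} {a b : GSym G} (ha : a ∈ deg G m) (hb : b ∈ deg G n) :
    a * b ∈ deg G (m + n) := by
  refine deg_induction (P := fun m a => a * b ∈ deg G (m + n)) ?_ ?_ ?_ ?_ ?_ ha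
  · intro m; rw [zero_mul]; exact Submodule.zero_mem _
  · rwa [one_mul, zero_add]
  · intro m c a h; rw [smul_mul_assoc]; exact Submodule.smul_mem _ _ h
  · intro m a a' h h'; rw [add_mul]; exact Submodule.add_mem _ h h'
  · intro i x hx m a _ h
    rw [mul_assoc, add_assoc]
    exact ι_mul_mem hx h

/-- Graded commutativity: `(-1) ^ (|x| |a|) a x = x a`. -/
theorem sign_mul_ι {i : ℤ} {x : V} (hx : x ∈ G.gr i) (a : GSym G) :
    (grading G).sign i a * ι G x = ι G x * a := by
  refine LinearMap.congr_fun (f := LinearMap.mulRight k (ι G x) ∘ₗ (grading G).sign i)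
    (g := LinearMap.mulLeft k (ι G x)) (ext_rec ?_ ?_) a
  · simp [sign_one]
  · intro j y hy a h
    simp only [LinearMap.comp_apply, LinearMap.mulRight_apply, LinearMap.mulLeft_apply] at h ⊢
    rw [sign_ι_mul i hy, smul_mul_assoc, mul_assoc, h, ← mul_assoc, ← mul_assoc, ι_comm G hx hy,
      smul_mul_assoc]

theorem mul_ι_comm {i m : ℤ} {x : V} (hx : x ∈ G.gr i) {a : GSym G} (ha : a ∈ deg G m) :
    a * ι G x = sgn k (i * m) • (ι G x * a) := by
  rw [← sign_mul_ι hx, (grading G).sign_apply i ha, smul_mul_assoc, smul_smul]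
  rcases sgn_cases (k := k) (i * m) with h | h <;> simp [h]

theorem ι_mul_comm {i m : ℤ} {x : V} (hx : x ∈ G.gr i) {a : GSym G} (ha : a ∈ deg G m) :
    ι G x * a = sgn k (i * m) • (a * ι G x) := by
  rw [← sign_mul_ι hx, (grading G).sign_apply i ha, smul_mul_assoc]

/-- The recursion that defines `derExt` is the Leibniz rule for a single letter; induction on words
extends it to all left factors. -/
theorem derExt_mul {n m : ℤ} (θ : G.homDeg n) {a : GSym G} (ha : a ∈ deg G m) (b : GSym G) :
    derExt G θ (a * b) = derExt G θ a * b + sgn k (n * m) • (a * derExt G θ b) := by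
  refine deg_induction (P := fun m a => derExt G θ (a * b) =
    derExt G θ a * b + sgn k (n * m) • (a * derExt G θ b)) ?_ ?_ ?_ ?_ ?_ ha
  · intro m; simp
  · simp [derExt_one, sgn_zero]
  · intro m c a h
    simp only [smul_mul_assoc, map_smul, h, smul_add, smul_comm c]
  · intro m a a' h h'
    simp only [add_mul, map_add, h, h', smul_add]
    abel
  · intro i x hx m a _ h
    rw [mul_assoc, derExt_ι_mul θ hx, derExt_ι_mul θ hx, h, add_mul, mul_add, smul_mul_assoc,
      mul_smul_comm, mul_add n, sgn_add, smul_add, smul_smul, mul_assoc, mul_assoc, mul_assoc,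
      add_assoc]

theorem derExt_ι {n : ℤ} (θ : G.homDeg n) (x : V) :
    derExt G θ (ι G x) = ι G ((θ : Module.End k V) x) := by
  refine LinearMap.congr_fun (f := derExt G θ ∘ₗ ι G) (g := ι G ∘ₗ (θ : Module.End k V))
    (G.ext_hom fun i x hx => ?_) x
  have h := derExt_ι_mul θ hx 1
  rwa [mul_one, derExt_one, mul_zero, smul_zero, add_zero, mul_one] at h

theorem counit_derExt {n : ℤ} (θ : G.homDeg n) (a : GSym G) : counit G (derExt G θ a) = 0 :=
  LinearMap.congr_fun (f := (counit G).toLinearMap ∘ₗ derExt G θ) (g := 0)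
    (ext_rec (by simp [derExt_one]) (fun i x hx a _ => by
      simp [derExt_ι_mul θ hx, counit_ι_mul])) a

theorem coproj_derExt {n : ℤ} (θ : G.homDeg n) (a : GSym G) :
    coproj G (derExt G θ a) = (θ : Module.End k V) (coproj G a) :=
  LinearMap.congr_fun (f := coproj G ∘ₗ derExt G θ) (g := (θ : Module.End k V) ∘ₗ coproj G)
    (ext_rec (by simp [derExt_one, coproj_one]) (fun i x hx a _ => by
      simp [derExt_ι_mul θ hx, coproj_ι_mul, counit_derExt])) a

theorem coproj_mul (a b : GSym G) :
    coproj G (a * b) = counit G a • coproj G b + counit G b • coproj G a := by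
  refine LinearMap.congr_fun (f := coproj G ∘ₗ LinearMap.mulRight k b)
    (g := (counit G).toLinearMap.smulRight (coproj G b) + counit G b • coproj G)
    (ext_rec ?_ ?_) a
  · simp [coproj_one]
  · intro i x _ a _
    simp only [LinearMap.comp_apply, LinearMap.mulRight_apply, LinearMap.add_apply,
      LinearMap.smulRight_apply, LinearMap.smul_apply, AlgHom.toLinearMap_apply, mul_assoc,
      coproj_ι_mul, counit_ι_mul, zero_smul, zero_add, smul_smul]
    rw [map_mul, mul_comm]

theorem coproj_mem {n : ℤ} {a : GSym G} (ha : a ∈ deg G n) : coproj G a ∈ G.gr n := by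
  refine deg_induction (P := fun n a => coproj G a ∈ G.gr n) ?_ ?_ ?_ ?_ ?_ ha
  · intro n; rw [map_zero]; exact Submodule.zero_mem _
  · rw [coproj_one]; exact Submodule.zero_mem _
  · intro n c a h; rw [map_smul]; exact Submodule.smul_mem _ _ h
  · intro n a b h h'; rw [map_add]; exact Submodule.add_mem _ h h'
  · intro i x hx n a ha _
    rw [coproj_ι_mul]
    by_cases hn : n = 0
    · subst hn; rw [add_zero]; exact Submodule.smul_mem _ _ hx
    · rw [counit_eq_zero ha hn, zero_smul]; exact Submodule.zero_mem _

theorem ι_mem {i : ℤ} {x : V} (hx : x ∈ G.gr i) : ι G x ∈ deg G i := by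
  simpa using ι_mul_mem hx (one_mem G)

/-! #### Coderivations with prescribed corestriction -/

/-- The map `a ⊗ b ↦ f a · b`. -/
def mulLeftBy (f : GSym G →ₗ[k] V) : GSym G ⊗[k] GSym G →ₗ[k] GSym G :=
  TensorProduct.lift (mulL G ∘ₗ f)

theorem mulLeftBy_tmul (f : GSym G →ₗ[k] V) (a b : GSym G) :
    mulLeftBy f (a ⊗ₜ b) = ι G (f a) * b := rfl

/-- The coderivation `c ↦ ∑ f c' · c''` with corestriction `f`. -/
def coLift (f : GSym G →ₗ[k] V) : Module.End k (GSym G) := mulLeftBy f ∘ₗ comul G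

theorem rTensor_counit_comul (c : GSym G) :
    (counit G).toLinearMap.rTensor (GSym G) (comul G c) = 1 ⊗ₜ[k] c :=
  Coalgebra.rTensor_counit_comul (R := k) c

theorem lTensor_counit_comul (c : GSym G) :
    (counit G).toLinearMap.lTensor (GSym G) (comul G c) = c ⊗ₜ[k] 1 :=
  Coalgebra.lTensor_counit_comul (R := k) c

/-- The projection of `f c' · c''` is `ε(c'') f c'`, so the claim is the right counit law. -/
theorem coproj_coLift (f : GSym G →ₗ[k] V) (c : GSym G) : coproj G (coLift f c) = f c := by
  have h : coproj G ∘ₗ mulLeftBy f = (f ∘ₗ (TensorProduct.rid k (GSym G)).toLinearMap) ∘ₗ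
      (counit G).toLinearMap.lTensor (GSym G) := TensorProduct.ext' fun a b => by
    simp [mulLeftBy_tmul, coproj_ι_mul]
  have h2 := LinearMap.congr_fun h (comul G c)
  simp only [LinearMap.comp_apply, lTensor_counit_comul, LinearEquiv.coe_coe,
    TensorProduct.rid_tmul, one_smul] at h2
  exact h2

theorem coLift_mem {n : ℤ} {f : GSym G →ₗ[k] V} (hf : ∀ i, ∀ c ∈ deg G i, f c ∈ G.gr (n + i)) :
    coLift f ∈ (grading G).homDeg n := by
  intro m c hc
  have h : (grading G).tensorDeg m ≤ (deg G (n + m)).comap (mulLeftBy f) := by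
    refine Submodule.span_le.2 ?_
    rintro _ ⟨i, j, rfl, a, ha, b, hb, rfl⟩
    have := ι_mul_mem (hf i a ha) hb
    rwa [add_assoc] at this
  exact h (comul_mem hc)

/-- Auxiliary: the map `a ⊗ b ⊗ c ↦ f a · b ⊗ c + (-1) ^ (|f a| |b|) b ⊗ f a · c`, for `f` of
degree `n`. -/
def coLiftAux (n : ℤ) (f : GSym G →ₗ[k] V) :
    GSym G ⊗[k] (GSym G ⊗[k] GSym G) →ₗ[k] GSym G ⊗[k] GSym G :=
  (mulLeftBy f).rTensor (GSym G) ∘ₗ (TensorProduct.assoc k _ _ _).symm.toLinearMap +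
    TensorProduct.map ((grading G).sign n) (mulLeftBy f) ∘ₗ
      (TensorProduct.assoc k _ _ _).toLinearMap ∘ₗ (grading G).braid.rTensor (GSym G) ∘ₗ
        (TensorProduct.assoc k _ _ _).symm.toLinearMap

theorem coLiftAux_tmul {n : ℤ} (f : GSym G →ₗ[k] V) {i : ℤ} {a : GSym G} (ha : a ∈ deg G i)
    (w : GSym G ⊗[k] GSym G) :
    coLiftAux n f (a ⊗ₜ w) = (grading G).tensorOp (n + i) (mulL G (f a)) w := by
  induction w using TensorProduct.induction_on with
  | zero => simp
  | add z w hz hw => simp only [map_add, TensorProduct.tmul_add, hz, hw]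
  | tmul p q =>
    simp only [coLiftAux, Grading.tensorOp_tmul, LinearMap.add_apply, LinearMap.comp_apply,
      LinearEquiv.coe_coe, TensorProduct.assoc_symm_tmul, LinearMap.rTensor_tmul, mulLeftBy_tmul,
      (grading G).braid_tmul ha, TensorProduct.assoc_tmul, TensorProduct.map_tmul, mulL_apply,
      Grading.sign_sign]

/-- Multiplicativity of the coproduct: `Δ` of a letter times `b` is `x ⊗ 1 + 1 ⊗ x` applied to `Δ
b`. The auxiliary map encodes this uniformly in the degree of the letter `f a`. -/
theorem comul_mulLeftBy {n : ℤ} {f : GSym G →ₗ[k] V}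
    (hf : ∀ i, ∀ c ∈ deg G i, f c ∈ G.gr (n + i)) (z : GSym G ⊗[k] GSym G) :
    comul G (mulLeftBy f z) = coLiftAux n f ((comul G).lTensor (GSym G) z) := by
  induction z using TensorProduct.induction_on with
  | zero => simp
  | add z w hz hw => simp only [map_add, hz, hw]
  | tmul a b =>
    rw [mulLeftBy_tmul, LinearMap.lTensor_tmul]
    refine (grading G).induction (P := fun a => comul G (ι G (f a) * b) =
      coLiftAux n f (a ⊗ₜ[k] comul G b)) (fun i a ha => ?_) (fun a a' h h' => ?_) a
    · rw [coLiftAux_tmul f ha, comul_ι_mul (hf i a ha)]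
    · rw [map_add, map_add, add_mul, map_add, h, h', TensorProduct.add_tmul, map_add]

/-- Coassociativity identifies the term `f c' · c'' ⊗ c'''` with `coLift f ⊗ 1`. In the other term
`f c'` has moved past `c''`; cocommutativity exchanges `c'` and `c''`, which gives `1 ⊗ coLift f`.
-/
theorem comul_coLift {n : ℤ} {f : GSym G →ₗ[k] V}
    (hf : ∀ i, ∀ c ∈ deg G i, f c ∈ G.gr (n + i)) (c : GSym G) :
    comul G (coLift f c) = (grading G).tensorOp n (coLift f) (comul G c) := by
  have h : (comul G).lTensor (GSym G) (comul G c) =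
      TensorProduct.assoc k _ _ _ ((comul G).rTensor (GSym G) (comul G c)) :=
    (Coalgebra.coassoc_apply (R := k) c).symm
  have hb : ∀ z : GSym G ⊗[k] GSym G, (grading G).braid.rTensor (GSym G)
      ((comul G).rTensor (GSym G) z) = (comul G).rTensor (GSym G) z := fun z => by
    rw [← LinearMap.comp_apply, ← LinearMap.rTensor_comp]
    congr 2
    exact LinearMap.ext braid_comul
  rw [coLift, LinearMap.comp_apply, comul_mulLeftBy hf]
  simp only [coLiftAux, LinearMap.add_apply, LinearMap.comp_apply, h, LinearEquiv.coe_coe,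
    LinearEquiv.symm_apply_apply, hb]
  rw [← h]
  simp only [Grading.tensorOp, LinearMap.add_apply, LinearMap.rTensorHom]
  have h1 : (mulLeftBy f).rTensor (GSym G) ((comul G).rTensor (GSym G) (comul G c)) =
      (mulLeftBy f ∘ₗ comul G).rTensor (GSym G) (comul G c) := by
    rw [LinearMap.rTensor_comp]; rfl
  have h2 : TensorProduct.map ((grading G).sign n) (mulLeftBy f)
      ((comul G).lTensor (GSym G) (comul G c)) =
      TensorProduct.map ((grading G).sign n) (mulLeftBy f ∘ₗ comul G) (comul G c) := by
    rw [LinearMap.lTensor, ← LinearMap.comp_apply, ← TensorProduct.map_comp, LinearMap.comp_id]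
  rw [h1, h2]
  rfl

/-- A coderivation composed with the counit vanishes. -/
theorem counit_coderivation [CharZero k] {n : ℤ} {θ : Module.End k (GSym G)}
    (hθ : ∀ c, comul G (θ c) = (grading G).tensorOp n θ (comul G c)) (c : GSym G) :
    counit G (θ c) = 0 := by
  set e : GSym G ⊗[k] GSym G →ₗ[k] k := LinearMap.mul' k k ∘ₗ
    TensorProduct.map (counit G).toLinearMap (counit G).toLinearMap with he
  have h1 : ∀ c, e (comul G c) = counit G c := fun c => by
    have : e = (counit G).toLinearMap ∘ₗ (TensorProduct.lid k _).toLinearMap ∘ₗ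
        (counit G).toLinearMap.rTensor (GSym G) := TensorProduct.ext' fun a b => by simp [he]
    rw [this]
    simp [rTensor_counit_comul]
  have h2 : e ∘ₗ (grading G).tensorOp n θ = (counit G).toLinearMap ∘ₗ θ ∘ₗ
      (TensorProduct.lid k _).toLinearMap ∘ₗ (counit G).toLinearMap.rTensor (GSym G) +
      (counit G).toLinearMap ∘ₗ θ ∘ₗ
      (TensorProduct.rid k _).toLinearMap ∘ₗ (counit G).toLinearMap.lTensor (GSym G) :=
    TensorProduct.ext' fun a b => by
      simp [he, Grading.tensorOp_tmul, counit_sign, mul_comm, add_comm]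
  -- Applying `ε ⊗ ε` to the coderivation identity yields `ε θ c = ε θ c + ε θ c`.
  have h3 := LinearMap.congr_fun h2 (comul G c)
  simp only [LinearMap.comp_apply, LinearMap.add_apply, rTensor_counit_comul,
    lTensor_counit_comul, LinearEquiv.coe_coe, TensorProduct.lid_tmul, TensorProduct.rid_tmul,
    one_smul, AlgHom.toLinearMap_apply, ← hθ] at h3
  rw [h1] at h3
  simpa using h3

/-- The word length operator of `S(V)`, in terms of the coproduct. -/
theorem mul_coproj_comul (c : GSym G) :
    LinearMap.mul' k (GSym G) ((ι G ∘ₗ coproj G).lTensor (GSym G) (comul G c)) =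
      derExt G (n := 0) ⟨LinearMap.id, fun i x hx => by simpa using hx⟩ c := by
  refine LinearMap.congr_fun (f := LinearMap.mul' k (GSym G) ∘ₗ
    (ι G ∘ₗ coproj G).lTensor (GSym G) ∘ₗ comul G) (g := derExt G _) (ext_rec ?_ ?_) c
  · simp [comul_one, coproj_one, derExt_one]
  · intro i x hx a h
    simp only [LinearMap.comp_apply] at h ⊢
    rw [derExt_ι_mul _ hx, ← h, comul_ι_mul hx, zero_mul, sgn_zero, one_smul]
    -- Either the new letter stays in the left factor and multiplies everything, or it is the one
    -- singled out on the right, which leaves a counit; graded commutativity brings it back to the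
    -- front.
    have h1 : LinearMap.mul' k (GSym G) ∘ₗ (ι G ∘ₗ coproj G).lTensor (GSym G) ∘ₗ
        (grading G).tensorOp i (mulL G x) = LinearMap.mulLeft k (ι G x) ∘ₗ
          (LinearMap.mul' k (GSym G) ∘ₗ (ι G ∘ₗ coproj G).lTensor (GSym G)) +
          LinearMap.mulLeft k (ι G x) ∘ₗ (TensorProduct.rid k _).toLinearMap ∘ₗ
            (counit G).toLinearMap.lTensor (GSym G) := TensorProduct.ext' fun a b => by
      simp only [LinearMap.comp_apply, LinearMap.add_apply, Grading.tensorOp_tmul, map_add,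
        LinearMap.lTensor_tmul, LinearMap.mul'_apply, LinearMap.mulLeft_apply, mulL_apply,
        coproj_ι_mul, map_smul, LinearEquiv.coe_coe, TensorProduct.rid_tmul, mul_smul_comm,
        sign_mul_ι hx, mul_assoc, AlgHom.toLinearMap_apply]
    have h2 := LinearMap.congr_fun h1 (comul G a)
    simp only [LinearMap.comp_apply, LinearMap.add_apply, lTensor_counit_comul,
      LinearEquiv.coe_coe, TensorProduct.rid_tmul, one_smul, LinearMap.mulLeft_apply] at h2
    rw [h2, add_comm]
    rfl

end GSym

end DGL

end

noncomputable section

namespace DGL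

/-! ### Gradings by eigenvalues -/

section Eigen

variable {k : Type u} [Field k] {V : Type v} [AddCommGroup V] [Module k V]

namespace Grading

/-- The decomposition holds over every larger finite set, so that any given index may be adjoined to
the support. -/
theorem exists_finset_sum (G : Grading k V) (x : V) :
    ∃ s : Finset ℤ, ∀ t, s ⊆ t → x = ∑ n ∈ t, G.proj n x := by
  classical
  refine G.induction (P := fun x => ∃ s : Finset ℤ, ∀ t, s ⊆ t → x = ∑ n ∈ t, G.proj n x) ?_ ?_ x
  · intro i x hx
    refine ⟨{i}, fun t ht => ?_⟩
    rw [Finset.sum_eq_single i (fun j _ hj => G.proj_ne (Ne.symm hj) hx)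
      (fun h => absurd (ht (Finset.mem_singleton_self i)) h), G.proj_same hx]
  · rintro x y ⟨s, hs⟩ ⟨t, ht⟩
    refine ⟨s ∪ t, fun r hr => ?_⟩
    simp only [map_add, Finset.sum_add_distrib]
    rw [← hs r (Finset.union_subset_left hr), ← ht r (Finset.union_subset_right hr)]

theorem eq_zero_of_proj (G : Grading k V) {x : V} (h : ∀ n, G.proj n x = 0) : x = 0 := by
  obtain ⟨s, hs⟩ := G.exists_finset_sum x
  rw [hs s subset_rfl, Finset.sum_eq_zero fun n _ => h n]

variable [CharZero k] (T : Module.End k V) (hT : ∀ x, x ∈ ⨆ n : ℤ, T.eigenspace (n : k))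

/-- The grading by eigenspaces of a diagonalizable operator with integral eigenvalues. -/
def ofEigen : Grading k V where
  gr n := T.eigenspace (n : k)
  internal := DirectSum.isInternal_submodule_of_iSupIndep_of_iSup_eq_top
    (T.eigenspaces_iSupIndep.comp Int.cast_injective) (eq_top_iff.2 fun x _ => hT x)

theorem mem_ofEigen {n : ℤ} {x : V} : x ∈ (ofEigen T hT).gr n ↔ T x = (n : k) • x :=
  Module.End.mem_eigenspace_iff

theorem apply_ofEigen_proj (n : ℤ) (x : V) :
    T ((ofEigen T hT).proj n x) = (n : k) • (ofEigen T hT).proj n x :=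
  (mem_ofEigen T hT).1 ((ofEigen T hT).proj_mem n x)

/-- The usual elimination argument for distinct eigenvalues; characteristic zero makes distinct
integers distinct in `k`. -/
theorem mem_of_sum_eigen_mem {S : Submodule k V} (hS : ∀ x ∈ S, T x ∈ S) (s : Finset ℤ) :
    ∀ c : ℤ → V, (∀ n ∈ s, T (c n) = (n : k) • c n) → ∑ n ∈ s, c n ∈ S → ∀ n ∈ s, c n ∈ S := by
  classical
  induction s using Finset.induction_on with
  | empty => intro c _ _ n hn; exact absurd hn (Finset.notMem_empty n)
  | insert m s hm ih =>
    intro c hc h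
    rw [Finset.sum_insert hm] at h
    -- The operator `T - m` removes the term of index `m` and rescales the others.
    have h1 : ∑ n ∈ s, ((n : k) - m) • c n ∈ S := by
      have h2 := Submodule.sub_mem _ (hS _ h) (Submodule.smul_mem _ (m : k) h)
      rw [map_add, map_sum, hc m (Finset.mem_insert_self m s), smul_add, add_sub_add_left_eq_sub,
        Finset.smul_sum, ← Finset.sum_sub_distrib] at h2
      have h3 : ∑ n ∈ s, ((n : k) - m) • c n = ∑ n ∈ s, (T (c n) - (m : k) • c n) :=
        Finset.sum_congr rfl fun n hn => by rw [hc n (Finset.mem_insert_of_mem hn), sub_smul]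
      rwa [h3]
    have h3 : ∀ n ∈ s, c n ∈ S := fun n hn => by
      have h4 := ih (fun n => ((n : k) - m) • c n) (fun n hn => by
        rw [map_smul, hc n (Finset.mem_insert_of_mem hn), smul_comm]) h1 n hn
      have h5 : (n : k) - m ≠ 0 := by
        rw [sub_ne_zero]
        intro h
        rw [Int.cast_inj] at h
        exact hm (h ▸ hn)
      have := Submodule.smul_mem S ((n : k) - m)⁻¹ h4
      rwa [smul_smul, inv_mul_cancel₀ h5, one_smul] at this
    intro n hn
    rcases Finset.mem_insert.1 hn with rfl | hn
    · exact (Submodule.add_mem_iff_left S (Submodule.sum_mem _ h3)).1 h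
    · exact h3 n hn

/-- The eigenspace projections preserve the subspaces that are invariant under `T`. -/
theorem ofEigen_proj_mem {S : Submodule k V} (hS : ∀ x ∈ S, T x ∈ S) (n : ℤ) {x : V}
    (hx : x ∈ S) : (ofEigen T hT).proj n x ∈ S := by
  classical
  obtain ⟨s, hs⟩ := (ofEigen T hT).exists_finset_sum x
  have h := hs (insert n s) (Finset.subset_insert n s)
  exact mem_of_sum_eigen_mem T hS (insert n s) (fun n => (ofEigen T hT).proj n x)
    (fun n _ => apply_ofEigen_proj T hT n x) (h ▸ hx) n (Finset.mem_insert_self n s)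

/-- The maps acting by scalars on the eigenspaces of `T` preserve the subspaces that are invariant
under `T`. -/
theorem ofEigen_glue_smul_mem {S : Submodule k V} (hS : ∀ x ∈ S, T x ∈ S) (r : ℤ → k) {x : V}
    (hx : x ∈ S) : (ofEigen T hT).glue (fun i => r i • ((ofEigen T hT).gr i).subtype) x ∈ S := by
  obtain ⟨s, hs⟩ := (ofEigen T hT).exists_finset_sum x
  rw [hs s subset_rfl, map_sum]
  refine Submodule.sum_mem _ fun n _ => ?_
  rw [glue_apply _ _ ((ofEigen T hT).proj_mem n x)]
  exact Submodule.smul_mem _ _ (ofEigen_proj_mem T hT hS n hx)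

end Grading

namespace GSym

variable {G : Grading k V}

theorem mem_homDeg_zero {τ : Module.End k V} (hτ : ∀ i, ∀ x ∈ G.gr i, τ x ∈ G.gr i) :
    τ ∈ G.homDeg 0 := fun i x hx => by rw [zero_add]; exact hτ i x hx

/-- The identity, as an operator of degree zero; the derivation of `S(V)` extending it is the word
length operator. -/
def idDeg (G : Grading k V) : G.homDeg 0 := ⟨LinearMap.id, mem_homDeg_zero fun _ _ hx => hx⟩

/-- In degree zero the Leibniz rule has no sign, so the letter need not be homogeneous. This matters
for eigenvectors of `τ`, which are not assumed homogeneous. -/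
theorem derExt_zero_ι_mul (τ : G.homDeg 0) (x : V) (a : GSym G) :
    derExt G τ (ι G x * a) = ι G ((τ : Module.End k V) x) * a + ι G x * derExt G τ a := by
  refine G.induction (P := fun x => derExt G τ (ι G x * a) =
    ι G ((τ : Module.End k V) x) * a + ι G x * derExt G τ a) (fun i x hx => ?_)
    (fun x y hx hy => ?_) x
  · rw [derExt_ι_mul τ hx, zero_mul, sgn_zero, one_smul]
  · simp only [map_add, add_mul, hx, hy]
    abel

/-- The eigenvectors of `τ` span `V`, so words in eigenvectors span `S(V)`. -/
theorem induction_eigen {τ : Module.End k V} (hτ : ∀ x, x ∈ ⨆ n : ℤ, τ.eigenspace (n : k))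
    {P : GSym G → Prop} (one : P 1) (smul : ∀ (c : k) a, P a → P (c • a))
    (add : ∀ a b, P a → P b → P (a + b))
    (mul : ∀ (n : ℤ) x, τ x = (n : k) • x → ∀ a, P a → P (ι G x * a)) (a : GSym G) : P a := by
  refine GSym.induction G one smul add (fun i x _ a ha => ?_) a
  refine Submodule.iSup_induction (fun n : ℤ => τ.eigenspace (n : k))
    (motive := fun x => P (ι G x * a)) (hτ x)
    (fun n x hx => mul n x (Module.End.mem_eigenspace_iff.1 hx) a ha) ?_ (fun x y hx hy => ?_)
  · have h := smul 0 a ha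
    rw [zero_smul k a] at h
    rwa [map_zero, zero_mul]
  · rw [map_add, add_mul]
    exact add _ _ hx hy

variable (τ : G.homDeg 0)

/-- A word in eigenvectors is an eigenvector of the derivation, with eigenvalue the sum of those of
its letters. -/
theorem mem_iSup_eigenspace_derExt
    (hτ : ∀ x, x ∈ ⨆ n : ℤ, Module.End.eigenspace (τ : Module.End k V) (n : k)) (a : GSym G) :
    a ∈ ⨆ n : ℤ, Module.End.eigenspace (derExt G τ) (n : k) := by
  refine induction_eigen hτ ?_ (fun c a h => Submodule.smul_mem _ c h)
    (fun a b ha hb => Submodule.add_mem _ ha hb) (fun n x hx a ha => ?_) a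
  · refine Submodule.mem_iSup_of_mem (p := fun n : ℤ => Module.End.eigenspace (derExt G τ) (n : k))
      0 ?_
    rw [Module.End.mem_eigenspace_iff, derExt_one, Int.cast_zero, zero_smul]
  · refine Submodule.iSup_induction (fun n : ℤ => Module.End.eigenspace (derExt G τ) (n : k))
      (motive := fun a => ι G x * a ∈ ⨆ n : ℤ, Module.End.eigenspace (derExt G τ) (n : k)) ha
      (fun m a ha => Submodule.mem_iSup_of_mem (n + m) ?_) ?_ (fun a b ha hb => ?_)
    · rw [Module.End.mem_eigenspace_iff] at ha ⊢
      rw [derExt_zero_ι_mul, ha, hx, map_smul, smul_mul_assoc, mul_smul_comm, Int.cast_add,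
        add_smul]
    · rw [mul_zero]; exact Submodule.zero_mem _
    · rw [mul_add]; exact Submodule.add_mem _ ha hb

variable [CharZero k]
  (hτ : ∀ x, x ∈ ⨆ n : ℤ, Module.End.eigenspace (τ : Module.End k V) (n : k))

/-- The grading of `S(V)` by the eigenvalues of the derivation extending `τ`. -/
abbrev eigenGrading : Grading k (GSym G) :=
  Grading.ofEigen (derExt G τ) (mem_iSup_eigenspace_derExt τ hτ)

theorem eigenGrading_proj_ι_mul {n : ℤ} {x : V} (hx : (τ : Module.End k V) x = (n : k) • x)
    (m : ℤ) (a : GSym G) :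
    (eigenGrading τ hτ).proj m (ι G x * a) = ι G x * (eigenGrading τ hτ).proj (m - n) a := by
  refine LinearMap.congr_fun (f := (eigenGrading τ hτ).proj m ∘ₗ mulL G x)
    (g := mulL G x ∘ₗ (eigenGrading τ hτ).proj (m - n))
    ((eigenGrading τ hτ).ext_hom fun l a ha => ?_) a
  have h : ι G x * a ∈ (eigenGrading τ hτ).gr (n + l) := by
    rw [Grading.mem_ofEigen] at ha ⊢
    rw [derExt_zero_ι_mul, ha, hx, map_smul, smul_mul_assoc, mul_smul_comm, Int.cast_add,
      add_smul]
  simp only [LinearMap.comp_apply, mulL_apply]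
  by_cases hl : l = m - n
  · subst hl
    rw [Grading.proj_same _ ha, Grading.proj_same _ (by rwa [add_sub_cancel] at h)]
  · rw [Grading.proj_ne _ hl ha, Grading.proj_ne _ (by omega) h, mul_zero]

/-- When every letter has positive eigenvalue, no word has a negative one. -/
theorem eigenGrading_proj_neg
    (hpos : ∀ n : ℤ, n ≤ 0 → ∀ x, (τ : Module.End k V) x = (n : k) • x → x = 0) (a : GSym G) :
    ∀ m : ℤ, m < 0 →
    (eigenGrading τ hτ).proj m a = 0 := by
  refine induction_eigen hτ (P := fun a => ∀ m : ℤ, m < 0 → (eigenGrading τ hτ).proj m a = 0)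
    ?_ ?_ ?_ ?_ a
  · intro m hm
    refine Grading.proj_ne _ (Ne.symm hm.ne) ?_
    rw [Grading.mem_ofEigen, derExt_one, Int.cast_zero, zero_smul]
  · intro c a h m hm
    rw [map_smul, h m hm, smul_zero]
  · intro a b ha hb m hm
    rw [map_add, ha m hm, hb m hm, add_zero]
  · intro n x hx a ha m hm
    by_cases hn : n ≤ 0
    · rw [hpos n hn x hx, map_zero, zero_mul, map_zero]
    · rw [eigenGrading_proj_ι_mul τ hτ hx, ha _ (by omega), mul_zero]

/-- Only the empty word has eigenvalue zero, and the counit reads off its coefficient. -/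
theorem eigenGrading_proj_zero
    (hpos : ∀ n : ℤ, n ≤ 0 → ∀ x, (τ : Module.End k V) x = (n : k) • x → x = 0) (a : GSym G) :
    (eigenGrading τ hτ).proj 0 a = counit G a • 1 := by
  refine induction_eigen hτ (P := fun a => (eigenGrading τ hτ).proj 0 a = counit G a • 1)
    ?_ ?_ ?_ ?_ a
  · rw [map_one (counit G), one_smul]
    refine Grading.proj_same _ ?_
    rw [Grading.mem_ofEigen, derExt_one, Int.cast_zero, zero_smul]
  · intro c a h
    rw [map_smul, h, map_smul, smul_assoc]
  · intro a b ha hb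
    rw [map_add, ha, hb, map_add, add_smul]
  · intro n x hx a _
    rw [counit_ι_mul, zero_smul]
    by_cases hn : n ≤ 0
    · rw [hpos n hn x hx, map_zero, zero_mul, map_zero]
    · rw [eigenGrading_proj_ι_mul τ hτ hx, eigenGrading_proj_neg τ hτ hpos a _ (by omega),
        mul_zero]

/-- A sum of positive integers is one only if it has a single term, so this component consists of
single letters of eigenvalue one. -/
theorem eigenGrading_proj_one
    (hpos : ∀ n : ℤ, n ≤ 0 → ∀ x, (τ : Module.End k V) x = (n : k) • x → x = 0) (a : GSym G) :
    (eigenGrading τ hτ).proj 1 a =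
    ι G ((Grading.ofEigen (τ : Module.End k V) hτ).proj 1 (coproj G a)) := by
  refine induction_eigen hτ (P := fun a => (eigenGrading τ hτ).proj 1 a =
    ι G ((Grading.ofEigen (τ : Module.End k V) hτ).proj 1 (coproj G a)))
    ?_ ?_ ?_ ?_ a
  · rw [coproj_one, map_zero, map_zero]
    refine Grading.proj_ne _ (m := 0) (by omega) ?_
    rw [Grading.mem_ofEigen, derExt_one, Int.cast_zero, zero_smul]
  · intro c a h
    simp only [map_smul, h]
  · intro a b ha hb
    simp only [map_add, ha, hb]
  · intro n x hx a _
    rw [coproj_ι_mul, map_smul, map_smul]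
    by_cases hn : n ≤ 0
    · rw [hpos n hn x hx]; simp
    · rw [eigenGrading_proj_ι_mul τ hτ hx]
      have hx' : x ∈ (Grading.ofEigen (τ : Module.End k V) hτ).gr n :=
        (Grading.mem_ofEigen _ hτ).2 hx
      by_cases h1 : n = 1
      · subst h1
        rw [sub_self, eigenGrading_proj_zero τ hτ hpos, Grading.proj_same _ hx', mul_smul_comm,
          mul_one]
      · rw [eigenGrading_proj_neg τ hτ hpos a _ (by omega), Grading.proj_ne _ h1 hx', mul_zero,
          map_zero, smul_zero]

/-- Elements of word length zero are scalars. -/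
theorem eq_counit_of_derExt_id {a : GSym G} (ha : derExt G (idDeg G) a = 0) :
    a = counit G a • 1 := by
  -- For the identity all of `V` is the eigenspace of eigenvalue one, and `eigenGrading_proj_zero`
  -- applies.
  have hτ : ∀ x : V, x ∈ ⨆ n : ℤ, Module.End.eigenspace (idDeg G : Module.End k V) (n : k) :=
    fun x => Submodule.mem_iSup_of_mem 1 (Module.End.mem_eigenspace_iff.2 (by
      rw [Int.cast_one, one_smul]; rfl))
  rw [← eigenGrading_proj_zero (idDeg G) hτ ?_ a, Grading.proj_same]
  · rw [Grading.mem_ofEigen, ha, Int.cast_zero, zero_smul]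
  · intro n hn x hx
    have h : x = (n : k) • x := hx
    have h1 : ((n : k) - 1) • x = 0 := by rw [sub_smul, one_smul, ← h, sub_self]
    refine (smul_eq_zero.1 h1).resolve_left ?_
    rw [← Int.cast_one (R := k), ← Int.cast_sub, Int.cast_eq_zero]
    omega

end GSym

end Eigen

end DGL

end

noncomputable section

namespace DGL

/-! ### The weight filtration of `S(sV)` -/

namespace GSym

variable {k : Type u} [Field k] {V : Type v} [AddCommGroup V] [Module k V]

theorem mem_shift {G : Grading k V} {i : ℤ} {x : V} (hx : x ∈ G.gr i) :
    x ∈ G.shift.gr (i + 1) := by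
  change x ∈ G.gr (i + 1 - 1)
  rwa [add_sub_cancel_right]

/-- The span of the products of suspensions of homogeneous elements of positive degree, with sum
of degrees in `V` at most `p`. -/
def weightFil (G : Grading k V) (p : ℤ) : Submodule k (GSym G.shift) :=
  Submodule.span k {a | ∃ l : List (ℤ × V), (∀ q ∈ l, 1 ≤ q.1 ∧ q.2 ∈ G.gr q.1) ∧
    (l.map Prod.fst).sum ≤ p ∧ (l.map fun q => ι G.shift q.2).prod = a}

variable {G : Grading k V}

theorem weightFil_mono {p q : ℤ} (h : p ≤ q) : weightFil G p ≤ weightFil G q :=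
  Submodule.span_mono fun _ ⟨l, h1, h2, h3⟩ => ⟨l, h1, h2.trans h, h3⟩

theorem one_mem_weightFil {p : ℤ} (hp : 0 ≤ p) : (1 : GSym G.shift) ∈ weightFil G p :=
  Submodule.subset_span ⟨[], by simp, hp, rfl⟩

theorem weightFil_induction {P : ℤ → GSym G.shift → Prop} (zero : ∀ p, P p 0)
    (one : ∀ p, 0 ≤ p → P p 1)
    (smul : ∀ p (c : k) a, P p a → P p (c • a)) (add : ∀ p a b, P p a → P p b → P p (a + b))
    (mul : ∀ i, 1 ≤ i → ∀ x ∈ G.gr i, ∀ p, ∀ a ∈ weightFil G p, P p a →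
      P (i + p) (ι G.shift x * a))
    {p : ℤ} {a : GSym G.shift} (ha : a ∈ weightFil G p) : P p a := by
  refine Submodule.span_induction (p := fun a _ => P p a) ?_ (zero p)
    (fun a b _ _ => add p a b) (fun c a _ => smul p c a) ha
  rintro _ ⟨l, hl, hp, rfl⟩
  clear ha
  induction l generalizing p with
  | nil => exact one p hp
  | cons q l ih =>
    simp only [List.map_cons, List.sum_cons, List.prod_cons] at hp ⊢
    have hl' : ∀ r ∈ l, 1 ≤ r.1 ∧ r.2 ∈ G.gr r.1 := fun r hr => hl r (List.mem_cons_of_mem _ hr)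
    have hq := hl q List.mem_cons_self
    have hmem : (l.map fun q => ι G.shift q.2).prod ∈ weightFil G (p - q.1) :=
      Submodule.subset_span ⟨l, hl', by omega, rfl⟩
    have := mul q.1 hq.1 q.2 hq.2 _ _ hmem (ih hl' (by omega))
    rwa [add_sub_cancel] at this

theorem ι_mul_mem_weightFil' {i p : ℤ} {x : V} (hi : 1 ≤ i) (hx : x ∈ G.gr i) {a : GSym G.shift}
    (ha : a ∈ weightFil G p) : ι G.shift x * a ∈ weightFil G (i + p) := by
  have h : weightFil G p ≤ (weightFil G (i + p)).comap (LinearMap.mulLeft k (ι G.shift x)) := by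
    refine Submodule.span_le.2 ?_
    rintro _ ⟨l, hl, hn, rfl⟩
    refine Submodule.subset_span ⟨(i, x) :: l, ?_, by simpa using hn, by simp⟩
    rintro q hq
    rcases List.mem_cons.1 hq with rfl | hq
    · exact ⟨hi, hx⟩
    · exact hl q hq
  exact h ha

theorem mul_mem_weightFil {p q : ℤ} {a b : GSym G.shift}
    (ha : a ∈ weightFil G p) (hb : b ∈ weightFil G q) : a * b ∈ weightFil G (p + q) := by
  refine weightFil_induction (P := fun p a => a * b ∈ weightFil G (p + q)) ?_ ?_ ?_ ?_ ?_ ha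
  · intro p; rw [zero_mul]; exact Submodule.zero_mem _
  · intro p hp; rw [one_mul]; exact weightFil_mono (by omega) hb
  · intro p c a h; rw [smul_mul_assoc]; exact Submodule.smul_mem _ _ h
  · intro p a a' h h'; rw [add_mul]; exact Submodule.add_mem _ h h'
  · intro i hi x hx p a _ h
    rw [mul_assoc, add_assoc]
    exact ι_mul_mem_weightFil' hi hx h

theorem weightFil_neg {p : ℤ} (hp : p < 0) : weightFil G p = ⊥ := by
  refine (Submodule.eq_bot_iff _).2 fun a ha => ?_
  refine weightFil_induction (P := fun p a => p < 0 → a = 0) ?_ ?_ ?_ ?_ ?_ ha hp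
  · intro _ _; rfl
  · intro p h h'; omega
  · intro p c a h hp; rw [h hp, smul_zero]
  · intro p a b ha hb hp; rw [ha hp, hb hp, add_zero]
  · intro i hi x _ p a _ h hp; rw [h (by omega), mul_zero]

/-- Letters weigh at least one, so weight zero leaves only the empty word. -/
theorem weightFil_zero {a : GSym G.shift} (ha : a ∈ weightFil G 0) :
    a = counit G.shift a • 1 := by
  refine weightFil_induction (P := fun p a => p ≤ 0 → a = counit G.shift a • 1)
    ?_ ?_ ?_ ?_ ?_ ha le_rfl
  · intro _ _; rw [map_zero, zero_smul]
  · intro p _ _; rw [map_one (counit G.shift), one_smul]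
  · intro p c a h hp; rw [map_smul, smul_assoc, ← h hp]
  · intro p a b ha hb hp; rw [map_add, add_smul, ← ha hp, ← hb hp]
  · intro i hi x _ p a ha _ hp
    rw [weightFil_neg (by omega), Submodule.mem_bot] at ha
    rw [ha, mul_zero, map_zero, zero_smul]

/-- The coprojection of an element of weight at most `p` lies in any subspace that contains the
components of degree at most `p`. -/
theorem coproj_mem_of_weightFil {S : Submodule k V} {p : ℤ} {a : GSym G.shift}
    (ha : a ∈ weightFil G p) (hS : ∀ i, 1 ≤ i → i ≤ p → G.gr i ≤ S) : coproj G.shift a ∈ S := by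
  refine weightFil_induction (P := fun p a => (∀ i, 1 ≤ i → i ≤ p → G.gr i ≤ S) →
    coproj G.shift a ∈ S) ?_ ?_ ?_ ?_ ?_ ha hS
  · intro _ _; rw [map_zero]; exact Submodule.zero_mem _
  · intro _ _ _; rw [coproj_one]; exact Submodule.zero_mem _
  · intro p c a h hS; rw [map_smul]; exact Submodule.smul_mem _ _ (h hS)
  · intro p a b h h' hS; rw [map_add]; exact Submodule.add_mem _ (h hS) (h' hS)
  · intro i hi x hx p a ha _ hS
    rw [coproj_ι_mul]
    by_cases hp : p < 0
    · rw [weightFil_neg hp, Submodule.mem_bot] at ha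
      rw [ha, map_zero, zero_smul]
      exact Submodule.zero_mem _
    · exact Submodule.smul_mem _ _ (hS i hi (by omega) hx)

theorem sign_mem_weightFil (n : ℤ) {p : ℤ} {a : GSym G.shift} (ha : a ∈ weightFil G p) :
    (grading G.shift).sign n a ∈ weightFil G p := by
  refine weightFil_induction (P := fun p a => (grading G.shift).sign n a ∈ weightFil G p)
    ?_ ?_ ?_ ?_ ?_ ha
  · intro p; rw [map_zero]; exact Submodule.zero_mem _
  · intro p hp; rw [sign_one]; exact one_mem_weightFil hp
  · intro p c a h; rw [map_smul]; exact Submodule.smul_mem _ _ h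
  · intro p a b h h'; rw [map_add]; exact Submodule.add_mem _ h h'
  · intro j hj y hy p a _ h
    rw [sign_ι_mul _ (mem_shift hy)]
    exact Submodule.smul_mem _ _ (ι_mul_mem_weightFil' hj hy h)

/-- The span of the tensors whose first factor has weight at most `p`. -/
def weightTensor (G : Grading k V) (p : ℤ) : Submodule k (GSym G.shift ⊗[k] GSym G.shift) :=
  Submodule.span k {z | ∃ a ∈ weightFil G p, ∃ b, a ⊗ₜ[k] b = z}

theorem tmul_mem_weightTensor {p : ℤ} {a : GSym G.shift} (ha : a ∈ weightFil G p)
    (b : GSym G.shift) : a ⊗ₜ[k] b ∈ weightTensor G p :=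
  Submodule.subset_span ⟨a, ha, b, rfl⟩

theorem tensorOp_mem_weightTensor {i p : ℤ} {x : V} (hi : 1 ≤ i) (hx : x ∈ G.gr i)
    {z : GSym G.shift ⊗[k] GSym G.shift} (hz : z ∈ weightTensor G p) :
    (grading G.shift).tensorOp (i + 1) (mulL G.shift x) z ∈ weightTensor G (i + p) := by
  have h : weightTensor G p ≤ (weightTensor G (i + p)).comap
      ((grading G.shift).tensorOp (i + 1) (mulL G.shift x)) := by
    refine Submodule.span_le.2 ?_
    rintro _ ⟨b, hb, c, rfl⟩
    rw [SetLike.mem_coe, Submodule.mem_comap, Grading.tensorOp_tmul]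
    exact Submodule.add_mem _ (tmul_mem_weightTensor (ι_mul_mem_weightFil' hi hx hb) _)
      (tmul_mem_weightTensor (weightFil_mono (by omega) (sign_mem_weightFil _ hb)) _)
  exact h hz

/-- `Δ a - a ⊗ 1` has first factors of smaller weight. -/
theorem comul_sub_mem {p : ℤ} {a : GSym G.shift} (ha : a ∈ weightFil G p) :
    comul G.shift a - a ⊗ₜ[k] 1 ∈ weightTensor G (p - 1) := by
  refine weightFil_induction (P := fun p a =>
    comul G.shift a - a ⊗ₜ[k] 1 ∈ weightTensor G (p - 1)) ?_ ?_ ?_ ?_ ?_ ha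
  · intro p; rw [map_zero, TensorProduct.zero_tmul, sub_zero]; exact Submodule.zero_mem _
  · intro p _; rw [comul_one, sub_self]; exact Submodule.zero_mem _
  · intro p c a h
    rw [map_smul, ← TensorProduct.smul_tmul', ← smul_sub]
    exact Submodule.smul_mem _ _ h
  · intro p a b h h'
    rw [map_add, TensorProduct.add_tmul, add_sub_add_comm]
    exact Submodule.add_mem _ h h'
  · intro i hi x hx p a ha h
    -- Besides `x a ⊗ 1`, the operator applied to `a ⊗ 1` produces `± a ⊗ x`. Its first factor has
    -- weight at most `p ≤ i + p - 1`, because `i ≥ 1`, and it joins the error term.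
    have h1 := tensorOp_mem_weightTensor hi hx h
    rw [map_sub, ← comul_ι_mul (mem_shift hx), Grading.tensorOp_tmul, mulL_apply, ← sub_sub,
      ← add_sub_assoc] at h1
    exact (Submodule.sub_mem_iff_left _ (tmul_mem_weightTensor
      (weightFil_mono (by omega) (sign_mem_weightFil _ ha)) _)).1 h1

/-- Linear maps on `S(sV) ⊗ S(sV)` that kill the tensors whose first factor is of weight less than
`p` only see the term `a ⊗ 1` of the coproduct. -/
theorem apply_comul_eq {W : Type w} [AddCommGroup W] [Module k W] {p : ℤ}
    {F : GSym G.shift ⊗[k] GSym G.shift →ₗ[k] W}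
    (hF : ∀ a ∈ weightFil G (p - 1), ∀ b, F (a ⊗ₜ b) = 0) {a : GSym G.shift}
    (ha : a ∈ weightFil G p) : F (comul G.shift a) = F (a ⊗ₜ 1) := by
  have h : weightTensor G (p - 1) ≤ LinearMap.ker F := by
    refine Submodule.span_le.2 ?_
    rintro _ ⟨a, ha, b, rfl⟩
    exact hF a ha b
  have h1 := h (comul_sub_mem ha)
  rwa [LinearMap.mem_ker, map_sub, sub_eq_zero] at h1

/-- The coderivation with corestriction `f`, on elements of weight `p`, for `f` vanishing in
smaller weights. -/
theorem coLift_eq_of_weightFil {p : ℤ} {f : GSym G.shift →ₗ[k] V}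
    (hf : ∀ a ∈ weightFil G (p - 1), f a = 0) {a : GSym G.shift} (ha : a ∈ weightFil G p) :
    coLift f a = ι G.shift (f a) := by
  rw [coLift, LinearMap.comp_apply, apply_comul_eq (p := p) (fun a ha b => ?_) ha, mulLeftBy_tmul,
    mul_one]
  rw [mulLeftBy_tmul, hf a ha, map_zero, zero_mul]

theorem ι_mul_mem_weightFil (hG : ∀ i : ℤ, i ≤ 0 → G.gr i = ⊥) {i p : ℤ} {x : V}
    (hx : x ∈ G.gr i) {a : GSym G.shift} (ha : a ∈ weightFil G p) :
    ι G.shift x * a ∈ weightFil G (i + p) := by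
  by_cases hi : i ≤ 0
  · rw [hG i hi, Submodule.mem_bot] at hx
    rw [hx, map_zero, zero_mul]
    exact Submodule.zero_mem _
  · exact ι_mul_mem_weightFil' (by omega) hx ha

theorem ι_mem_weightFil (hG : ∀ i : ℤ, i ≤ 0 → G.gr i = ⊥) {i : ℤ} {x : V}
    (hx : x ∈ G.gr i) : ι G.shift x ∈ weightFil G i := by
  have h := ι_mul_mem_weightFil hG hx (one_mem_weightFil le_rfl)
  rwa [mul_one, add_zero] at h

/-- The filtration is exhaustive because `V` lives in positive degrees; this is what makes induction
on the weight reach every element. -/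
theorem exists_mem_weightFil (hG : ∀ i : ℤ, i ≤ 0 → G.gr i = ⊥) (a : GSym G.shift) :
    ∃ p : ℕ, a ∈ weightFil G p := by
  refine induction G.shift (P := fun a => ∃ p : ℕ, a ∈ weightFil G p)
    ⟨0, one_mem_weightFil le_rfl⟩ ?_ ?_ ?_ a
  · rintro c a ⟨p, hp⟩
    exact ⟨p, Submodule.smul_mem _ _ hp⟩
  · rintro a b ⟨p, hp⟩ ⟨q, hq⟩
    exact ⟨p + q, Submodule.add_mem _ (weightFil_mono (by omega) hp)
      (weightFil_mono (by omega) hq)⟩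
  · rintro i x hx a ⟨p, hp⟩
    refine ⟨i.toNat + p, weightFil_mono ?_ (ι_mul_mem_weightFil hG (show x ∈ G.gr (i - 1) from hx)
      hp)⟩
    omega

/-- A coderivation of `S(sV)` is determined by its corestriction. -/
theorem coderivation_eq_zero [CharZero k] (hG : ∀ i : ℤ, i ≤ 0 → G.gr i = ⊥) {n : ℤ}
    {θ : Module.End k (GSym G.shift)}
    (hθ : ∀ c, comul G.shift (θ c) = (grading G.shift).tensorOp n θ (comul G.shift c))
    (h0 : ∀ c, coproj G.shift (θ c) = 0) : θ = 0 := by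
  -- The shift by one makes the base case the zero space of negative weight.
  have key : ∀ p : ℕ, ∀ c ∈ weightFil G ((p : ℤ) - 1), θ c = 0 := by
    intro p
    induction p with
    | zero =>
      intro c hc
      rw [weightFil_neg (by simp), Submodule.mem_bot] at hc
      rw [hc, map_zero]
    | succ p ih =>
      intro c hc
      rw [Nat.cast_succ, add_sub_cancel_right] at hc
      -- The word length of `θ c` is computed from `Δ θ c = (θ ⊗ 1 + 1 ⊗ θ) Δ c`. Terms with first
      -- factor of smaller weight vanish by induction and by `p θ = 0`; the term `c ⊗ 1` gives `p 1
      -- = 0` and `p θ 1 = 0`. Hence `θ c` is a scalar, and the counit kills it.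
      have h1 : derExt G.shift (idDeg G.shift) (θ c) = 0 := by
        rw [idDeg, ← mul_coproj_comul, hθ]
        have h2 := apply_comul_eq (p := p) (F := LinearMap.mul' k (GSym G.shift) ∘ₗ
          (ι G.shift ∘ₗ coproj G.shift).lTensor (GSym G.shift) ∘ₗ
            (grading G.shift).tensorOp n θ) (fun a ha b => ?_) hc
        · simp only [LinearMap.comp_apply] at h2
          rw [h2]
          simp [Grading.tensorOp_tmul, coproj_one, h0]
        · simp [Grading.tensorOp_tmul, ih a ha, h0]
      rw [eq_counit_of_derExt_id h1, counit_coderivation hθ, zero_smul]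
  refine LinearMap.ext fun c => ?_
  obtain ⟨p, hp⟩ := exists_mem_weightFil hG c
  exact key (p + 1) c (by rwa [Nat.cast_succ, add_sub_cancel_right])

end GSym

end DGL

end

noncomputable section

namespace DGL

/-! ### The canonical map `sπ ♯ Der π → Der C(π)` -/

/-- A graded commutator of derivations is a derivation, so both sides satisfy the same recursion
over letters. -/
theorem GSym.derExt_commutator {k : Type u} [Field k] {V : Type v} [AddCommGroup V] [Module k V]
    {G : Grading k V} {m n : ℤ} (θ : G.homDeg m) (φ : G.homDeg n) (ψ : G.homDeg (m + n))
    (h : (θ : Module.End k V) * φ - sgn k (m * n) • ((φ : Module.End k V) * θ) = ψ)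
    (a : GSym G) : derExt G θ (derExt G φ a) - sgn k (m * n) • derExt G φ (derExt G θ a) =
      derExt G ψ a := by
  refine LinearMap.congr_fun (f := derExt G θ ∘ₗ derExt G φ -
    sgn k (m * n) • (derExt G φ ∘ₗ derExt G θ)) (g := derExt G ψ) (ext_rec ?_ ?_) a
  · simp [derExt_one]
  · intro i x hx a h1
    simp only [LinearMap.comp_apply, LinearMap.sub_apply, LinearMap.smul_apply] at h1 ⊢
    have h2 : (ψ : Module.End k V) x = (θ : Module.End k V) ((φ : Module.End k V) x) -
      sgn k (m * n) • (φ : Module.End k V) ((θ : Module.End k V) x) := by rw [← h]; rfl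
    rw [derExt_ι_mul φ hx, derExt_ι_mul θ hx, derExt_ι_mul ψ hx, map_add, map_add, map_smul,
      map_smul, derExt_ι_mul θ hx, derExt_ι_mul φ hx, derExt_ι_mul θ (φ.2 i x hx),
      derExt_ι_mul φ (θ.2 i x hx), ← h1, h2]
    simp only [map_sub, map_smul, sub_mul, mul_sub, mul_add, add_mul, smul_add, smul_sub, smul_smul,
      sgn_add, smul_mul_assoc, mul_smul_comm, mul_comm n m]
    rcases sgn_cases (k := k) (m * i) with h2 | h2 <;>
      rcases sgn_cases (k := k) (n * i) with h3 | h3 <;>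
      rcases sgn_cases (k := k) (m * n) with h4 | h4 <;>
      simp only [h2, h3, h4] <;> module

namespace DGLieAlgebra

open GSym

variable {k : Type u} [Field k] {L : Type v} [AddCommGroup L] [Module k L] (π : DGLieAlgebra k L)

theorem der_le_homDeg_shift (n : ℤ) : π.der n ≤ π.shift.homDeg n := fun θ hθ i x hx => by
  have h : θ x ∈ π.gr (n + (i - 1)) := hθ.1 (i - 1) x hx
  rwa [← add_sub_assoc] at h

/-- The coderivation of `C(π)` that extends a derivation of `π` (without the sign). -/
def derCoext (n : ℤ) : π.der n →ₗ[k] Module.End k π.CESpace :=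
  derExtLin n ∘ₗ Submodule.inclusion (π.der_le_homDeg_shift n)

theorem derCoext_eq {n : ℤ} (θ : π.der n) :
    π.derCoext n θ = derExt π.shift ⟨θ, π.der_le_homDeg_shift n θ.2⟩ := rfl

theorem derCoext_mem {n : ℤ} (θ : π.der n) : π.derCoext n θ ∈ π.CE.coder n :=
  ⟨derExt_mem _, fun c => comul_derExt _ c⟩

theorem mulL_mem_coder {i : ℤ} {x : L} (hx : x ∈ π.shift.gr i) :
    mulL π.shift x ∈ π.CE.coder i :=
  ⟨mulL_mem hx, fun c => comul_ι_mul hx c⟩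

theorem derCoext_one {n : ℤ} (θ : π.der n) : π.derCoext n θ 1 = 0 := derExt_one _

theorem derCoext_ι_mul {n : ℤ} (θ : π.der n) {i : ℤ} {x : L} (hx : x ∈ π.shift.gr i)
    (a : π.CESpace) : π.derCoext n θ (ι π.shift x * a) =
      ι π.shift ((θ : Module.End k L) x) * a + sgn k (n * i) • (ι π.shift x * π.derCoext n θ a) :=
  derExt_ι_mul _ hx a

theorem coproj_derCoext {n : ℤ} (θ : π.der n) (a : π.CESpace) :
    coproj π.shift (π.derCoext n θ a) = (θ : Module.End k L) (coproj π.shift a) :=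
  coproj_derExt _ a

/-- This is the link between the differential and `ρ`: the operator `ceAd x`, which occurs in the
commutator of `d` with `sx`, is the coderivation that `ρ` assigns to `ad x`, sign included. -/
theorem ceAd_eq_derCoext {i : ℤ} {x : L} (hx : x ∈ π.gr i) :
    π.ceAd x = sgn k i • π.derCoext i ⟨π.bracket x, π.bracket_mem_der hx⟩ := by
  have hx' := mem_shift hx
  refine ext_rec ?_ fun l z hz a h => ?_
  · simp [ceAd_one, derCoext_one]
  · rw [LinearMap.smul_apply] at h ⊢
    rw [π.ceAd_ι_mul hx' hz, π.derCoext_ι_mul _ hz, h]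
    simp only [add_sub_cancel_right, smul_add, smul_comm (sgn k i), mul_smul_comm]

/-- The commutator of `θ` with `[x, -]` is `[θ x, -]`. The factor `(-1)^n` compares the sign
`(-1)^|x|` built into `ceAd x` with the sign `(-1)^|θ x|` in `ceAd (θ x)`. -/
theorem derCoext_ceAd {n : ℤ} (θ : π.der n) {i : ℤ} {x : L} (hx : x ∈ π.gr i)
    (a : π.CESpace) : π.derCoext n θ (π.ceAd x a) =
      sgn k n • π.ceAd ((θ : Module.End k L) x) a +
        sgn k (n * i) • π.ceAd x (π.derCoext n θ a) := by
  have h := derExt_commutator (⟨θ, π.der_le_homDeg_shift n θ.2⟩ : π.shift.homDeg n)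
    (⟨π.bracket x, π.der_le_homDeg_shift i (π.bracket_mem_der hx)⟩ : π.shift.homDeg i)
    ⟨π.bracket ((θ : Module.End k L) x),
      π.der_le_homDeg_shift (n + i) (π.bracket_mem_der (θ.2.1 i x hx))⟩
    (LinearMap.ext fun y => by simp [θ.2.2 i x hx y]) a
  rw [π.ceAd_eq_derCoext hx, π.ceAd_eq_derCoext (θ.2.1 i x hx), LinearMap.smul_apply,
    LinearMap.smul_apply, LinearMap.smul_apply, map_smul, smul_smul, ← sgn_add,
    show n + (n + i) = i + 2 * n by ring]
  rw [derCoext_eq, derCoext_eq, derCoext_eq, ← h, sgn_add, two_mul, sgn_add]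
  rcases sgn_cases (k := k) n with h1 | h1 <;> simp only [h1] <;> module

/-- Both sides kill the unit and have the same commutator with each letter. The linear part of `d`
contributes `-[d, θ]`; the contributions of the quadratic part cancel because `θ` is a derivation.
-/
theorem ceDiff_derCoext_aux {m : ℤ} (θ : π.der (m + 1)) (φ : π.der m)
    (h : (φ : Module.End k L) = π.d * θ - sgn k (m + 1) • ((θ : Module.End k L) * π.d))
    (a : π.CESpace) : π.ceDiff (π.derCoext (m + 1) θ a) -
      sgn k (m + 1) • π.derCoext (m + 1) θ (π.ceDiff a) = -π.derCoext m φ a := by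
  have hθ := π.der_le_homDeg_shift (m + 1) θ.2
  refine LinearMap.congr_fun (f := π.ceDiff ∘ₗ π.derCoext (m + 1) θ -
    sgn k (m + 1) • (π.derCoext (m + 1) θ ∘ₗ π.ceDiff)) (g := -π.derCoext m φ) (ext_rec ?_ ?_) a
  · simp [ceDiff_one, derCoext_one]
  · intro l z hz a ih
    simp only [LinearMap.comp_apply, LinearMap.sub_apply, LinearMap.neg_apply,
      LinearMap.smul_apply] at ih ⊢
    have hj : (φ : Module.End k L) z = π.d ((θ : Module.End k L) z) -
        sgn k (m + 1) • (θ : Module.End k L) (π.d z) := by rw [h]; rfl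
    rw [sub_eq_iff_eq_add] at ih
    rw [π.derCoext_ι_mul θ hz, π.ceDiff_ι_mul hz, map_add, map_add, map_add, map_neg, map_smul,
      map_smul, π.ceDiff_ι_mul hz, π.ceDiff_ι_mul (hθ l z hz), π.derCoext_ι_mul θ hz,
      π.derCoext_ι_mul θ (π.shift_d_mem hz), π.derCoext_ι_mul φ hz,
      π.derCoext_ceAd θ (show z ∈ π.gr (l - 1) from hz), ih, hj]
    simp only [map_sub, map_smul, sub_mul, mul_sub, add_mul, mul_add, mul_neg, smul_add, smul_neg,
      smul_smul, sgn_sub, neg_add, sgn_add, sgn_one, one_mul, mul_one, smul_mul_assoc,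
      mul_smul_comm]
    rcases sgn_cases (k := k) (m * l) with h2 | h2 <;>
      rcases sgn_cases (k := k) l with h5 | h5 <;>
      rcases sgn_cases (k := k) m with h6 | h6 <;>
      simp only [h2, h5, h6] <;> module

/-- The commutator of the differential of `C(π)` with the coderivation extending `θ`. -/
theorem ceDiff_derCoext {n m : ℤ} (θ : π.der n) (φ : π.der m) (hm : n = m + 1)
    (h : (φ : Module.End k L) = π.d * θ - sgn k n • ((θ : Module.End k L) * π.d)) (a : π.CESpace) :
    π.ceDiff (π.derCoext n θ a) - sgn k n • π.derCoext n θ (π.ceDiff a) =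
      -π.derCoext m φ a := by
  subst hm
  exact π.ceDiff_derCoext_aux θ φ h a

/-- The linear map underlying the canonical map `ρ`. -/
def rhoLin : π.SemidirectSpace →ₗ[k] π.CE.CoderSpace :=
  LinearMap.coprod
    (π.shift.glue fun i => Tot.of π.CE.coder i ∘ₗ
      (mulL π.shift ∘ₗ (π.shift.gr i).subtype).codRestrict (π.CE.coder i)
        fun x => π.mulL_mem_coder x.2)
    (Tot.lift π.der fun n => Tot.of π.CE.coder n ∘ₗ
      (sgn k n • π.derCoext n).codRestrict (π.CE.coder n)
        fun θ => Submodule.smul_mem _ _ (π.derCoext_mem θ))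

theorem rhoLin_s {i : ℤ} {x : L} (hx : x ∈ π.shift.gr i) :
    π.rhoLin (x, 0) = Tot.of π.CE.coder i ⟨mulL π.shift x, π.mulL_mem_coder hx⟩ := by
  rw [rhoLin, LinearMap.coprod_apply, map_zero, add_zero, π.shift.glue_apply _ hx]
  rfl

theorem rhoLin_der {n : ℤ} (θ : π.der n) : π.rhoLin (0, Tot.of π.der n θ) =
    Tot.of π.CE.coder n ⟨sgn k n • π.derCoext n θ,
      Submodule.smul_mem _ _ (π.derCoext_mem θ)⟩ := by
  rw [rhoLin, LinearMap.coprod_apply, map_zero, zero_add, Tot.lift_of]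
  rfl

theorem coder_bracket_of {i j : ℤ} (f : π.CE.coder i) (g : π.CE.coder j) :
    π.CE.Coder.bracket (Tot.of π.CE.coder i f) (Tot.of π.CE.coder j g) =
      Tot.of π.CE.coder (i + j) ⟨_, π.CE.coder_commutator f.2 g.2⟩ :=
  commBracket_lof _ (fun hf hg => π.CE.coder_commutator hf hg) f g

theorem coder_d_of {i : ℤ} (f : π.CE.coder i) :
    π.CE.Coder.d (Tot.of π.CE.coder i f) =
      Tot.of π.CE.coder (-1 + i) ⟨_, π.CE.coder_commutator π.CE.d_mem_coder f.2⟩ :=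
  commBracket_lof _ (fun hf hg => π.CE.coder_commutator hf hg) _ f

theorem der_bracket_of {i j : ℤ} (f : π.der i) (g : π.der j) :
    π.Der.bracket (Tot.of π.der i f) (Tot.of π.der j g) =
      Tot.of π.der (i + j) ⟨_, π.der_commutator f.2 g.2⟩ :=
  commBracket_lof _ (fun hf hg => π.der_commutator hf hg) f g

theorem der_d_of {i : ℤ} (f : π.der i) : π.Der.d (Tot.of π.der i f) =
      Tot.of π.der (-1 + i) ⟨_, π.der_commutator π.d_mem_der f.2⟩ :=
  commBracket_lof _ (fun hf hg => π.der_commutator hf hg) _ f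

theorem ad_of {i : ℤ} {x : L} (hx : x ∈ π.gr i) :
    π.ad x = Tot.of π.der i ⟨π.bracket x, π.bracket_mem_der hx⟩ := by
  rw [ad, π.glue_apply _ hx]
  rfl

theorem rhoLin_mem {i : ℤ} {a : π.SemidirectSpace} (ha : a ∈ π.semidirect.gr i) :
    π.rhoLin a ∈ π.CE.Coder.gr i := by
  obtain ⟨x, f⟩ := a
  obtain ⟨hx, θ, rfl⟩ := ha
  have h : ((x, Tot.of π.der i θ) : π.SemidirectSpace) = (x, 0) + (0, Tot.of π.der i θ) := by simp
  rw [h, map_add, π.rhoLin_s hx, π.rhoLin_der θ]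
  exact Submodule.add_mem _ ⟨_, rfl⟩ ⟨_, rfl⟩

theorem rhoLin_bracket_s_s {i j : ℤ} {x y : L} (hx : x ∈ π.shift.gr i) (hy : y ∈ π.shift.gr j) :
    π.rhoLin (π.semidirect.bracket (x, 0) (y, 0)) =
      π.CE.Coder.bracket (π.rhoLin (x, 0)) (π.rhoLin (y, 0)) := by
  have h : π.semidirect.bracket (x, 0) (y, 0) = 0 := by
    change (π.actLeft 0 y - π.actRight 0 x, π.Der.bracket 0 0) = 0
    simp
  rw [h, map_zero, π.rhoLin_s hx, π.rhoLin_s hy, coder_bracket_of,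
    ← map_zero (Tot.of π.CE.coder (i + j))]
  refine Tot.of_congr _ rfl ?_
  change 0 = _ - _
  rw [eq_comm, sub_eq_zero]
  exact mulL_comm hx hy

theorem rhoLin_bracket_der_s {n j : ℤ} (θ : π.der n) {y : L} (hy : y ∈ π.shift.gr j) :
    π.rhoLin (π.semidirect.bracket (0, Tot.of π.der n θ) (y, 0)) =
      π.CE.Coder.bracket (π.rhoLin (0, Tot.of π.der n θ)) (π.rhoLin (y, 0)) := by
  have h : π.semidirect.bracket (0, Tot.of π.der n θ) (y, 0) =
      (sgn k n • (θ : Module.End k L) y, 0) := by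
    change (π.actLeft (Tot.of π.der n θ) y - π.actRight 0 0, π.Der.bracket _ 0) = _
    rw [π.actLeft_apply ⟨θ, rfl⟩, derToEnd_lof]
    simp
  have hθ := π.der_le_homDeg_shift n θ.2 j y hy
  rw [h, π.rhoLin_s (Submodule.smul_mem _ _ hθ), π.rhoLin_s hy, π.rhoLin_der, coder_bracket_of]
  refine Tot.of_congr _ rfl (LinearMap.ext fun a => ?_)
  simp only [LinearMap.sub_apply, LinearMap.smul_apply, Module.End.mul_apply, mulL_apply,
    π.derCoext_ι_mul θ hy, map_smul, smul_mul_assoc, mul_smul_comm, smul_add]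
  module

theorem rhoLin_bracket_der_der {m n : ℤ} (θ : π.der m) (φ : π.der n) :
    π.rhoLin (π.semidirect.bracket (0, Tot.of π.der m θ) (0, Tot.of π.der n φ)) =
      π.CE.Coder.bracket (π.rhoLin (0, Tot.of π.der m θ)) (π.rhoLin (0, Tot.of π.der n φ)) := by
  have h : π.semidirect.bracket (0, Tot.of π.der m θ) (0, Tot.of π.der n φ) =
      (0, Tot.of π.der (m + n) ⟨_, π.der_commutator θ.2 φ.2⟩) := by
    change (π.actLeft (Tot.of π.der m θ) 0 - π.actRight (Tot.of π.der n φ) 0, π.Der.bracket _ _) = _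
    rw [der_bracket_of, map_zero, map_zero, sub_zero]
  rw [h, rhoLin_der, rhoLin_der, rhoLin_der, coder_bracket_of]
  refine Tot.of_congr _ rfl (LinearMap.ext fun a => ?_)
  have h1 := derExt_commutator (⟨θ, π.der_le_homDeg_shift m θ.2⟩ : π.shift.homDeg m)
    (⟨φ, π.der_le_homDeg_shift n φ.2⟩ : π.shift.homDeg n)
    ⟨_, π.der_le_homDeg_shift (m + n) (π.der_commutator θ.2 φ.2)⟩ rfl a
  simp only [LinearMap.sub_apply, LinearMap.smul_apply, Module.End.mul_apply, derCoext_eq,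
    map_smul, ← h1, sgn_add]
  module

theorem rhoLin_bracket (a b : π.SemidirectSpace) : π.rhoLin (π.semidirect.bracket a b) =
    π.CE.Coder.bracket (π.rhoLin a) (π.rhoLin b) := by
  have hs : ∀ (x : L) (b : π.SemidirectSpace), (∀ i j, x ∈ π.shift.gr i → b ∈ π.semidirect.gr j →
      π.rhoLin (π.semidirect.bracket b (x, 0)) =
        π.CE.Coder.bracket (π.rhoLin b) (π.rhoLin (x, 0)) →
      π.rhoLin (π.semidirect.bracket (x, 0) b) =
        π.CE.Coder.bracket (π.rhoLin (x, 0)) (π.rhoLin b)) := by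
    intro x b i j hx hb h
    have hx' : ((x, 0) : π.SemidirectSpace) ∈ π.semidirect.gr i := ⟨hx, Submodule.zero_mem _⟩
    -- Skew symmetry on both sides reduces the order `[sx, θ]` to the order `[θ, sx]`.
    rw [π.semidirect.skew hx' hb, map_neg, map_smul, h,
      π.CE.Coder.skew (π.rhoLin_mem hx') (π.rhoLin_mem hb)]
  have key : ∀ a b : π.SemidirectSpace,
      (∀ i, ∀ x ∈ π.shift.gr i, π.rhoLin (π.semidirect.bracket (x, 0) b) =
        π.CE.Coder.bracket (π.rhoLin (x, 0)) (π.rhoLin b)) →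
      (∀ n (θ : π.der n), π.rhoLin (π.semidirect.bracket (0, Tot.of π.der n θ) b) =
        π.CE.Coder.bracket (π.rhoLin (0, Tot.of π.der n θ)) (π.rhoLin b)) →
      π.rhoLin (π.semidirect.bracket a b) = π.CE.Coder.bracket (π.rhoLin a) (π.rhoLin b) := by
    rintro ⟨x, f⟩ b h1 h2
    have h : ((x, f) : π.SemidirectSpace) = LinearMap.inl k _ _ x + LinearMap.inr k _ _ f := by simp
    rw [h]
    simp only [map_add, LinearMap.add_apply]
    congr 1
    · exact LinearMap.congr_fun (f := π.rhoLin ∘ₗ π.semidirect.bracket.flip b ∘ₗ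
        LinearMap.inl k L π.DerSpace) (g := π.CE.Coder.bracket.flip (π.rhoLin b) ∘ₗ π.rhoLin ∘ₗ
        LinearMap.inl k L π.DerSpace) (π.shift.ext_hom fun i x hx => h1 i x hx) x
    · exact LinearMap.congr_fun (f := π.rhoLin ∘ₗ π.semidirect.bracket.flip b ∘ₗ
        LinearMap.inr k L π.DerSpace) (g := π.CE.Coder.bracket.flip (π.rhoLin b) ∘ₗ π.rhoLin ∘ₗ
        LinearMap.inr k L π.DerSpace) ((Tot.grading π.der).ext_hom (by
          rintro i _ ⟨θ, rfl⟩; exact h2 i θ)) f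
  have key2 : ∀ a b : π.SemidirectSpace,
      (∀ i, ∀ x ∈ π.shift.gr i, π.rhoLin (π.semidirect.bracket a (x, 0)) =
        π.CE.Coder.bracket (π.rhoLin a) (π.rhoLin (x, 0))) →
      (∀ n (θ : π.der n), π.rhoLin (π.semidirect.bracket a (0, Tot.of π.der n θ)) =
        π.CE.Coder.bracket (π.rhoLin a) (π.rhoLin (0, Tot.of π.der n θ))) →
      π.rhoLin (π.semidirect.bracket a b) = π.CE.Coder.bracket (π.rhoLin a) (π.rhoLin b) := by
    rintro a ⟨x, f⟩ h1 h2
    have h : ((x, f) : π.SemidirectSpace) = LinearMap.inl k _ _ x + LinearMap.inr k _ _ f := by simp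
    rw [h]
    simp only [map_add]
    congr 1
    · exact LinearMap.congr_fun (f := π.rhoLin ∘ₗ π.semidirect.bracket a ∘ₗ
        LinearMap.inl k L π.DerSpace) (g := π.CE.Coder.bracket (π.rhoLin a) ∘ₗ π.rhoLin ∘ₗ
        LinearMap.inl k L π.DerSpace) (π.shift.ext_hom fun i x hx => h1 i x hx) x
    · exact LinearMap.congr_fun (f := π.rhoLin ∘ₗ π.semidirect.bracket a ∘ₗ
        LinearMap.inr k L π.DerSpace) (g := π.CE.Coder.bracket (π.rhoLin a) ∘ₗ π.rhoLin ∘ₗ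
        LinearMap.inr k L π.DerSpace) ((Tot.grading π.der).ext_hom (by
          rintro i _ ⟨θ, rfl⟩; exact h2 i θ)) f
  refine key a b (fun i x hx => key2 _ b (fun j y hy => π.rhoLin_bracket_s_s hx hy)
    fun n θ => hs x _ i n hx ⟨Submodule.zero_mem _, θ, rfl⟩ (π.rhoLin_bracket_der_s θ hx))
    (fun n θ => key2 _ b (fun j y hy => π.rhoLin_bracket_der_s θ hy)
      fun m φ => π.rhoLin_bracket_der_der θ φ)

theorem rhoLin_d (a : π.SemidirectSpace) :
    π.rhoLin (π.semidirect.d a) = π.CE.Coder.d (π.rhoLin a) := by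
  refine LinearMap.congr_fun (f := π.rhoLin ∘ₗ π.semidirect.d) (g := π.CE.Coder.d ∘ₗ π.rhoLin)
    (LinearMap.prod_ext (π.shift.ext_hom fun i x hx => ?_)
      ((Tot.grading π.der).ext_hom ?_)) a
  · simp only [LinearMap.comp_apply, LinearMap.inl_apply]
    have h : π.semidirect.d (x, 0) = (-π.d x, 0) + (0, π.ad x) := by
      change (-π.d x, π.ad x + π.Der.d 0) = _
      simp
    have hx' : x ∈ π.gr (i - 1) := hx
    rw [h, map_add, π.rhoLin_s (Submodule.neg_mem _ (π.shift_d_mem hx)), π.ad_of hx', rhoLin_der,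
      π.rhoLin_s hx, coder_d_of, ← map_add]
    refine Tot.of_congr _ (by ring) (LinearMap.ext fun a => ?_)
    have h1 := LinearMap.congr_fun (π.ceAd_eq_derCoext hx') a
    simp only [LinearMap.smul_apply] at h1
    simp only [Submodule.coe_add, LinearMap.add_apply, LinearMap.sub_apply, LinearMap.smul_apply,
      Module.End.mul_apply, mulL_apply, ← h1, map_neg, neg_mul, one_mul, sgn_neg]
    change _ = π.ceDiff (ι π.shift x * a) - sgn k i • (ι π.shift x * π.ceDiff a)
    rw [π.ceDiff_ι_mul hx, add_sub_cancel_right]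
    rfl
  · rintro n _ ⟨θ, rfl⟩
    simp only [LinearMap.comp_apply, LinearMap.inr_apply]
    have h : π.semidirect.d (0, Tot.of π.der n θ) = (0, π.Der.d (Tot.of π.der n θ)) := by
      change (-π.d 0, π.ad 0 + π.Der.d _) = _
      simp
    rw [h, der_d_of, rhoLin_der, rhoLin_der, coder_d_of]
    generalize hφ : (⟨_, π.der_commutator π.d_mem_der θ.2⟩ : π.der (-1 + n)) = φ
    refine Tot.of_congr _ rfl (LinearMap.ext fun a => ?_)
    -- The minus sign produced here is absorbed by the factor `(-1)^|θ|` of `rhoLin`, since `[d, θ]`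
    -- has degree one less than `θ`.
    have h1 := π.ceDiff_derCoext θ φ (m := -1 + n) (by ring)
      (by
        rw [← hφ]
        change π.d * _ - sgn k (-1 * n) • _ = _
        rw [neg_mul, one_mul, sgn_neg]) a
    simp only [LinearMap.sub_apply, LinearMap.smul_apply, Module.End.mul_apply, neg_mul, one_mul,
      sgn_neg, sgn_add, sgn_one, map_smul]
    change _ = sgn k n • π.ceDiff _ - sgn k n • sgn k n • π.derCoext n θ (π.ceDiff a)
    rw [← smul_sub, h1, smul_neg, neg_smul]

/-- The canonical map `ρ : sπ ♯ Der π → Der C(π)`. -/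
def rho : Hom π.semidirect π.CE.Coder where
  toLin := π.rhoLin
  isHom := ⟨fun ha => π.rhoLin_mem ha, π.rhoLin_bracket⟩
  map_d := π.rhoLin_d

theorem coderToEnd_of {n : ℤ} (f : π.CE.coder n) :
    π.CE.coderToEnd (Tot.of π.CE.coder n f) = f := Tot.toAmbient_of _ f

theorem rho_isCanonical : π.IsCanonical π.rho where
  map_s x c := by
    refine LinearMap.congr_fun (f := (coproj π.shift ∘ₗ LinearMap.applyₗ (R := k) c) ∘ₗ
      π.CE.coderToEnd ∘ₗ π.rhoLin ∘ₗ LinearMap.inl k L π.DerSpace)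
      (g := Coalgebra.counit (R := k) c • LinearMap.id)
      (π.shift.ext_hom fun i x hx => ?_) x
    simp only [LinearMap.comp_apply, LinearMap.inl_apply, π.rhoLin_s hx, coderToEnd_of]
    exact coproj_ι_mul π.shift x c
  map_der n θ c := by
    change coproj π.shift (π.CE.coderToEnd (π.rhoLin _) c) = _
    rw [rhoLin_der, coderToEnd_of, LinearMap.smul_apply, map_smul, coproj_derCoext]

/-- Coderivations of `C(π)` are determined by their corestrictions. -/
theorem coder_ext [CharZero k] (hπ : ∀ i : ℤ, i ≤ 0 → π.gr i = ⊥) {n : ℤ}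
    {f g : Module.End k π.CESpace} (hf : f ∈ π.CE.coder n) (hg : g ∈ π.CE.coder n)
    (h : ∀ c, coproj π.shift (f c) = coproj π.shift (g c)) : f = g := by
  rw [← sub_eq_zero]
  exact coderivation_eq_zero hπ (Submodule.sub_mem _ hf hg).2 fun c => by
    rw [LinearMap.sub_apply, map_sub, h, sub_self]

theorem eq_of_mem_coder_gr [CharZero k] (hπ : ∀ i : ℤ, i ≤ 0 → π.gr i = ⊥) {n : ℤ}
    {a b : π.CE.CoderSpace} (ha : a ∈ π.CE.Coder.gr n) (hb : b ∈ π.CE.Coder.gr n)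
    (h : ∀ c, coproj π.shift (π.CE.coderToEnd a c) = coproj π.shift (π.CE.coderToEnd b c)) :
    a = b := by
  obtain ⟨f, rfl⟩ := ha
  obtain ⟨g, rfl⟩ := hb
  simp only [coderToEnd_of] at h
  exact Tot.of_congr _ rfl (π.coder_ext hπ f.2 g.2 h)

/-- On a homogeneous argument both maps take values in a single degree, where a coderivation is
determined by its corestriction; the latter is prescribed by `IsCanonical`. -/
theorem eq_rho [CharZero k] (hπ : ∀ i : ℤ, i ≤ 0 → π.gr i = ⊥)
    {ρ : Hom π.semidirect π.CE.Coder} (hρ : π.IsCanonical ρ) : ρ = π.rho := by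
  have h : ρ.toLin = π.rho.toLin := by
    refine LinearMap.prod_ext (π.shift.ext_hom fun i x hx => ?_) ((Tot.grading π.der).ext_hom ?_)
    · have hx' : ((x, 0) : π.SemidirectSpace) ∈ π.semidirect.gr i := ⟨hx, Submodule.zero_mem _⟩
      refine π.eq_of_mem_coder_gr hπ (ρ.isHom.map_mem hx') (π.rho.isHom.map_mem hx') fun c => ?_
      exact (hρ.map_s x c).trans (π.rho_isCanonical.map_s x c).symm
    · rintro n _ ⟨θ, rfl⟩
      have hx' : ((0, Tot.of π.der n θ) : π.SemidirectSpace) ∈ π.semidirect.gr n :=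
        ⟨Submodule.zero_mem _, θ, rfl⟩
      refine π.eq_of_mem_coder_gr hπ (ρ.isHom.map_mem hx') (π.rho.isHom.map_mem hx') fun c => ?_
      exact (hρ.map_der n θ c).trans (π.rho_isCanonical.map_der n θ c).symm
  cases ρ
  cases h
  rfl

end DGLieAlgebra

end DGL

end

noncomputable section

namespace DGL

/-! ### Constructions of gradings and of graded Lie algebras -/

namespace Grading

variable {k : Type u} [Field k] {V : Type v} [AddCommGroup V] [Module k V]
  {W : Type w} [AddCommGroup W] [Module k W] (G : Grading k V)

/-- The grading with components `G.gr (n + i)`. -/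
def translate (n : ℤ) : Grading k V where
  gr i := G.gr (n + i)
  internal := by
    refine internal_of_proj _ (fun i => G.proj (n + i)) (fun i x hx => G.proj_same hx)
      (fun i j h x hx => G.proj_ne (by omega) hx) fun x => ?_
    have h : ⨆ i, G.gr i ≤ ⨆ i, G.gr (n + i) := iSup_le fun i =>
      (le_of_eq (by rw [add_sub_cancel])).trans (le_iSup (fun i => G.gr (n + i)) (i - n))
    exact h (G.mem_iSup x)

/-- The transport of a grading along a linear isomorphism. -/
def transport (e : V ≃ₗ[k] W) : Grading k W where
  gr i := (G.gr i).comap e.symm.toLinearMap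
  internal := by
    refine internal_of_proj _ (fun i => e.toLinearMap ∘ₗ G.proj i ∘ₗ e.symm.toLinearMap)
      (fun i x hx => ?_) (fun i j h x hx => ?_) fun x => ?_
    · simp [G.proj_same (show e.symm x ∈ G.gr i from hx)]
    · simp [G.proj_ne h (show e.symm x ∈ G.gr i from hx)]
    · obtain ⟨y, rfl⟩ := e.surjective x
      refine G.induction (P := fun y => e y ∈ ⨆ n, (G.gr n).comap e.symm.toLinearMap) ?_ ?_ y
      · intro i y hy
        exact Submodule.mem_iSup_of_mem i (by simpa using hy)
      · intro y z hy hz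
        rw [map_add]
        exact Submodule.add_mem _ hy hz

/-- The grading of a homogeneous subspace. -/
def restrict (T : Submodule k V) (hT : ∀ n, ∀ x ∈ T, G.proj n x ∈ T) : Grading k T where
  gr i := (G.gr i).comap T.subtype
  internal := by
    refine internal_of_proj _ (fun i => (G.proj i).restrict (hT i))
      (fun i x hx => Subtype.ext (G.proj_same (x := (x : V)) hx))
      (fun i j h x hx => Subtype.ext (G.proj_ne h (x := (x : V)) hx)) fun x => ?_
    obtain ⟨s, hs⟩ := G.exists_finset_sum (x : V)
    have h : x = ∑ n ∈ s, (G.proj n).restrict (hT n) x := by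
      refine Subtype.ext ?_
      rw [Submodule.coe_sum]
      exact hs s (Finset.Subset.refl s)
    rw [h]
    exact Submodule.sum_mem _ fun n _ => Submodule.mem_iSup_of_mem n (G.proj_mem n (x : V))

end Grading

namespace GradedLieAlgebra

variable {k : Type u} [Field k] {L : Type v} [AddCommGroup L] [Module k L]
  {M : Type w} [AddCommGroup M] [Module k M] (A : GradedLieAlgebra k L)

/-- The transport of a graded Lie algebra along a linear isomorphism. -/
def transport (e : L ≃ₗ[k] M) : GradedLieAlgebra k M where
  toGrading := A.toGrading.transport e
  bracket := (A.bracket.compl₁₂ e.symm.toLinearMap e.symm.toLinearMap).compr₂ e.toLinearMap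
  bracket_mem {i j x y} hx hy := by
    change e.symm (e (A.bracket (e.symm x) (e.symm y))) ∈ A.gr (i + j)
    rw [e.symm_apply_apply]
    exact A.bracket_mem hx hy
  skew {i j x y} hx hy := by
    have h : A.bracket (e.symm x) (e.symm y) = _ := A.skew hx hy
    change e (A.bracket (e.symm x) (e.symm y)) = -(sgn k (i * j) • e (A.bracket _ _))
    rw [h, map_neg, map_smul]
    rfl
  jacobi {i j x y} hx hy z := by
    have h := A.jacobi (x := e.symm x) (y := e.symm y) hx hy (e.symm z)
    simp [h]

/-- A homogeneous subspace closed under the bracket is a graded Lie algebra. -/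
def restrict (T : Submodule k L) (hT : ∀ n, ∀ x ∈ T, A.proj n x ∈ T)
    (hb : ∀ x ∈ T, ∀ y ∈ T, A.bracket x y ∈ T) : GradedLieAlgebra k T where
  toGrading := A.toGrading.restrict T hT
  bracket := LinearMap.mk₂ k (fun x y => ⟨A.bracket x y, hb x x.2 y y.2⟩)
    (fun x y z => Subtype.ext (by simp)) (fun c x y => Subtype.ext (by simp))
    (fun x y z => Subtype.ext (by simp)) (fun c x y => Subtype.ext (by simp))
  bracket_mem hx hy := A.bracket_mem hx hy
  skew hx hy := Subtype.ext (A.skew hx hy)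
  jacobi hx hy z := Subtype.ext (A.jacobi hx hy (z : L))

section Extension

variable (H : Grading k M) (act : L →ₗ[k] Module.End k M) (ω : L →ₗ[k] L →ₗ[k] M)

/-- The right action `y ↦ (m ↦ (-1) ^ (|m| |y|) y m)` of a graded Lie algebra on a module. -/
def rightAct : L →ₗ[k] Module.End k M :=
  A.glue fun j => LinearMap.lcomp k M (H.sign j) ∘ₗ act ∘ₗ (A.gr j).subtype

theorem rightAct_apply {i j : ℤ} {y : L} {m : M} (hy : y ∈ A.gr j) (hm : m ∈ H.gr i) :
    A.rightAct H act y m = sgn k (i * j) • act y m := by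
  rw [rightAct, A.glue_apply _ hy]
  simp [H.sign_apply j hm, mul_comm]

/-- The extension of a graded Lie algebra by a module, defined by a cocycle. -/
def extension (hmem : ∀ i j x m, x ∈ A.gr i → m ∈ H.gr j → act x m ∈ H.gr (i + j))
    (hact : ∀ i j x y, x ∈ A.gr i → y ∈ A.gr j → ∀ m,
      act x (act y m) = act (A.bracket x y) m + sgn k (i * j) • act y (act x m))
    (ωmem : ∀ i j x y, x ∈ A.gr i → y ∈ A.gr j → ω x y ∈ H.gr (i + j))
    (ωskew : ∀ i j x y, x ∈ A.gr i → y ∈ A.gr j → ω x y = -(sgn k (i * j) • ω y x))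
    (ωcocycle : ∀ i j l x y z, x ∈ A.gr i → y ∈ A.gr j → z ∈ A.gr l →
      act x (ω y z) + ω x (A.bracket y z) = -(sgn k ((i + j) * l) • act z (ω x y)) +
        ω (A.bracket x y) z + sgn k (i * j) • (act y (ω x z) + ω y (A.bracket x z))) :
    GradedLieAlgebra k (L × M) where
  toGrading := A.toGrading.prod H
  bracket := LinearMap.mk₂ k (fun a b => (A.bracket a.1 b.1,
      act a.1 b.2 - A.rightAct H act b.1 a.2 + ω a.1 b.1))
    (fun a b c => Prod.ext (by simp) (by simp; abel))
    (fun c a b => Prod.ext (by simp) (by simp [smul_sub]))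
    (fun a b c => Prod.ext (by simp) (by simp; abel))
    (fun c a b => Prod.ext (by simp) (by simp [smul_sub]))
  bracket_mem := by
    rintro i j ⟨x, m⟩ ⟨y, n⟩ ⟨hx, hm⟩ ⟨hy, hn⟩
    refine ⟨A.bracket_mem hx hy, Submodule.add_mem _ (Submodule.sub_mem _ (hmem _ _ _ _ hx hn) ?_)
      (ωmem _ _ _ _ hx hy)⟩
    change A.rightAct H act y m ∈ _
    rw [A.rightAct_apply H act hy hm, add_comm]
    exact Submodule.smul_mem _ _ (hmem _ _ _ _ hy hm)
  skew := by
    rintro i j ⟨x, m⟩ ⟨y, n⟩ ⟨hx, hm⟩ ⟨hy, hn⟩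
    refine Prod.ext (A.skew hx hy) ?_
    change act x n - A.rightAct H act y m + ω x y =
      -(sgn k (i * j) • (act y m - A.rightAct H act x n + ω y x))
    rw [A.rightAct_apply H act hy hm, A.rightAct_apply H act hx hn, ωskew _ _ _ _ hx hy,
      mul_comm j i]
    rcases sgn_cases (k := k) (i * j) with h | h <;> simp only [h] <;> module
  jacobi := by
    rintro i j ⟨x, m⟩ ⟨y, n⟩ ⟨hx, hm⟩ ⟨hy, hn⟩ z
    -- The structure is still under construction, so the motive spells out the bracket; unification
    -- with the goal fills in the placeholders.
    refine (A.toGrading.prod H).induction (P := fun z => LinearMap.mk₂ k _ _ _ _ _ _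
      (LinearMap.mk₂ k _ _ _ _ _ _ z) = LinearMap.mk₂ k _ _ _ _ _ (LinearMap.mk₂ k _ _ _ _ _ _ _)
        z + sgn k (i * j) • LinearMap.mk₂ k _ _ _ _ _ _ (LinearMap.mk₂ k _ _ _ _ _ _ z)) ?_ ?_ z
    · rintro l ⟨z, p⟩ ⟨hz, hp⟩
      replace hx : x ∈ A.gr i := hx
      replace hy : y ∈ A.gr j := hy
      replace hz : z ∈ A.gr l := hz
      replace hm : m ∈ H.gr i := hm
      replace hn : n ∈ H.gr j := hn
      refine Prod.ext (A.jacobi hx hy z) ?_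
      change act x (act y p - A.rightAct H act z n + ω y z) -
          A.rightAct H act (A.bracket y z) m + ω x (A.bracket y z) =
        (act (A.bracket x y) p - A.rightAct H act z (act x n - A.rightAct H act y m + ω x y) +
          ω (A.bracket x y) z) + sgn k (i * j) • (act y (act x p - A.rightAct H act z m + ω x z) -
          A.rightAct H act (A.bracket x z) n + ω y (A.bracket x z))
      -- In the module component, the terms without `ω` cancel by the three instances of `hact`
      -- below, and the remaining terms form the cocycle identity.
      have h := ωcocycle _ _ _ _ _ _ hx hy hz
      rw [← eq_sub_iff_add_eq'] at h
      rw [A.rightAct_apply H act hz hn, A.rightAct_apply H act (A.bracket_mem hy hz) hm,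
        A.rightAct_apply H act hy hm, A.rightAct_apply H act hz hm,
        A.rightAct_apply H act (A.bracket_mem hx hz) hn]
      rw [map_add (A.rightAct H act z), map_sub (A.rightAct H act z), map_smul,
        A.rightAct_apply H act hz (hmem _ _ _ _ hx hn),
        A.rightAct_apply H act hz (hmem _ _ _ _ hy hm),
        A.rightAct_apply H act hz (ωmem _ _ _ _ hx hy), ← sub_eq_zero]
      have e1 := hact _ _ _ _ hx hy p
      have e2 := hact _ _ _ _ hx hz n
      have e3 := hact _ _ _ _ hy hz m
      rw [← sub_eq_iff_eq_add] at e1 e2 e3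
      simp only [map_add, map_sub, map_smul]
      rw [← e1, ← e2, ← e3, h]
      simp only [mul_add, add_mul, sgn_add, mul_comm j i]
      rcases sgn_cases (k := k) (i * j) with h1 | h1 <;>
        rcases sgn_cases (k := k) (i * l) with h2 | h2 <;>
        rcases sgn_cases (k := k) (j * l) with h3 | h3 <;> simp only [h1, h2, h3] <;> module
    · intro a b ha hb
      simp only [map_add, smul_add] at ha hb ⊢
      rw [ha, hb]
      abel

end Extension

end GradedLieAlgebra

end DGL

end

noncomputable section

namespace DGL

/-! ### Free graded Lie algebras -/

namespace GradedLieAlgebra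

variable {k : Type u} [Field k] {L : Type v} [AddCommGroup L] [Module k L]
  {A : GradedLieAlgebra k L}

theorem IsHom.comp {M : Type*} [AddCommGroup M] [Module k M] {N : Type*} [AddCommGroup N]
    [Module k N] {B : GradedLieAlgebra k M} {C : GradedLieAlgebra k N} {g : M →ₗ[k] N}
    {f : L →ₗ[k] M} (hg : B.IsHom C g) (hf : A.IsHom B f) : A.IsHom C (g ∘ₗ f) :=
  ⟨fun h => hg.map_mem (hf.map_mem h), fun x y => by
    simp only [LinearMap.comp_apply, hf.map_bracket, hg.map_bracket]⟩

theorem isHom_transport {M : Type*} [AddCommGroup M] [Module k M] (e : L ≃ₗ[k] M) :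
    A.IsHom (A.transport e) e.toLinearMap :=
  ⟨fun {i x} h => by
    change e.symm (e x) ∈ A.gr i
    rwa [e.symm_apply_apply], fun x y => by simp [transport]⟩

theorem isHom_transport_symm {M : Type*} [AddCommGroup M] [Module k M] (e : L ≃ₗ[k] M) :
    (A.transport e).IsHom A e.symm.toLinearMap :=
  ⟨fun h => h, fun x y => by simp [transport]⟩

theorem isHom_subtype (T : Submodule k L) (hT : ∀ n, ∀ x ∈ T, A.proj n x ∈ T)
    (hb : ∀ x ∈ T, ∀ y ∈ T, A.bracket x y ∈ T) : (A.restrict T hT hb).IsHom A T.subtype :=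
  ⟨fun h => h, fun _ _ => rfl⟩

namespace IsFreeOn

variable {X : Type v} {deg : X → ℤ} {gen : X → L}

/-- The sum of the `S i` is a graded subalgebra. The universal property maps `L` into it, and the
composite with the inclusion agrees with the identity on generators, hence everywhere. -/
theorem le_of_closed (h : A.IsFreeOn deg gen) (S : ℤ → Submodule k L) (hS : ∀ i, S i ≤ A.gr i)
    (hgen : ∀ x, gen x ∈ S (deg x))
    (hb : ∀ i j x y, x ∈ S i → y ∈ S j → A.bracket x y ∈ S (i + j)) (i : ℤ) : A.gr i ≤ S i := by
  have hproj : ∀ n, ∀ x ∈ ⨆ i, S i, A.proj n x ∈ S n := by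
    intro n x hx
    refine Submodule.iSup_induction S (motive := fun x => A.proj n x ∈ S n) hx ?_ ?_ ?_
    · intro i x hx
      by_cases hi : i = n
      · subst hi
        rwa [A.proj_same (hS i hx)]
      · rw [A.proj_ne hi (hS i hx)]
        exact Submodule.zero_mem _
    · rw [map_zero]; exact Submodule.zero_mem _
    · intro x y hx hy
      rw [map_add]; exact Submodule.add_mem _ hx hy
  have hb' : ∀ x ∈ ⨆ i, S i, ∀ y ∈ ⨆ i, S i, A.bracket x y ∈ ⨆ i, S i := by
    intro x hx y hy
    refine Submodule.iSup_induction S (motive := fun x => A.bracket x y ∈ ⨆ i, S i) hx ?_ ?_ ?_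
    · intro i x hx
      refine Submodule.iSup_induction S (motive := fun y => A.bracket x y ∈ ⨆ i, S i) hy ?_ ?_ ?_
      · intro j y hy
        exact Submodule.mem_iSup_of_mem (i + j) (hb i j x y hx hy)
      · rw [map_zero]; exact Submodule.zero_mem _
      · intro y z hy hz
        rw [map_add]; exact Submodule.add_mem _ hy hz
    · rw [map_zero]; exact Submodule.zero_mem _
    · intro x z hx hz
      rw [map_add]; exact Submodule.add_mem _ hx hz
  let B := A.restrict (⨆ i, S i) (fun n x hx => Submodule.mem_iSup_of_mem n (hproj n x hx)) hb'
  -- The universal property in `IsFreeOn` only tests Lie algebras in the universe `max u v`, so both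
  -- targets are lifted there.
  let e : ↥(⨆ i, S i) ≃ₗ[k] ULift.{u} ↥(⨆ i, S i) := ULift.moduleEquiv.symm
  let e' : L ≃ₗ[k] ULift.{u} L := ULift.moduleEquiv.symm
  have hB : B.IsHom A (⨆ i, S i).subtype := isHom_subtype _ _ _
  obtain ⟨f, ⟨hf, hfg⟩, -⟩ := h.2 _ (B.transport e)
    (fun x => e ⟨gen x, Submodule.mem_iSup_of_mem _ (hgen x)⟩)
    (fun x => (isHom_transport e).map_mem (h.1 x))
  have hu := (h.2 _ (A.transport e') (fun x => e' (gen x))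
    (fun x => (isHom_transport e').map_mem (h.1 x))).unique (y₁ := e'.toLinearMap)
    (y₂ := e'.toLinearMap ∘ₗ (⨆ i, S i).subtype ∘ₗ e.symm.toLinearMap ∘ₗ f)
    ⟨isHom_transport e', fun x => rfl⟩
    ⟨(isHom_transport e').comp (hB.comp ((isHom_transport_symm e).comp hf)), fun x => by
      simp [hfg]⟩
  intro x hx
  have hx' : x = (e.symm (f x) : ↥(⨆ i, S i)) := e'.injective (LinearMap.congr_fun hu x)
  have h1 := hproj i x (by rw [hx']; exact (e.symm (f x)).2)
  rwa [A.proj_same hx] at h1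

/-- Induction over a free graded Lie algebra. -/
theorem induction (h : A.IsFreeOn deg gen) {P : ℤ → L → Prop} (zero : ∀ i, P i 0)
    (add : ∀ i x y, P i x → P i y → P i (x + y)) (smul : ∀ i (c : k) x, P i x → P i (c • x))
    (gen_mem : ∀ x, P (deg x) (gen x))
    (bracket : ∀ i j x y, x ∈ A.gr i → y ∈ A.gr j → P i x → P j y → P (i + j) (A.bracket x y))
    {i : ℤ} {x : L} (hx : x ∈ A.gr i) : P i x := by
  let S : ℤ → Submodule k L := fun i =>
    { carrier := {x | x ∈ A.gr i ∧ P i x}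
      add_mem' := fun hx hy => ⟨Submodule.add_mem _ hx.1 hy.1, add i _ _ hx.2 hy.2⟩
      zero_mem' := ⟨Submodule.zero_mem _, zero i⟩
      smul_mem' := fun c x hx => ⟨Submodule.smul_mem _ c hx.1, smul i c x hx.2⟩ }
  exact (h.le_of_closed S (fun i x hx => hx.1) (fun x => ⟨h.1 x, gen_mem x⟩)
    (fun i j x y hx hy => ⟨A.bracket_mem hx.1 hy.1, bracket i j x y hx.1 hy.1 hx.2 hy.2⟩) i hx).2

/-- A free graded Lie algebra has derivations with values in a module, twisted by a cocycle, with
arbitrary values on the generators. -/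
theorem exists_cocycle_lift (h : A.IsFreeOn deg gen) {M : Type (max u v)} [AddCommGroup M]
    [Module k M] (H : Grading k M) (act : L →ₗ[k] Module.End k M) (ω : L →ₗ[k] L →ₗ[k] M)
    (hmem : ∀ i j x m, x ∈ A.gr i → m ∈ H.gr j → act x m ∈ H.gr (i + j))
    (hact : ∀ i j x y, x ∈ A.gr i → y ∈ A.gr j → ∀ m,
      act x (act y m) = act (A.bracket x y) m + sgn k (i * j) • act y (act x m))
    (ωmem : ∀ i j x y, x ∈ A.gr i → y ∈ A.gr j → ω x y ∈ H.gr (i + j))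
    (ωskew : ∀ i j x y, x ∈ A.gr i → y ∈ A.gr j → ω x y = -(sgn k (i * j) • ω y x))
    (ωcocycle : ∀ i j l x y z, x ∈ A.gr i → y ∈ A.gr j → z ∈ A.gr l →
      act x (ω y z) + ω x (A.bracket y z) = -(sgn k ((i + j) * l) • act z (ω x y)) +
        ω (A.bracket x y) z + sgn k (i * j) • (act y (ω x z) + ω y (A.bracket x z)))
    (m : X → M) (hm : ∀ x, m x ∈ H.gr (deg x)) :
    ∃ Q : L →ₗ[k] M, (∀ i, ∀ x ∈ A.gr i, Q x ∈ H.gr i) ∧ (∀ x, Q (gen x) = m x) ∧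
      ∀ i j x y, x ∈ A.gr i → y ∈ A.gr j →
        Q (A.bracket x y) = act x (Q y) - sgn k (i * j) • act y (Q x) + ω x y := by
  -- A twisted derivation is the second component of a section of the extension, and sections are
  -- determined by their values on generators.
  obtain ⟨f, ⟨hf, hfg⟩, -⟩ := h.2 _ (A.extension H act ω hmem hact ωmem ωskew ωcocycle)
    (fun x => (gen x, m x)) (fun x => ⟨h.1 x, hm x⟩)
  have hfst : ∀ i, ∀ x ∈ A.gr i, (f x).1 = x := fun i x hx => by
    refine h.induction (P := fun _ x => (f x).1 = x) ?_ ?_ ?_ ?_ ?_ hx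
    · simp
    · intro i x y hx hy; rw [map_add, Prod.fst_add, hx, hy]
    · intro i c x hx; rw [map_smul, Prod.smul_fst, hx]
    · intro x; rw [hfg]
    · intro i j x y _ _ hx hy
      rw [hf.map_bracket]
      change A.bracket (f x).1 (f y).1 = _
      rw [hx, hy]
  refine ⟨LinearMap.snd k L M ∘ₗ f, fun i x hx => (hf.map_mem hx).2, fun x => by simp [hfg], ?_⟩
  intro i j x y hx hy
  have h1 : (f (A.bracket x y)).2 =
      act (f x).1 (f y).2 - A.rightAct H act (f y).1 (f x).2 + ω (f x).1 (f y).1 := by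
    rw [hf.map_bracket]
    rfl
  rw [hfst i x hx, hfst j y hy, A.rightAct_apply H act hy (hf.map_mem hx).2] at h1
  exact h1

/-- A free graded Lie algebra has derivations with arbitrary values on the generators. -/
theorem exists_der (h : A.IsFreeOn deg gen) (n : ℤ) (m : X → L) (hm : ∀ x, m x ∈ A.gr (n + deg x)) :
    ∃ θ ∈ A.der n, ∀ x, θ (gen x) = m x := by
  let e : L ≃ₗ[k] ULift.{u} L := ULift.moduleEquiv.symm
  -- A derivation of degree `n` is a degree zero derivation into the translate of `L` by `n`, where
  -- `x` acts by `(-1)^(n|x|) [x, -]`.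
  obtain ⟨Q, hQ, hQg, hQb⟩ := h.exists_cocycle_lift ((A.toGrading.translate n).transport e)
    (e.conj.toLinearMap ∘ₗ A.bracket ∘ₗ A.sign n) 0
    (fun i j x m hx hm => by
      change e.symm (e (A.bracket (A.sign n x) (e.symm m))) ∈ A.gr (n + (i + j))
      have hm' : e.symm m ∈ A.gr (n + j) := hm
      rw [e.symm_apply_apply, add_left_comm]
      exact A.bracket_mem (A.sign_mem n hx) hm')
    (fun i j x y hx hy m => by
      simp only [LinearMap.comp_apply, A.sign_apply n hx, A.sign_apply n hy,
        A.sign_apply n (A.bracket_mem hx hy), map_smul, LinearMap.smul_apply]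
      simp [LinearEquiv.conj_apply, A.jacobi hx hy, mul_add, sgn_add, smul_smul]
      congr 2 <;> ring)
    (by simp) (by simp) (by simp) (fun x => e (m x))
    (fun x => by
      change e.symm (e (m x)) ∈ A.gr (n + deg x)
      rw [e.symm_apply_apply]
      exact hm x)
  refine ⟨e.symm.toLinearMap ∘ₗ Q, ⟨fun i x hx => hQ i x hx, fun i x hx y => ?_⟩,
    fun x => by simp [hQg]⟩
  refine A.induction (P := fun y => (e.symm.toLinearMap ∘ₗ Q) (A.bracket x y) =
    A.bracket ((e.symm.toLinearMap ∘ₗ Q) x) y +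
      sgn k (n * i) • A.bracket x ((e.symm.toLinearMap ∘ₗ Q) y)) ?_ ?_ y
  · intro j y hy
    have hx' : e.symm (Q x) ∈ A.gr (n + i) := hQ i x hx
    have hs : A.bracket (e.symm (Q x)) y = _ := A.skew hx' hy
    simp only [LinearMap.comp_apply, LinearEquiv.coe_coe]
    rw [hQb i j x y hx hy, hs]
    simp [LinearEquiv.conj_apply, A.sign_apply n hx, A.sign_apply n hy, add_mul, sgn_add, smul_smul,
      mul_comm (sgn k (i * j))]
    abel
  · intro y z hy hz
    simp only [map_add, hy, hz, smul_add]
    abel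

end IsFreeOn

end GradedLieAlgebra

end DGL

end

noncomputable section

namespace DGL

/-! ### The Euler derivation of a free graded Lie algebra -/

theorem GradedLieAlgebra.der_zero_bracket {k : Type u} [Field k] {L : Type v} [AddCommGroup L]
    [Module k L] (A : GradedLieAlgebra k L) {E : Module.End k L} (hE : E ∈ A.der 0) (x y : L) :
    E (A.bracket x y) = A.bracket (E x) y + A.bracket x (E y) :=
  A.induction (P := fun x => E (A.bracket x y) = A.bracket (E x) y + A.bracket x (E y))
    (fun i x hx => by rw [hE.2 i x hx, zero_mul, sgn_zero, one_smul])
    (fun x z hx hz => by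
      simp only [map_add, LinearMap.add_apply, hx, hz]
      abel) x

namespace GradedLieAlgebra.IsFreeOn

variable {k : Type u} [Field k] {L : Type v} [AddCommGroup L] [Module k L]
  {A : GradedLieAlgebra k L} {X : Type v} {deg : X → ℤ} {gen : X → L}

/-- Eigenvalues of a derivation add under the bracket, and generators have eigenvalue one. Indexing
by `n + 1` with `n` natural records positivity. -/
theorem mem_iSup_eigenspace (h : A.IsFreeOn deg gen) {E : Module.End k L} (hE : E ∈ A.der 0)
    (hgen : ∀ x, E (gen x) = gen x) (x : L) : x ∈ ⨆ n : ℕ, E.eigenspace ((n + 1 : ℕ) : k) := by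
  refine A.induction (P := fun x => x ∈ ⨆ n : ℕ, E.eigenspace ((n + 1 : ℕ) : k)) ?_
    (fun x y hx hy => Submodule.add_mem _ hx hy) x
  intro i x hx
  refine h.induction (P := fun _ x => x ∈ ⨆ n : ℕ, E.eigenspace ((n + 1 : ℕ) : k)) ?_ ?_ ?_ ?_ ?_ hx
  · exact fun _ => Submodule.zero_mem _
  · exact fun _ x y hx hy => Submodule.add_mem _ hx hy
  · exact fun _ c x hx => Submodule.smul_mem _ c hx
  · exact fun x => Submodule.mem_iSup_of_mem (p := fun n : ℕ => E.eigenspace ((n + 1 : ℕ) : k)) 0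
      (Module.End.mem_eigenspace_iff.2 (by simp [hgen]))
  · intro i j x y _ _ hx hy
    refine Submodule.iSup_induction (fun n : ℕ => E.eigenspace ((n + 1 : ℕ) : k))
      (motive := fun x => A.bracket x y ∈ ⨆ n : ℕ, E.eigenspace ((n + 1 : ℕ) : k)) hx ?_
        (by simp) ?_
    · intro n x hx
      refine Submodule.iSup_induction (fun n : ℕ => E.eigenspace ((n + 1 : ℕ) : k))
        (motive := fun y => A.bracket x y ∈ ⨆ n : ℕ, E.eigenspace ((n + 1 : ℕ) : k)) hy ?_
          (by simp) ?_
      · intro m y hy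
        refine Submodule.mem_iSup_of_mem (p := fun n : ℕ => E.eigenspace ((n + 1 : ℕ) : k))
          (n + m + 1) (Module.End.mem_eigenspace_iff.2 ?_)
        rw [A.der_zero_bracket hE, Module.End.mem_eigenspace_iff.1 hx,
          Module.End.mem_eigenspace_iff.1 hy]
        simp only [map_smul, LinearMap.smul_apply, ← add_smul]
        congr 1
        push_cast
        ring
      · intro y z hy hz
        rw [map_add]
        exact Submodule.add_mem _ hy hz
    · intro x z hx hz
      rw [map_add]
      exact Submodule.add_mem _ hx hz

/-- The derivation that is the identity on the generators, with its eigenspace decomposition, and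
the projection onto the span of the generators. -/
theorem exists_euler [CharZero k] (h : A.IsFreeOn deg gen) : ∃ E ∈ A.der 0,
    (∀ x, E (gen x) = gen x) ∧
    ∃ hT : ∀ x, x ∈ ⨆ n : ℤ, E.eigenspace (n : k),
    (∀ n : ℤ, n ≤ 0 → ∀ x, E x = (n : k) • x → x = 0) ∧
    (∀ x, (Grading.ofEigen E hT).proj 1 (gen x) = gen x) ∧
    ∀ x y, (Grading.ofEigen E hT).proj 1 (A.bracket x y) = 0 := by
  obtain ⟨E, hE, hgen⟩ := h.exists_der 0 gen (fun x => by rw [zero_add]; exact h.1 x)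
  have h1 := h.mem_iSup_eigenspace hE hgen
  have hT : ∀ x, x ∈ ⨆ n : ℤ, E.eigenspace (n : k) := fun x => by
    have h2 : (⨆ n : ℕ, E.eigenspace ((n + 1 : ℕ) : k)) ≤ ⨆ n : ℤ, E.eigenspace (n : k) :=
      iSup_le fun n => by
        have h3 := le_iSup (fun n : ℤ => E.eigenspace (n : k)) ((n + 1 : ℕ) : ℤ)
        rwa [Int.cast_natCast] at h3
    exact h2 (h1 x)
  -- Every element is a sum of eigenvectors with positive eigenvalues, so its components at `n ≤ 0`
  -- vanish.
  have hpos : ∀ n : ℤ, n ≤ 0 → ∀ x, E x = (n : k) • x → x = 0 := by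
    intro n hn x hx
    have h2 : (Grading.ofEigen E hT).proj n x = 0 := by
      refine Submodule.iSup_induction (fun n : ℕ => E.eigenspace ((n + 1 : ℕ) : k))
        (motive := fun x => (Grading.ofEigen E hT).proj n x = 0) (h1 x) ?_ (map_zero _) ?_
      · intro m y hy
        refine Grading.proj_ne _ (m := ((m + 1 : ℕ) : ℤ)) (by omega) ?_
        rw [Grading.mem_ofEigen, Int.cast_natCast]
        exact Module.End.mem_eigenspace_iff.1 hy
      · intro y z hy hz
        rw [map_add, hy, hz, add_zero]
    rwa [Grading.proj_same _ ((Grading.mem_ofEigen E hT).2 hx)] at h2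
  refine ⟨E, hE, hgen, hT, hpos, fun x => Grading.proj_same _ ?_, fun x y => ?_⟩
  · rw [Grading.mem_ofEigen, hgen, Int.cast_one, one_smul]
  -- The bracket of two eigenvectors of positive eigenvalue has eigenvalue at least two.
  · refine (Grading.ofEigen E hT).induction
      (P := fun x => (Grading.ofEigen E hT).proj 1 (A.bracket x y) = 0) ?_ ?_ x
    · intro n x hx
      refine (Grading.ofEigen E hT).induction
        (P := fun y => (Grading.ofEigen E hT).proj 1 (A.bracket x y) = 0) ?_ ?_ y
      · intro m y hy
        rw [Grading.mem_ofEigen] at hx hy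
        rcases le_or_gt n 0 with hn | hn
        · rw [hpos n hn x hx]
          simp
        rcases le_or_gt m 0 with hm | hm
        · rw [hpos m hm y hy]
          simp
        refine Grading.proj_ne _ (m := n + m) (by omega) ?_
        rw [Grading.mem_ofEigen, A.der_zero_bracket hE, hx, hy, Int.cast_add]
        simp only [map_smul, LinearMap.smul_apply, ← add_smul]
      · intro y z hy hz
        rw [map_add, map_add, hy, hz, add_zero]
    · intro x z hx hz
      rw [map_add, LinearMap.add_apply, map_add, hx, hz, add_zero]

end GradedLieAlgebra.IsFreeOn

end DGL

end

noncomputable section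

namespace DGL

/-! ### A contraction of the Chevalley–Eilenberg complex of a free graded Lie algebra -/

namespace DGLieAlgebra

open GSym

variable {k : Type u} [Field k] {L : Type v} [AddCommGroup L] [Module k L] (π : DGLieAlgebra k L)

theorem ceDiff_ι_mul_of_d_eq_zero (hd : ∀ x, π.d x = 0) {i : ℤ} {x : L} (hx : x ∈ π.shift.gr i)
    (a : π.CESpace) : π.ceDiff (ι π.shift x * a) =
      π.ceAd x a + sgn k i • (ι π.shift x * π.ceDiff a) := by
  rw [π.ceDiff_ι_mul hx, hd, map_zero, zero_mul, neg_zero, zero_add]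

theorem ceAd_mul {j m : ℤ} {y : L} (hy : y ∈ π.shift.gr j) {a : π.CESpace}
    (ha : a ∈ GSym.deg π.shift m) (b : π.CESpace) :
    π.ceAd y (a * b) = π.ceAd y a * b + sgn k ((j - 1) * m) • (a * π.ceAd y b) := by
  rw [π.ceAd_eq hy]
  exact derExt_mul _ ha b

theorem ceAd_ι {i : ℤ} {x : L} (hx : x ∈ π.gr i) (y : L) :
    π.ceAd x (ι π.shift y) = sgn k i • ι π.shift (π.bracket x y) := by
  rw [π.ceAd_eq (mem_shift hx), derExt_ι]
  change ι π.shift (sgn k (i + 1 - 1) • π.bracket x y) = _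
  rw [add_sub_cancel_right, map_smul]

theorem counit_ceAd (x : L) (a : π.CESpace) : counit π.shift (π.ceAd x a) = 0 :=
  π.shift.induction (P := fun x => counit π.shift (π.ceAd x a) = 0)
    (fun i x hx => by rw [π.ceAd_eq hx, counit_derExt])
    (fun x y hx hy => by rw [map_add, LinearMap.add_apply, map_add, hx, hy, add_zero]) x

theorem coproj_ceAd {i : ℤ} {x : L} (hx : x ∈ π.gr i) (a : π.CESpace) :
    coproj π.shift (π.ceAd x a) = sgn k i • π.bracket x (coproj π.shift a) := by
  rw [π.ceAd_eq (mem_shift hx), coproj_derExt]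
  change sgn k (i + 1 - 1) • π.bracket x _ = _
  rw [add_sub_cancel_right]

/-- Replacing a letter `y` by `[x, y]` raises the weight by exactly `|x|`. -/
theorem ceAd_mem_weightFil (hπ : ∀ i : ℤ, i ≤ 0 → π.gr i = ⊥) {i p : ℤ} {x : L} (hx : x ∈ π.gr i)
    {a : π.CESpace} (ha : a ∈ weightFil π.toGrading p) :
    π.ceAd x a ∈ weightFil π.toGrading (i + p) := by
  refine weightFil_induction (P := fun p a => π.ceAd x a ∈ weightFil π.toGrading (i + p))
    ?_ ?_ ?_ ?_ ?_ ha
  · intro p; rw [map_zero]; exact Submodule.zero_mem _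
  · intro p _; rw [ceAd_one]; exact Submodule.zero_mem _
  · intro p c a h; rw [map_smul]; exact Submodule.smul_mem _ c h
  · intro p a b ha hb; rw [map_add]; exact Submodule.add_mem _ ha hb
  · intro j hj y hy p a ha h
    rw [π.ceAd_ι_mul (mem_shift hx) (mem_shift hy)]
    refine Submodule.add_mem _ (Submodule.smul_mem _ _ ?_) (Submodule.smul_mem _ _ ?_)
    · rw [← add_assoc]
      exact ι_mul_mem_weightFil hπ (π.bracket_mem hx hy) ha
    · rw [add_left_comm]
      exact ι_mul_mem_weightFil' hj hy h

theorem derExt_zero_mem_weightFil {E : π.shift.homDeg 0} {p : ℤ}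
    {a : π.CESpace} (ha : a ∈ weightFil π.toGrading p) :
    derExt π.shift E a ∈ weightFil π.toGrading p := by
  refine weightFil_induction (P := fun p a => derExt π.shift E a ∈ weightFil π.toGrading p)
    ?_ ?_ ?_ ?_ ?_ ha
  · intro p; rw [map_zero]; exact Submodule.zero_mem _
  · intro p _; rw [derExt_one]; exact Submodule.zero_mem _
  · intro p c a h; rw [map_smul]; exact Submodule.smul_mem _ c h
  · intro p a b ha hb; rw [map_add]; exact Submodule.add_mem _ ha hb
  · intro j hj y hy p a ha h
    rw [derExt_zero_ι_mul]
    refine Submodule.add_mem _ (ι_mul_mem_weightFil' hj ?_ ha) (ι_mul_mem_weightFil' hj hy h)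
    have h1 : (E : Module.End k L) y ∈ π.gr (0 + (j + 1) - 1) := E.2 _ _ (mem_shift hy)
    rwa [zero_add, add_sub_cancel_right] at h1

section Contraction

/-- The cocycle `(x, y) ↦ 2 (-1) ^ |x| s(E x) s(E y)`. -/
def eulerCocycle (E : Module.End k L) : L →ₗ[k] L →ₗ[k] π.CESpace :=
  (2 : k) • (LinearMap.mul k π.CESpace).compl₁₂ (ι π.shift ∘ₗ E ∘ₗ π.sign 1) (ι π.shift ∘ₗ E)

theorem eulerCocycle_apply (E : Module.End k L) {i : ℤ} {x : L} (hx : x ∈ π.gr i) (y : L) :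
    π.eulerCocycle E x y = (2 * sgn k i) • (ι π.shift (E x) * ι π.shift (E y)) := by
  simp [eulerCocycle, π.sign_apply 1 hx, smul_smul]

theorem der_zero_mem {E : Module.End k L} (hE : E ∈ π.der 0) {i : ℤ} {x : L} (hx : x ∈ π.gr i) :
    E x ∈ π.gr i := by
  have h := hE.1 i x hx
  rwa [zero_add] at h

theorem eulerCocycle_mem {E : Module.End k L} (hE : E ∈ π.der 0) {i j : ℤ} {x y : L}
    (hx : x ∈ π.gr i) (hy : y ∈ π.gr j) :
    π.eulerCocycle E x y ∈ GSym.deg π.shift (2 + (i + j)) := by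
  rw [π.eulerCocycle_apply E hx]
  refine Submodule.smul_mem _ _ ?_
  have h := mul_mem_deg (ι_mem (mem_shift (π.der_zero_mem hE hx)))
    (ι_mem (mem_shift (π.der_zero_mem hE hy)))
  rwa [show i + 1 + (j + 1) = 2 + (i + j) by ring] at h

/-- The graded commutativity of suspended letters, of degrees `i + 1` and `j + 1`, combines with the
sign `(-1)^|x|` to give graded skew symmetry in the degrees of `π`. -/
theorem eulerCocycle_skew {E : Module.End k L} (hE : E ∈ π.der 0) {i j : ℤ} {x y : L}
    (hx : x ∈ π.gr i) (hy : y ∈ π.gr j) :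
    π.eulerCocycle E x y = -(sgn k (i * j) • π.eulerCocycle E y x) := by
  rw [π.eulerCocycle_apply E hx, π.eulerCocycle_apply E hy,
    ι_comm π.shift (mem_shift (π.der_zero_mem hE hx)) (mem_shift (π.der_zero_mem hE hy))]
  simp only [add_mul, mul_add, one_mul, mul_one, sgn_add, sgn_one, smul_smul]
  rcases sgn_cases (k := k) (i * j) with h1 | h1 <;>
    rcases sgn_cases (k := k) i with h2 | h2 <;>
    rcases sgn_cases (k := k) j with h3 | h3 <;> simp only [h1, h2, h3] <;> module

theorem ceAd_eulerCocycle {E : Module.End k L} (hE : E ∈ π.der 0) {i j : ℤ} {x y z : L}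
    (hx : x ∈ π.gr i) (hy : y ∈ π.gr j) :
    π.ceAd x (π.eulerCocycle E y z) = (2 * (sgn k i * sgn k j)) •
      (ι π.shift (π.bracket x (E y)) * ι π.shift (E z)) +
      (2 * (sgn k (i * j) * sgn k j)) • (ι π.shift (E y) * ι π.shift (π.bracket x (E z))) := by
  rw [π.eulerCocycle_apply E hy, map_smul,
    π.ceAd_mul (mem_shift hx) (ι_mem (mem_shift (π.der_zero_mem hE hy))), π.ceAd_ι hx, π.ceAd_ι hx]
  simp only [smul_add, smul_smul, smul_mul_assoc, mul_smul_comm, add_sub_cancel_right, mul_add,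
    mul_one, sgn_add]
  rcases sgn_cases (k := k) (i * j) with h1 | h1 <;>
    rcases sgn_cases (k := k) i with h2 | h2 <;> simp only [h1, h2] <;> module

set_option maxHeartbeats 1600000 in
-- Expanding `E` of each bracket by the Leibniz rule turns every term into a product of one
-- suspended bracket and one suspended letter. The twelve terms cancel in pairs by skew symmetry and
-- graded commutativity; the Jacobi identity is not needed.
theorem eulerCocycle_cocycle {E : Module.End k L} (hE : E ∈ π.der 0) {i j l : ℤ} {x y z : L}
    (hx : x ∈ π.gr i) (hy : y ∈ π.gr j) (hz : z ∈ π.gr l) :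
    π.ceAd x (π.eulerCocycle E y z) + π.eulerCocycle E x (π.bracket y z) =
      -(sgn k ((i + j) * l) • π.ceAd z (π.eulerCocycle E x y)) +
        π.eulerCocycle E (π.bracket x y) z + sgn k (i * j) •
          (π.ceAd y (π.eulerCocycle E x z) + π.eulerCocycle E y (π.bracket x z)) := by
  have hEx := π.der_zero_mem hE hx
  have hEy := π.der_zero_mem hE hy
  have hEz := π.der_zero_mem hE hz
  have e1 : π.bracket z (E x) = _ := π.skew hz hEx
  have e2 : π.bracket z (E y) = _ := π.skew hz hEy
  have e3 : π.bracket y (E x) = _ := π.skew hy hEx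
  rw [π.ceAd_eulerCocycle hE hx hy, π.ceAd_eulerCocycle hE hz hx, π.ceAd_eulerCocycle hE hy hx,
    π.eulerCocycle_apply E hx, π.eulerCocycle_apply E hy,
    π.eulerCocycle_apply E (π.bracket_mem hx hy), π.der_zero_bracket hE, π.der_zero_bracket hE,
    π.der_zero_bracket hE, e1, e2, e3]
  simp only [map_add, map_neg, map_smul, mul_add, add_mul, neg_mul, mul_neg, smul_mul_assoc,
    mul_smul_comm]
  rw [ι_comm π.shift (mem_shift hEy) (mem_shift (π.bracket_mem hEx hz)),
    ι_comm π.shift (mem_shift hEy) (mem_shift (π.bracket_mem hx hEz))]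
  simp only [smul_add, smul_neg, smul_smul, mul_add, add_mul, one_mul, mul_one, sgn_add, sgn_one,
    mul_comm j i, mul_comm l i, mul_comm l j]
  rcases sgn_cases (k := k) (i * j) with h1 | h1 <;>
    rcases sgn_cases (k := k) (i * l) with h2 | h2 <;>
    rcases sgn_cases (k := k) (j * l) with h3 | h3 <;>
    rcases sgn_cases (k := k) i with h4 | h4 <;>
    rcases sgn_cases (k := k) j with h5 | h5 <;>
    rcases sgn_cases (k := k) l with h6 | h6 <;>
    simp only [h1, h2, h3, h4, h5, h6] <;> module

end Contraction

end DGLieAlgebra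

end DGL

end

/-! ### The twisted derivation `Q` and the homotopy it defines -/

noncomputable section

namespace DGL

namespace DGLieAlgebra

open GSym

variable {k : Type u} [Field k] {L : Type v} [AddCommGroup L] [Module k L] (π : DGLieAlgebra k L)

/-- The same identity as `ceAd_bracket` in the degrees of `π`: it makes `S(sπ)` a `π`-module, the
target of `Q`. -/
theorem ceAd_bracket' {i j : ℤ} {x y : L} (hx : x ∈ π.gr i) (hy : y ∈ π.gr j) (a : π.CESpace) :
    π.ceAd x (π.ceAd y a) = π.ceAd (π.bracket x y) a +
      sgn k (i * j) • π.ceAd y (π.ceAd x a) := by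
  have h := π.ceAd_bracket (mem_shift hx) (mem_shift hy) a
  rwa [add_sub_cancel_right, add_sub_cancel_right] at h

theorem ceAd_mem_deg {i m : ℤ} {x : L} (hx : x ∈ π.gr i) {a : π.CESpace}
    (ha : a ∈ GSym.deg π.shift m) : π.ceAd x a ∈ GSym.deg π.shift (i + m) := by
  have h := π.ceAd_mem (mem_shift hx) m a ha
  rwa [add_sub_cancel_right] at h

variable {X : Type v} {deg : X → ℤ} {gen : X → L}

/-- The map `Q` such that multiplication by `Q x` defines a contraction of the Chevalley–Eilenberg
complex of a free graded Lie algebra. -/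
theorem exists_eulerLift (hd : ∀ x, π.d x = 0) (hπ : ∀ i : ℤ, i ≤ 0 → π.gr i = ⊥)
    (hfree : π.IsFreeOn deg gen) {E : Module.End k L} (hE : E ∈ π.der 0)
    (hgen : ∀ x, E (gen x) = gen x) :
    ∃ Q : L →ₗ[k] π.CESpace,
      (∀ i, ∀ x ∈ π.gr i, Q x ∈ GSym.deg π.shift (2 + i)) ∧
      (∀ i j x y, x ∈ π.gr i → y ∈ π.gr j → Q (π.bracket x y) =
        π.ceAd x (Q y) - sgn k (i * j) • π.ceAd y (Q x) + π.eulerCocycle E x y) ∧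
      (∀ i, ∀ x ∈ π.gr i, Q x ∈ weightFil π.toGrading i) ∧
      (∀ x, counit π.shift (Q x) = 0) ∧ (∀ x, coproj π.shift (Q x) = 0) ∧
      ∀ x, π.ceDiff (Q x) = ι π.shift (E (E x) - E x) := by
  -- The translation by two accounts for the two suspensions in a word of length two. The value zero
  -- on generators is forced by the goal `d Q = s(E² - E)`, up to cycles, since `E² - E` vanishes
  -- there.
  obtain ⟨Q, hQ, hQg, hQb⟩ := hfree.exists_cocycle_lift ((grading π.shift).translate 2)
    π.ceAd (π.eulerCocycle E)
    (fun i j x m hx hm => by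
      have h := π.ceAd_mem_deg hx (m := 2 + j) hm
      rwa [add_left_comm] at h)
    (fun i j x y hx hy m => π.ceAd_bracket' hx hy m)
    (fun i j x y hx hy => π.eulerCocycle_mem hE hx hy)
    (fun i j x y hx hy => π.eulerCocycle_skew hE hx hy)
    (fun i j l x y z hx hy hz => π.eulerCocycle_cocycle hE hx hy hz)
    (fun _ => 0) (fun _ => Submodule.zero_mem _)
  refine ⟨Q, hQ, hQb, fun i x hx => ?_, fun x => ?_, fun x => ?_, fun x => ?_⟩
  · refine hfree.induction (P := fun i x => Q x ∈ weightFil π.toGrading i) ?_ ?_ ?_ ?_ ?_ hx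
    · intro i; rw [map_zero]; exact Submodule.zero_mem _
    · intro i x y hx hy; rw [map_add]; exact Submodule.add_mem _ hx hy
    · intro i c x hx; rw [map_smul]; exact Submodule.smul_mem _ _ hx
    · intro x; rw [hQg]; exact Submodule.zero_mem _
    · intro i j x y hx hy h1 h2
      rw [hQb i j x y hx hy, π.eulerCocycle_apply E hx]
      refine Submodule.add_mem _ (Submodule.sub_mem _ (π.ceAd_mem_weightFil hπ hx h2)
        (Submodule.smul_mem _ _ ?_)) (Submodule.smul_mem _ _ ?_)
      · rw [add_comm]
        exact π.ceAd_mem_weightFil hπ hy h1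
      · exact ι_mul_mem_weightFil hπ (π.der_zero_mem hE hx)
          (ι_mem_weightFil hπ (π.der_zero_mem hE hy))
  · refine π.induction (P := fun x => counit π.shift (Q x) = 0) (fun i x hx => ?_)
      (fun x y hx hy => by rw [map_add, map_add, hx, hy, add_zero]) x
    refine hfree.induction (P := fun _ x => counit π.shift (Q x) = 0) ?_ ?_ ?_ ?_ ?_ hx
    · simp
    · intro i x y hx hy; rw [map_add, map_add, hx, hy, add_zero]
    · intro i c x hx; rw [map_smul, map_smul, hx, smul_zero]
    · intro x; rw [hQg, map_zero]
    · intro i j x y hx hy _ _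
      rw [hQb i j x y hx hy, π.eulerCocycle_apply E hx]
      simp [counit_ceAd, counit_ι_mul]
  · refine π.induction (P := fun x => coproj π.shift (Q x) = 0) (fun i x hx => ?_)
      (fun x y hx hy => by rw [map_add, map_add, hx, hy, add_zero]) x
    refine hfree.induction (P := fun _ x => coproj π.shift (Q x) = 0) ?_ ?_ ?_ ?_ ?_ hx
    · simp
    · intro i x y hx hy; rw [map_add, map_add, hx, hy, add_zero]
    · intro i c x hx; rw [map_smul, map_smul, hx, smul_zero]
    · intro x; rw [hQg, map_zero]
    · intro i j x y hx hy h1 h2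
      have h3 : counit π.shift (ι π.shift (E y)) = 0 := by
        have h := counit_ι_mul π.shift (E y) 1
        rwa [mul_one] at h
      rw [hQb i j x y hx hy, π.eulerCocycle_apply E hx]
      simp [π.coproj_ceAd hx, π.coproj_ceAd hy, h1, h2, coproj_ι_mul, h3]
  -- The operator `E² - E` fails to be a derivation by `2 [E x, E y]`, and `s` of this is the
  -- differential of the cocycle. The rest of the induction over brackets is the equivariance of `d`
  -- under `ceAd`.
  · refine π.induction (P := fun x => π.ceDiff (Q x) = ι π.shift (E (E x) - E x)) (fun i x hx => ?_)
      (fun x y hx hy => by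
        simp only [map_add, hx, hy, map_sub]
        abel) x
    refine hfree.induction (P := fun _ x => π.ceDiff (Q x) = ι π.shift (E (E x) - E x))
      ?_ ?_ ?_ ?_ ?_ hx
    · simp
    · intro i x y hx hy
      simp only [map_add, hx, hy, map_sub]
      abel
    · intro i c x hx
      simp only [map_smul, hx, ← smul_sub]
    · intro x; rw [hQg]; simp [hgen]
    · intro i j x y hx hy h1 h2
      have e1 : π.bracket y (E (E x)) = _ := π.skew hy (π.der_zero_mem hE (π.der_zero_mem hE hx))
      have e2 : π.bracket y (E x) = _ := π.skew hy (π.der_zero_mem hE hx)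
      rw [hQb i j x y hx hy, π.eulerCocycle_apply E hx, map_add, map_sub, map_smul, map_smul,
        π.ceDiff_ceAd (mem_shift hx), π.ceDiff_ceAd (mem_shift hy), hd, hd, h1, h2,
        π.ceDiff_ι_mul_ι (π.der_zero_mem hE hx), hd, hd, add_sub_cancel_right,
        add_sub_cancel_right, π.ceAd_ι hx, π.ceAd_ι hy]
      simp only [π.der_zero_bracket hE, map_zero, LinearMap.zero_apply, map_add, map_sub, e1, e2,
        zero_mul, mul_zero, mul_comm j i, smul_sub, smul_smul, map_neg, map_smul]
      rcases sgn_cases (k := k) (i * j) with h1 | h1 <;>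
        rcases sgn_cases (k := k) i with h2 | h2 <;>
        rcases sgn_cases (k := k) j with h3 | h3 <;> simp only [h1, h2, h3] <;> module

section Homotopy

variable {Q : L →ₗ[k] π.CESpace}

/-- The map `sx ↦ Q x` has degree one, and graded commutativity is all that is needed to extend it
to a derivation of the algebra. -/
theorem eulerHomotopy_aux (hQ : ∀ i, ∀ x ∈ π.gr i, Q x ∈ GSym.deg π.shift (2 + i)) :
    ∀ i j x y, x ∈ π.shift.gr i → y ∈ π.shift.gr j →
      (LinearMap.mul k π.CESpace ∘ₗ Q) x * mulL π.shift y +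
          sgn k (1 * i) • (mulL π.shift x * (LinearMap.mul k π.CESpace ∘ₗ Q) y) =
        sgn k (i * j) • ((LinearMap.mul k π.CESpace ∘ₗ Q) y * mulL π.shift x +
          sgn k (1 * j) • (mulL π.shift y * (LinearMap.mul k π.CESpace ∘ₗ Q) x)) := by
  intro i j x y hx hy
  refine LinearMap.ext fun a => ?_
  have h1 : ι π.shift y * Q x = _ := ι_mul_comm hy (hQ (i - 1) x hx)
  have h2 : ι π.shift x * Q y = _ := ι_mul_comm hx (hQ (j - 1) y hy)
  simp only [LinearMap.add_apply, LinearMap.smul_apply, Module.End.mul_apply, mulL_apply,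
    LinearMap.comp_apply, LinearMap.mul_apply', ← mul_assoc, h1, h2, smul_mul_assoc, smul_smul,
    mul_add, mul_sub, sgn_add, sgn_sub, one_mul, mul_one, mul_comm j i, smul_add, mul_two]
  rcases sgn_cases (k := k) (i * j) with h1 | h1 <;>
    rcases sgn_cases (k := k) i with h2 | h2 <;>
    rcases sgn_cases (k := k) j with h3 | h3 <;> simp only [h1, h2, h3] <;> module

/-- The operator on `S(sπ)` with `sx a ↦ Q x a - (-1) ^ |x| sx (T a)`. -/
def eulerHomotopy (hQ : ∀ i, ∀ x ∈ π.gr i, Q x ∈ GSym.deg π.shift (2 + i)) :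
    Module.End k π.CESpace :=
  recOp π.shift 1 (LinearMap.mul k π.CESpace ∘ₗ Q) (π.eulerHomotopy_aux hQ)

variable (hQ : ∀ i, ∀ x ∈ π.gr i, Q x ∈ GSym.deg π.shift (2 + i))

theorem eulerHomotopy_one : π.eulerHomotopy hQ 1 = 0 := recOp_one _

theorem eulerHomotopy_ι_mul {i : ℤ} {x : L} (hx : x ∈ π.shift.gr i) (a : π.CESpace) :
    π.eulerHomotopy hQ (ι π.shift x * a) =
      Q x * a + sgn k i • (ι π.shift x * π.eulerHomotopy hQ a) := by
  have h := recOp_ι_mul (π.eulerHomotopy_aux hQ) hx a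
  rwa [one_mul] at h

theorem eulerHomotopy_mem : π.eulerHomotopy hQ ∈ (grading π.shift).homDeg 1 :=
  recOp_mem _ fun i x hx m a ha => by
    have h := mul_mem_deg (hQ (i - 1) x hx) ha
    rwa [show 2 + (i - 1) + m = 1 + i + m by ring] at h

theorem counit_eulerHomotopy (hε : ∀ x, counit π.shift (Q x) = 0) (a : π.CESpace) :
    counit π.shift (π.eulerHomotopy hQ a) = 0 :=
  LinearMap.congr_fun (f := (counit π.shift).toLinearMap ∘ₗ π.eulerHomotopy hQ) (g := 0)
    (ext_rec (by simp [eulerHomotopy_one]) (fun i x hx a _ => by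
      simp [π.eulerHomotopy_ι_mul hQ hx, counit_ι_mul, hε])) a

/-- `Q x` has neither a constant nor a linear term, so a derivation with values `Q x` on letters
never produces a word of length one. -/
theorem coproj_eulerHomotopy (hε : ∀ x, counit π.shift (Q x) = 0)
    (hp : ∀ x, coproj π.shift (Q x) = 0) (a : π.CESpace) :
    coproj π.shift (π.eulerHomotopy hQ a) = 0 :=
  LinearMap.congr_fun (f := coproj π.shift ∘ₗ π.eulerHomotopy hQ) (g := 0)
    (ext_rec (by simp [eulerHomotopy_one]) (fun i x hx a _ => by
      simp only [LinearMap.comp_apply, LinearMap.zero_apply]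
      rw [π.eulerHomotopy_ι_mul hQ hx, map_add, map_smul, coproj_mul, coproj_ι_mul, hε, hp,
        π.counit_eulerHomotopy hQ hε]
      simp)) a

theorem eulerHomotopy_mem_weightFil (hQw : ∀ i, ∀ x ∈ π.gr i, Q x ∈ weightFil π.toGrading i)
    {p : ℤ} {a : π.CESpace} (ha : a ∈ weightFil π.toGrading p) :
    π.eulerHomotopy hQ a ∈ weightFil π.toGrading p := by
  refine weightFil_induction (P := fun p a => π.eulerHomotopy hQ a ∈ weightFil π.toGrading p)
    ?_ ?_ ?_ ?_ ?_ ha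
  · intro p; rw [map_zero]; exact Submodule.zero_mem _
  · intro p _; rw [eulerHomotopy_one]; exact Submodule.zero_mem _
  · intro p c a h; rw [map_smul]; exact Submodule.smul_mem _ c h
  · intro p a b ha hb; rw [map_add]; exact Submodule.add_mem _ ha hb
  · intro j hj y hy p a ha h
    rw [π.eulerHomotopy_ι_mul hQ (mem_shift hy)]
    exact Submodule.add_mem _ (mul_mem_weightFil (hQw j y hy) ha)
      (Submodule.smul_mem _ _ (ι_mul_mem_weightFil' hj hy h))

variable {E : Module.End k L} (hE : E ∈ π.der 0)

/-- The left side is the commutator of `dT + Td` with multiplication by `sx`, where `T` is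
`eulerHomotopy`; the right side is that of `N² - N`. In the induction on the letters of `a`, the
cross terms in `x` and a letter `y` are matched by the twisted Leibniz rule for `Q [x, y]`, which is
why the cocycle carries the factor two. -/
theorem ceDiff_eulerHomotopy_aux (hd : ∀ x, π.d x = 0)
    (hQb : ∀ i j x y, x ∈ π.gr i → y ∈ π.gr j → Q (π.bracket x y) =
        π.ceAd x (Q y) - sgn k (i * j) • π.ceAd y (Q x) + π.eulerCocycle E x y)
    (hQd : ∀ x, π.ceDiff (Q x) = ι π.shift (E (E x) - E x))
    {i : ℤ} {x : L} (hx : x ∈ π.shift.gr i) (a : π.CESpace) :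
    (π.ceDiff (Q x * a) + sgn k i • (Q x * π.ceDiff a)) +
      (π.eulerHomotopy hQ (π.ceAd x a) + sgn k i • π.ceAd x (π.eulerHomotopy hQ a)) =
    ι π.shift (E (E x) - E x) * a +
      (2 : k) • (ι π.shift (E x) * π.derCoext 0 ⟨E, hE⟩ a) := by
  refine LinearMap.congr_fun
    (f := (π.ceDiff ∘ₗ LinearMap.mulLeft k (Q x) +
      sgn k i • (LinearMap.mulLeft k (Q x) ∘ₗ π.ceDiff))
      + (π.eulerHomotopy hQ ∘ₗ π.ceAd x + sgn k i • (π.ceAd x ∘ₗ π.eulerHomotopy hQ)))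
    (g := mulL π.shift (E (E x) - E x) +
      (2 : k) • (mulL π.shift (E x) ∘ₗ π.derCoext 0 ⟨E, hE⟩)) (ext_rec ?_ ?_) a
  · simp only [LinearMap.add_apply, LinearMap.smul_apply, LinearMap.comp_apply,
      LinearMap.mulLeft_apply, mulL_apply, ceDiff_one, ceAd_one, eulerHomotopy_one, derCoext_one,
      mul_one, smul_zero, map_zero, add_zero, hQd]
  · intro j y hy b h
    simp only [LinearMap.add_apply, LinearMap.smul_apply, LinearMap.comp_apply,
      LinearMap.mulLeft_apply, mulL_apply] at h ⊢
    have hx' : x ∈ π.gr (i - 1) := hx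
    have hy' : y ∈ π.gr (j - 1) := hy
    have hEx : E x ∈ π.shift.gr i := π.der_zero_mem hE hx'
    have hEEx : E (E x) - E x ∈ π.shift.gr i :=
      Submodule.sub_mem _ (π.der_zero_mem hE hEx) hEx
    have hc : ∀ b, Q x * (ι π.shift y * b) =
        sgn k (j * (2 + (i - 1))) • (ι π.shift y * (Q x * b)) :=
      fun b => by
        rw [← mul_assoc, mul_ι_comm hy (hQ _ x hx'), smul_mul_assoc, mul_assoc]
    have hEb : π.derCoext 0 ⟨E, hE⟩ (ι π.shift y * b) =
        ι π.shift (E y) * b + ι π.shift y * π.derCoext 0 ⟨E, hE⟩ b := by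
      rw [π.derCoext_ι_mul _ hy, zero_mul, sgn_zero, one_smul]
    have c1 : ∀ b, ι π.shift (E (E x) - E x) * (ι π.shift y * b) = sgn k (i * j) •
        (ι π.shift y * (ι π.shift (E (E x) - E x) * b)) := fun b => by
      rw [← mul_assoc, ι_comm π.shift hEEx hy, smul_mul_assoc, mul_assoc]
    have c2 : ∀ b, ι π.shift (E x) * (ι π.shift y * b) = sgn k (i * j) •
        (ι π.shift y * (ι π.shift (E x) * b)) := fun b => by
      rw [← mul_assoc, ι_comm π.shift hEx hy, smul_mul_assoc, mul_assoc]
    have hb := hQb _ _ _ _ hx' hy'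
    rw [π.eulerCocycle_apply E hx'] at hb
    have hdi : ∀ b, π.ceDiff (ι π.shift y * b) =
        π.ceAd y b + sgn k j • (ι π.shift y * π.ceDiff b) :=
      π.ceDiff_ι_mul_of_d_eq_zero hd hy
    rw [← eq_sub_iff_add_eq, ← eq_sub_iff_add_eq] at h
    rw [hc, map_smul, hdi, hdi, h, π.ceAd_mul hy (hQ _ x hx'), π.ceAd_ι_mul hx hy, map_add,
      map_smul, map_smul, π.eulerHomotopy_ι_mul hQ hy,
      π.eulerHomotopy_ι_mul hQ (π.shift_bracket_mem hx hy), π.eulerHomotopy_ι_mul hQ hy,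
      map_add, map_smul, π.ceAd_mul hx (hQ _ y hy'), π.ceAd_ι_mul hx hy, mul_add (Q x),
      mul_smul_comm (sgn k j), hc, hEb, c1, mul_add (ι π.shift (E x)), c2, hb]
    simp only [mul_add, add_mul, mul_sub, sub_mul, smul_add, smul_sub, smul_smul, mul_smul_comm,
      smul_mul_assoc, sgn_add, sgn_sub, sgn_one, mul_one, one_mul, mul_comm j i, mul_two,
      mul_assoc (ι π.shift (E x))]
    rcases sgn_cases (k := k) (i * j) with h1 | h1 <;>
      rcases sgn_cases (k := k) i with h2 | h2 <;>
      rcases sgn_cases (k := k) j with h3 | h3 <;> simp only [h1, h2, h3] <;> module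

end Homotopy

end DGLieAlgebra

end DGL

end

/-! ### The homotopy formula and the contraction -/

noncomputable section

namespace DGL

namespace DGLieAlgebra

open GSym

variable {k : Type u} [Field k] {L : Type v} [AddCommGroup L] [Module k L] (π : DGLieAlgebra k L)

theorem derCoext_zero_ι_mul {E : Module.End k L} (hE : E ∈ π.der 0) (x : L) (a : π.CESpace) :
    π.derCoext 0 ⟨E, hE⟩ (ι π.shift x * a) =
      ι π.shift (E x) * a + ι π.shift x * π.derCoext 0 ⟨E, hE⟩ a :=
  derExt_zero_ι_mul (⟨E, π.der_le_homDeg_shift 0 hE⟩ : π.shift.homDeg 0) x a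

/-- Both sides kill the unit, and `ceDiff_eulerHomotopy_aux` says that they have the same
commutators with letters. -/
theorem ceDiff_eulerHomotopy {Q : L →ₗ[k] π.CESpace}
    (hQ : ∀ i, ∀ x ∈ π.gr i, Q x ∈ GSym.deg π.shift (2 + i))
    {E : Module.End k L} (hE : E ∈ π.der 0) (hd : ∀ x, π.d x = 0)
    (hQb : ∀ i j x y, x ∈ π.gr i → y ∈ π.gr j → Q (π.bracket x y) =
        π.ceAd x (Q y) - sgn k (i * j) • π.ceAd y (Q x) + π.eulerCocycle E x y)
    (hQd : ∀ x, π.ceDiff (Q x) = ι π.shift (E (E x) - E x)) (a : π.CESpace) :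
    π.ceDiff (π.eulerHomotopy hQ a) + π.eulerHomotopy hQ (π.ceDiff a) =
      π.derCoext 0 ⟨E, hE⟩ (π.derCoext 0 ⟨E, hE⟩ a) - π.derCoext 0 ⟨E, hE⟩ a := by
  refine LinearMap.congr_fun (f := π.ceDiff ∘ₗ π.eulerHomotopy hQ + π.eulerHomotopy hQ ∘ₗ π.ceDiff)
    (g := π.derCoext 0 ⟨E, hE⟩ ∘ₗ π.derCoext 0 ⟨E, hE⟩ - π.derCoext 0 ⟨E, hE⟩) (ext_rec ?_ ?_) a
  · simp [ceDiff_one, eulerHomotopy_one, derCoext_one]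
  · intro i x hx a h
    simp only [LinearMap.add_apply, LinearMap.sub_apply, LinearMap.comp_apply] at h ⊢
    have hB := π.ceDiff_eulerHomotopy_aux hQ hE hd hQb hQd hx a
    have hdi : ∀ b, π.ceDiff (ι π.shift x * b) =
        π.ceAd x b + sgn k i • (ι π.shift x * π.ceDiff b) :=
      π.ceDiff_ι_mul_of_d_eq_zero hd hx
    rw [π.eulerHomotopy_ι_mul hQ hx, map_add, map_smul, hdi, hdi, map_add, map_smul,
      π.eulerHomotopy_ι_mul hQ hx, derCoext_zero_ι_mul, map_add, derCoext_zero_ι_mul,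
      derCoext_zero_ι_mul]
    rw [← eq_sub_iff_add_eq, ← eq_sub_iff_add_eq] at hB
    rw [← eq_sub_iff_add_eq] at h
    rw [hB]
    have h' : ι π.shift x * π.ceDiff (π.eulerHomotopy hQ a) = _ := congrArg (ι π.shift x * ·) h
    simp only [smul_add, smul_smul, h', mul_sub, map_sub, sub_mul]
    rcases sgn_cases (k := k) i with h2 | h2 <;> simp only [h2] <;> module

variable [CharZero k] {X : Type v} {deg : X → ℤ} {gen : X → L}

/-- The Chevalley–Eilenberg complex of a free graded Lie algebra, with zero differential,
contracts onto the span of the unit and of the generators. -/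
theorem exists_contraction (hd : ∀ x, π.d x = 0) (hπ : ∀ i : ℤ, i ≤ 0 → π.gr i = ⊥)
    (hfree : π.IsFreeOn deg gen) :
    ∃ (s : Module.End k π.CESpace) (q : Module.End k L),
      s ∈ (grading π.shift).homDeg 1 ∧
      (∀ p, ∀ c ∈ weightFil π.toGrading p, s c ∈ weightFil π.toGrading p) ∧
      (∀ c, counit π.shift (s c) = 0) ∧
      (∀ c, coproj π.shift (s c) = 0) ∧
      (∀ x, q (gen x) = gen x) ∧ (∀ x y, q (π.bracket x y) = 0) ∧
      ∀ c, π.ceDiff (s c) + s (π.ceDiff c) =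
        c - counit π.shift c • 1 - ι π.shift (q (coproj π.shift c)) := by
  obtain ⟨E, hE, hgen, hT, hpos, hq, hq'⟩ := hfree.exists_euler
  obtain ⟨Q, hQ, hQb, hQw, hQε, hQp, hQd⟩ := π.exists_eulerLift hd hπ hfree hE hgen
  let τ : π.shift.homDeg 0 := ⟨E, π.der_le_homDeg_shift 0 hE⟩
  let N : Module.End k π.CESpace := derExt π.shift τ
  -- At `n = 0` and `n = 1` this is the default value `0⁻¹ = 0`; it is harmless because `N(N - 1)`
  -- vanishes on those components.
  let r : ℤ → k := fun n => ((n : k) * ((n : k) - 1))⁻¹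
  let M : Module.End k π.CESpace :=
    (eigenGrading τ hT).glue fun n => r n • ((eigenGrading τ hT).gr n).subtype
  have hM : ∀ n c, N c = (n : ℤ) • c → M c = r n • c := fun n c hc => by
    have hc' : c ∈ (eigenGrading τ hT).gr n := by
      rw [Grading.mem_ofEigen, Int.cast_smul_eq_zsmul]
      exact hc
    simp only [M]
    rw [Grading.glue_apply _ _ hc']
    rfl
  -- The commutator of `d` with the extension of `E` extends `[d, E]`, up to sign, and this vanishes
  -- because `π` has zero differential.
  have hNd : ∀ c, N (π.ceDiff c) = π.ceDiff (N c) := fun c => by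
    have h := π.ceDiff_derCoext (n := 0) (m := -1) ⟨E, hE⟩ 0 (by norm_num) (by
      refine LinearMap.ext fun x => ?_
      simp [hd]) c
    rw [map_zero, LinearMap.zero_apply, neg_zero, sgn_zero, one_smul, sub_eq_zero] at h
    exact h.symm
  have hind : ∀ {P : π.CESpace → Prop}, (∀ n : ℤ, ∀ c, N c = n • c → P c) →
      (∀ a b, P a → P b → P (a + b)) → ∀ c, P c := fun {P} h1 h2 c =>
    (eigenGrading τ hT).induction (P := P) (fun n c hc => h1 n c (by
      rw [← Int.cast_smul_eq_zsmul k]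
      exact (Grading.mem_ofEigen _ _).1 hc)) h2 c
  have hMd : ∀ c, M (π.ceDiff c) = π.ceDiff (M c) := hind
    (fun n c hc => by
      rw [hM n c hc, map_smul, hM n _ (by rw [hNd, hc, map_zsmul])])
    (fun a b ha hb => by simp only [map_add, ha, hb])
  -- `N` preserves each weight and each degree, so its eigenspace projections do too, and `M`
  -- combines these with scalars.
  have hMw : ∀ p, ∀ c ∈ weightFil π.toGrading p, M c ∈ weightFil π.toGrading p := fun p c hc =>
    Grading.ofEigen_glue_smul_mem _ _
      (fun c hc => π.derExt_zero_mem_weightFil hc) r hc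
  have hMdeg : ∀ i, ∀ c ∈ GSym.deg π.shift i, M c ∈ GSym.deg π.shift i := fun i c hc =>
    Grading.ofEigen_glue_smul_mem _ _ (fun c hc => by
      have h := derExt_mem τ i c hc
      rwa [zero_add] at h) r hc
  refine ⟨π.eulerHomotopy hQ ∘ₗ M, (Grading.ofEigen E hT).proj 1,
    fun i c hc => π.eulerHomotopy_mem hQ i _ (hMdeg i c hc),
    fun p c hc => π.eulerHomotopy_mem_weightFil hQ hQw (hMw p c hc),
    fun c => π.counit_eulerHomotopy hQ hQε _, fun c => π.coproj_eulerHomotopy hQ hQε hQp _,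
    hq, hq', fun c => ?_⟩
  -- The components of eigenvalue 0 and 1 are the two correction terms of the contraction; on the
  -- other components `(N² - N) M` is the identity.
  have h0 := eigenGrading_proj_zero τ hT hpos c
  have h1 := eigenGrading_proj_one τ hT hpos c
  simp only [LinearMap.comp_apply]
  refine Eq.trans ?_ (congrArg₂ (fun a b => c - a - b) h0 h1)
  rw [hMd, π.ceDiff_eulerHomotopy hQ hE hd hQb hQd]
  change N (N (M c)) - N (M c) = _
  refine hind (P := fun c => N (N (M c)) - N (M c) =
    c - (eigenGrading τ hT).proj 0 c - (eigenGrading τ hT).proj 1 c) ?_ ?_ c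
  · intro n c hc
    have hc' : c ∈ (eigenGrading τ hT).gr n := by
      rw [Grading.mem_ofEigen, Int.cast_smul_eq_zsmul]
      exact hc
    rw [← Int.cast_smul_eq_zsmul k] at hc
    rw [hM n c (by rw [hc, Int.cast_smul_eq_zsmul]), map_smul, hc, map_smul, map_smul, hc]
    by_cases hn0 : n = 0
    · subst hn0
      rw [Grading.proj_same _ hc', Grading.proj_ne _ (by omega) hc']
      simp
    by_cases hn1 : n = 1
    · subst hn1
      rw [Grading.proj_same _ hc', Grading.proj_ne _ (by omega) hc']
      simp
    rw [Grading.proj_ne _ hn0 hc', Grading.proj_ne _ hn1 hc', sub_zero, sub_zero, smul_smul,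
      smul_smul, smul_smul, ← sub_smul]
    have e0 : (n : k) ≠ 0 := Int.cast_ne_zero.2 hn0
    have e1 : (n : k) - 1 ≠ 0 := by
      rw [sub_ne_zero]
      exact_mod_cast hn1
    conv_rhs => rw [← one_smul k c]
    congr 1
    simp only [r]
    field_simp
  · intro a b ha hb
    simp only [map_add] at ha hb ⊢
    rw [add_sub_add_comm, ha, hb]
    abel

end DGLieAlgebra

end DGL

end

noncomputable section

namespace DGL

/-! ### Coderivations of the Chevalley–Eilenberg coalgebra up to homotopy -/

/-- A sum of linear maps that is locally finite with respect to an exhaustive filtration. -/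
theorem exists_locally_finite_sum {k : Type u} [Field k] {V : Type v} [AddCommGroup V] [Module k V]
    {W : Type w} [AddCommGroup W] [Module k W] {F : ℕ → Submodule k V} (hF : Monotone F)
    (hF' : ∀ x, ∃ m, x ∈ F m) (h : ℕ → V →ₗ[k] W) (hh : ∀ j, ∀ x ∈ F j, h j x = 0) :
    ∃ H : V →ₗ[k] W, ∀ m, ∀ x ∈ F m, H x = ∑ j ∈ Finset.range m, h j x := by
  choose w hw using hF'
  -- On `F m` the terms of index at least `m` vanish, so the partial sums are constant from `m` on.
  have key : ∀ m n, m ≤ n → ∀ x ∈ F m,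
      ∑ j ∈ Finset.range m, h j x = ∑ j ∈ Finset.range n, h j x := fun m n hmn x hx =>
    Finset.sum_subset (Finset.range_mono hmn) fun j _ hj =>
      hh j x (hF (by simpa using hj) hx)
  have key' : ∀ m x, x ∈ F m →
      ∑ j ∈ Finset.range (w x), h j x = ∑ j ∈ Finset.range m, h j x := fun m x hx =>
    (key _ _ (le_max_left (w x) m) x (hw x)).trans (key _ _ (le_max_right (w x) m) x hx).symm
  refine ⟨{ toFun := fun x => ∑ j ∈ Finset.range (w x), h j x
            map_add' := fun x y => ?_
            map_smul' := fun c x => ?_ }, fun m x hx => key' m x hx⟩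
  · have hx := hF (le_max_left (w x) (w y)) (hw x)
    have hy := hF (le_max_right (w x) (w y)) (hw y)
    rw [key' _ _ (Submodule.add_mem _ hx hy), key' _ _ hx, key' _ _ hy, ← Finset.sum_add_distrib]
    simp only [map_add]
  · rw [key' _ _ (Submodule.smul_mem _ c (hw x)), RingHom.id_apply, Finset.smul_sum]
    simp only [map_smul]

/-- A graded Lie algebra, with the zero differential. -/
def GradedLieAlgebra.zeroDiff {k : Type u} [Field k] {L : Type v} [AddCommGroup L] [Module k L]
    (A : GradedLieAlgebra k L) : DGLieAlgebra k L where
  toGradedLieAlgebra := A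
  d := 0
  d_mem _ := Submodule.zero_mem _
  d_d _ := rfl
  leibniz _ _ := by simp

namespace DGLieAlgebra

open GSym

variable {k : Type u} [Field k] {L : Type v} [AddCommGroup L] [Module k L] (π : DGLieAlgebra k L)

/-- The quadratic part of the Chevalley–Eilenberg differential. -/
def ceQuad : Module.End k π.CESpace := (π.toGradedLieAlgebra.zeroDiff).ceDiff

theorem ceQuad_one : π.ceQuad 1 = 0 := ceDiff_one _

theorem ceQuad_ι_mul {i : ℤ} {x : L} (hx : x ∈ π.shift.gr i) (a : π.CESpace) :
    π.ceQuad (ι π.shift x * a) = π.ceAd x a + sgn k i • (ι π.shift x * π.ceQuad a) :=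
  (π.toGradedLieAlgebra.zeroDiff).ceDiff_ι_mul_of_d_eq_zero (fun _ => rfl) hx a

/-- The difference is the linear part of the differential, which replaces one letter `sx` by `∓ s(d
x)` and so lowers the weight by one. -/
theorem ceDiff_sub_ceQuad_mem (hπ : ∀ i : ℤ, i ≤ 0 → π.gr i = ⊥) {p : ℤ} {a : π.CESpace}
    (ha : a ∈ weightFil π.toGrading p) :
    π.ceDiff a - π.ceQuad a ∈ weightFil π.toGrading (p - 1) := by
  refine weightFil_induction
    (P := fun p a => π.ceDiff a - π.ceQuad a ∈ weightFil π.toGrading (p - 1)) ?_ ?_ ?_ ?_ ?_ ha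
  · intro p; simp
  · intro p _; rw [ceDiff_one, ceQuad_one, sub_zero]; exact Submodule.zero_mem _
  · intro p c a h
    rw [map_smul, map_smul, ← smul_sub]
    exact Submodule.smul_mem _ c h
  · intro p a b ha hb
    rw [map_add, map_add, add_sub_add_comm]
    exact Submodule.add_mem _ ha hb
  · intro i hi x hx p a ha h
    have h1 : π.ceDiff (ι π.shift x * a) - π.ceQuad (ι π.shift x * a) =
        sgn k (i + 1) • (ι π.shift x * (π.ceDiff a - π.ceQuad a)) - ι π.shift (π.d x) * a := by
      rw [π.ceDiff_ι_mul (mem_shift hx), π.ceQuad_ι_mul (mem_shift hx), mul_sub]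
      module
    rw [h1]
    refine Submodule.sub_mem _ (Submodule.smul_mem _ _ ?_) ?_
    · rw [add_sub_assoc]
      exact ι_mul_mem_weightFil' hi hx h
    · rw [add_sub_right_comm]
      exact ι_mul_mem_weightFil hπ (π.d_mem hx) ha

theorem ceQuad_mem_weightFil (hπ : ∀ i : ℤ, i ≤ 0 → π.gr i = ⊥) {p : ℤ} {a : π.CESpace}
    (ha : a ∈ weightFil π.toGrading p) : π.ceQuad a ∈ weightFil π.toGrading p := by
  refine weightFil_induction (P := fun p a => π.ceQuad a ∈ weightFil π.toGrading p)
    ?_ ?_ ?_ ?_ ?_ ha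
  · intro p; rw [map_zero]; exact Submodule.zero_mem _
  · intro p _; rw [ceQuad_one]; exact Submodule.zero_mem _
  · intro p c a h; rw [map_smul]; exact Submodule.smul_mem _ c h
  · intro p a b ha hb; rw [map_add]; exact Submodule.add_mem _ ha hb
  · intro i hi x hx p a ha h
    rw [π.ceQuad_ι_mul (mem_shift hx)]
    exact Submodule.add_mem _ (π.ceAd_mem_weightFil hπ hx ha)
      (Submodule.smul_mem _ _ (ι_mul_mem_weightFil' hi hx h))

/-- The commutator of an operator of degree `n` with the Chevalley–Eilenberg differential. -/
def ceCommutator (n : ℤ) : Module.End k π.CESpace →ₗ[k] Module.End k π.CESpace :=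
  LinearMap.mulLeft k π.ceDiff - sgn k n • LinearMap.mulRight k π.ceDiff

theorem ceCommutator_apply (n : ℤ) (θ : Module.End k π.CESpace) (a : π.CESpace) :
    π.ceCommutator n θ a = π.ceDiff (θ a) - sgn k n • θ (π.ceDiff a) := rfl

theorem ceCommutator_ceCommutator (n : ℤ) (θ : Module.End k π.CESpace) :
    π.ceCommutator n (π.ceCommutator (n + 1) θ) = 0 := by
  refine LinearMap.ext fun a => ?_
  simp only [ceCommutator_apply, map_sub, map_smul, ceDiff_ceDiff, map_zero, sgn_add, sgn_one,
    LinearMap.zero_apply, smul_sub, smul_smul]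
  rcases sgn_cases (k := k) n with h | h <;> simp only [h] <;> module

theorem ceCommutator_mem {n : ℤ} {θ : Module.End k π.CESpace} (hθ : θ ∈ π.CE.coder n) :
    π.ceCommutator n θ ∈ π.CE.coder (n - 1) := by
  have h := π.CE.coder_commutator π.CE.d_mem_coder hθ
  rwa [neg_mul, one_mul, sgn_neg, neg_add_eq_sub] at h

/-- The operators on `C(π)` with corestriction in the image of `sπ ♯ Der π`. -/
def rhoType (n : ℤ) : Submodule k (Module.End k π.CESpace) where
  carrier := {θ | ∃ x ∈ π.shift.gr n, ∃ φ ∈ π.der n, ∀ c,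
    coproj π.shift (θ c) = counit π.shift c • x + φ (coproj π.shift c)}
  add_mem' := by
    rintro θ θ' ⟨x, hx, φ, hφ, h⟩ ⟨x', hx', φ', hφ', h'⟩
    refine ⟨x + x', Submodule.add_mem _ hx hx', φ + φ', Submodule.add_mem _ hφ hφ', fun c => ?_⟩
    rw [LinearMap.add_apply, map_add, h, h', LinearMap.add_apply]
    module
  zero_mem' := ⟨0, Submodule.zero_mem _, 0, Submodule.zero_mem _, fun c => by simp⟩
  smul_mem' := by
    rintro r θ ⟨x, hx, φ, hφ, h⟩
    refine ⟨r • x, Submodule.smul_mem _ _ hx, r • φ, Submodule.smul_mem _ _ hφ, fun c => ?_⟩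
    rw [LinearMap.smul_apply, map_smul, h, LinearMap.smul_apply]
    module

theorem derCoext_mem_rhoType {n : ℤ} (t : π.der n) : π.derCoext n t ∈ π.rhoType n :=
  ⟨0, Submodule.zero_mem _, t, t.2, fun c => by rw [coproj_derCoext, smul_zero, zero_add]⟩

theorem mulL_mem_rhoType {n : ℤ} {x : L} (hx : x ∈ π.shift.gr n) :
    mulL π.shift x ∈ π.rhoType n :=
  ⟨x, hx, 0, Submodule.zero_mem _, fun c => by
    rw [mulL_apply, coproj_ι_mul, LinearMap.zero_apply, add_zero]⟩

theorem ceCommutator_derCoext_mem {n : ℤ} (t : π.der n) :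
    π.ceCommutator n (π.derCoext n t) ∈ π.rhoType (n - 1) := by
  have h := π.der_commutator π.d_mem_der t.2
  rw [neg_mul, one_mul, sgn_neg, neg_add_eq_sub] at h
  have h1 : π.ceCommutator n (π.derCoext n t) = -π.derCoext (n - 1) ⟨_, h⟩ :=
    LinearMap.ext fun a => π.ceDiff_derCoext t ⟨_, h⟩ (by ring) rfl a
  rw [h1]
  exact Submodule.neg_mem _ (π.derCoext_mem_rhoType _)

/-- The witnesses are the two parts of the differential of `sx` in `sπ ♯ Der π`: `-s(d x)` and the
sign `(-1)^|x|` times `ad x`, with `|x| = n - 1`. -/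
theorem ceCommutator_mulL_mem {n : ℤ} {x : L} (hx : x ∈ π.shift.gr n) :
    π.ceCommutator n (mulL π.shift x) ∈ π.rhoType (n - 1) := by
  refine ⟨-π.d x, Submodule.neg_mem _ (π.shift_d_mem hx), sgn k (n - 1) • π.bracket x,
    Submodule.smul_mem _ _ (π.bracket_mem_der hx), fun c => ?_⟩
  have hx' : x ∈ π.gr (n - 1) := hx
  rw [ceCommutator_apply, mulL_apply, mulL_apply, π.ceDiff_ι_mul hx, add_sub_cancel_right, map_add,
    map_neg, coproj_ι_mul, π.coproj_ceAd hx', LinearMap.smul_apply, smul_neg]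

/-- `rhoType` constrains only the corestriction, but for a coderivation this determines the whole
operator. -/
theorem eq_of_mem_rhoType [CharZero k] (hπ : ∀ i : ℤ, i ≤ 0 → π.gr i = ⊥) {n : ℤ}
    {θ : Module.End k π.CESpace} (hθ : θ ∈ π.CE.coder n) (hθ' : θ ∈ π.rhoType n) :
    ∃ x ∈ π.shift.gr n, ∃ φ : π.der n, θ = mulL π.shift x + π.derCoext n φ := by
  obtain ⟨x, hx, φ, hφ, h⟩ := hθ'
  refine ⟨x, hx, ⟨φ, hφ⟩, π.coder_ext hπ hθ
    (Submodule.add_mem _ (π.mulL_mem_coder hx) (π.derCoext_mem _)) fun c => ?_⟩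
  rw [h, LinearMap.add_apply, map_add, coproj_derCoext, mulL_apply, coproj_ι_mul]

theorem coLift_mem_coder {n : ℤ} {f : π.CESpace →ₗ[k] L}
    (hf : ∀ i, ∀ c ∈ GSym.deg π.shift i, f c ∈ π.shift.gr (n + i)) : coLift f ∈ π.CE.coder n :=
  ⟨coLift_mem hf, fun c => comul_coLift hf c⟩

theorem coproj_comp_mem {n : ℤ} {θ : Module.End k π.CESpace} (hθ : θ ∈ π.CE.coder n) (i : ℤ)
    (c : π.CESpace) (hc : c ∈ GSym.deg π.shift i) : coproj π.shift (θ c) ∈ π.shift.gr (n + i) :=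
  coproj_mem (hθ.1 i c hc)

/-- If `g` vanishes below weight `p`, then in weight `p` the coderivation only produces the letter
`g c`, and `g` does not see the linear part of `d c`, which has smaller weight. The commutator
becomes that of `g` with the quadratic differential and `d` of `π`. -/
theorem coproj_ceCommutator_coLift (hπ : ∀ i : ℤ, i ≤ 0 → π.gr i = ⊥) (n : ℤ)
    {p : ℤ} {g : π.CESpace →ₗ[k] L} (hg : ∀ c ∈ weightFil π.toGrading (p - 1), g c = 0)
    {c : π.CESpace} (hc : c ∈ weightFil π.toGrading p) :
    coproj π.shift (π.ceCommutator n (coLift g) c) = -π.d (g c) - sgn k n • g (π.ceQuad c) := by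
  have h := hg _ (π.ceDiff_sub_ceQuad_mem hπ hc)
  rw [map_sub, sub_eq_zero] at h
  rw [ceCommutator_apply, map_sub, map_smul, coproj_coLift, h, coLift_eq_of_weightFil hg hc,
    ceDiff_ι, map_neg, coproj_ι]

theorem eq_coLift [CharZero k] (hπ : ∀ i : ℤ, i ≤ 0 → π.gr i = ⊥) {n : ℤ}
    {θ : Module.End k π.CESpace} (hθ : θ ∈ π.CE.coder n) : θ = coLift (coproj π.shift ∘ₗ θ) :=
  π.coder_ext hπ hθ (π.coLift_mem_coder (π.coproj_comp_mem hθ)) fun c => by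
    rw [coproj_coLift]
    rfl

end DGLieAlgebra

end DGL

end

/-! ### Correcting a coderivation weight by weight -/

noncomputable section

namespace DGL

theorem GSym.coLift_add {k : Type u} [Field k] {V : Type v} [AddCommGroup V] [Module k V]
    {G : Grading k V} (f g : GSym G →ₗ[k] V) : coLift (f + g) = coLift f + coLift g := by
  have h : mulLeftBy (f + g) = mulLeftBy f + mulLeftBy g := TensorProduct.ext' fun a b => by
    simp [mulLeftBy_tmul, add_mul]
  rw [coLift, h, LinearMap.add_comp]
  rfl

theorem GSym.coLift_sum {k : Type u} [Field k] {V : Type v} [AddCommGroup V] [Module k V]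
    {G : Grading k V} {ι : Type*} (s : Finset ι) (f : ι → GSym G →ₗ[k] V) :
    coLift (∑ i ∈ s, f i) = ∑ i ∈ s, coLift (f i) :=
  map_sum (AddMonoidHom.mk' (fun f : GSym G →ₗ[k] V => coLift f) coLift_add) f s

namespace DGLieAlgebra

open GSym

variable {k : Type u} [Field k] {L : Type v} [AddCommGroup L] [Module k L] (π : DGLieAlgebra k L)
  {X : Type v} {deg : X → ℤ} {gen : X → L}

/-- Degrees being positive, a nonzero bracket of degree less than `p` has both factors of degree
less than `p`, where the derivation already vanishes by induction. -/
theorem der_eq_zero_of_gen (hπ : ∀ i : ℤ, i ≤ 0 → π.gr i = ⊥) (hfree : π.IsFreeOn deg gen) {n p : ℤ}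
    {t : Module.End k L} (ht : t ∈ π.der n) (h0 : ∀ x, deg x < p → t (gen x) = 0) {i : ℤ}
    (hi : i < p) {x : L} (hx : x ∈ π.gr i) : t x = 0 := by
  refine hfree.induction (P := fun i x => i < p → t x = 0) ?_ ?_ ?_ h0 ?_ hx hi
  · intro i _; rw [map_zero]
  · intro i x y hx hy hi; rw [map_add, hx hi, hy hi, add_zero]
  · intro i c x hx hi; rw [map_smul, hx hi, smul_zero]
  · intro i j x y hx hy h1 h2 hij
    rcases le_or_gt i 0 with hi | hi
    · rw [hπ i hi, Submodule.mem_bot] at hx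
      rw [hx]; simp
    rcases le_or_gt j 0 with hj | hj
    · rw [hπ j hj, Submodule.mem_bot] at hy
      rw [hy]; simp
    rw [ht.2 i x hx, h1 (by omega), h2 (by omega)]
    simp

variable [CharZero k]

/-- Freeness and the coalgebra `S(sπ)` do not involve the differential of `π`, so the contraction
for zero differential applies unchanged. -/
theorem exists_contraction_ceQuad (hπ : ∀ i : ℤ, i ≤ 0 → π.gr i = ⊥)
    (hfree : π.IsFreeOn deg gen) :
    ∃ (s : Module.End k π.CESpace) (q : Module.End k L),
      s ∈ (grading π.shift).homDeg 1 ∧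
      (∀ p, ∀ c ∈ weightFil π.toGrading p, s c ∈ weightFil π.toGrading p) ∧
      (∀ c, counit π.shift (s c) = 0) ∧
      (∀ c, coproj π.shift (s c) = 0) ∧
      (∀ x, q (gen x) = gen x) ∧ (∀ x y, q (π.bracket x y) = 0) ∧
      ∀ c, π.ceQuad (s c) + s (π.ceQuad c) =
        c - counit π.shift c • 1 - ι π.shift (q (coproj π.shift c)) :=
  (π.toGradedLieAlgebra.zeroDiff).exists_contraction (fun _ => rfl) hπ hfree

/-- A coderivation with commutator in the image of `sπ ♯ Der π` can be improved by one step in the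
weight filtration. -/
theorem exists_coder_step (hπ : ∀ i : ℤ, i ≤ 0 → π.gr i = ⊥) (hfree : π.IsFreeOn deg gen) {n p : ℤ}
    (hp : 1 ≤ p) {θ : Module.End k π.CESpace} (hθ : θ ∈ π.CE.coder n)
    (hdθ : π.ceCommutator n θ ∈ π.rhoType (n - 1))
    (h0 : ∀ c ∈ weightFil π.toGrading (p - 1), coproj π.shift (θ c) = 0) :
    ∃ (h : π.CESpace →ₗ[k] L) (t : π.der n),
      (∀ i, ∀ c ∈ GSym.deg π.shift i, h c ∈ π.shift.gr (n + 1 + i)) ∧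
      (∀ c ∈ weightFil π.toGrading (p - 1), h c = 0) ∧
      (∀ i, i < p → ∀ x ∈ π.gr i, (t : Module.End k L) x = 0) ∧
      ∀ c ∈ weightFil π.toGrading p, coproj π.shift
        ((θ - π.ceCommutator (n + 1) (coLift h) - π.derCoext n t) c) = 0 := by
  obtain ⟨s, q, hs, hsw, hsε, hsp, hq, hq', hsd⟩ := π.exists_contraction_ceQuad hπ hfree
  let g : π.CESpace →ₗ[k] L := coproj π.shift ∘ₗ θ
  have hg0 : ∀ c ∈ weightFil π.toGrading (p - 1), g c = 0 := h0
  have hgdeg : ∀ i, ∀ c ∈ GSym.deg π.shift i, g c ∈ π.shift.gr (n + i) := π.coproj_comp_mem hθ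
  -- This derivation takes care of the generators, the part of `S(sπ)` that the contraction does not
  -- reach.
  obtain ⟨t, ht, htg⟩ := hfree.exists_der n (fun x => g (ι π.shift (gen x))) (fun x => by
    have h1 := hgdeg _ _ (ι_mem (mem_shift (hfree.1 x)))
    change _ ∈ π.gr _ at h1
    rwa [← add_assoc, add_sub_cancel_right] at h1)
  have ht0 : ∀ i, i < p → ∀ x ∈ π.gr i, t x = 0 := fun i hi x hx =>
    π.der_eq_zero_of_gen hπ hfree ht (fun x hx => by
      rw [htg]
      exact hg0 _ (weightFil_mono (by omega) (ι_mem_weightFil hπ (hfree.1 x)))) hi hx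
  -- The two sides agree on generators and both vanish on brackets of degree at most `p`: `q` kills
  -- brackets, and the factors have degree less than `p`, where `t` is zero.
  have htq : ∀ i, i ≤ p → ∀ x ∈ π.gr i, g (ι π.shift (q x)) = t x := fun i hi x hx => by
    refine hfree.induction (P := fun i x => i ≤ p → g (ι π.shift (q x)) = t x) ?_ ?_ ?_ ?_ ?_ hx hi
    · intro i _; simp
    · intro i x y hx hy hi; simp only [map_add, hx hi, hy hi]
    · intro i c x hx hi; simp only [map_smul, hx hi]
    · intro x _; rw [hq, htg]
    · intro i j x y hx hy h1 h2 hij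
      rw [hq', map_zero, map_zero]
      rcases le_or_gt i 0 with hi | hi
      · rw [hπ i hi, Submodule.mem_bot] at hx
        rw [hx]; simp
      rcases le_or_gt j 0 with hj | hj
      · rw [hπ j hj, Submodule.mem_bot] at hy
        rw [hy]; simp
      rw [ht.2 i x hx, ht0 i (by omega) x hx, ht0 j (by omega) y hy]
      simp
  have hh0 : ∀ c ∈ weightFil π.toGrading (p - 1), (sgn k n • g ∘ₗ s) c = 0 := fun c hc => by
    rw [LinearMap.smul_apply, LinearMap.comp_apply, hg0 _ (hsw _ c hc), smul_zero]
  -- The corestriction of the correcting coderivation is `g` composed with the contracting homotopy;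
  -- the sign `(-1)^n` makes the commutator come out as `g (ds + sd)`, with `d` quadratic.
  refine ⟨sgn k n • g ∘ₗ s, ⟨t, ht⟩, fun i c hc => ?_, hh0, ht0, fun c hc => ?_⟩
  · have h1 := hgdeg _ _ (hs i c hc)
    rw [← add_assoc] at h1
    exact Submodule.smul_mem _ _ h1
  · obtain ⟨x, -, φ, -, hφ⟩ := hdθ
    -- The hypothesis on `[d, θ]` is evaluated at `s c`. Since `ε s = 0` and `p s = 0`, its right
    -- side vanishes, which rewrites `d (g (s c))` as `∓ g` of the quadratic differential of `s c`.
    have h1 := hφ (s c)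
    rw [hsε, hsp, map_zero, zero_smul, add_zero, π.eq_coLift hπ hθ,
      π.coproj_ceCommutator_coLift hπ n hg0 (hsw p c hc)] at h1
    have h2 := π.coproj_ceCommutator_coLift hπ (n + 1) hh0 hc
    have h3 : coproj π.shift c ∈ LinearMap.eqLocus (g ∘ₗ ι π.shift ∘ₗ q) t :=
      coproj_mem_of_weightFil hc fun i _ hi x hx => htq i hi x hx
    have h4 : g 1 = 0 := hg0 1 (one_mem_weightFil (by omega))
    have h5 := congrArg g (hsd c)
    rw [map_add, map_sub, map_sub, map_smul, h4, smul_zero, sub_zero, ← eq_sub_iff_add_eq'] at h5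
    change g (ι π.shift (q (coproj π.shift c))) = t (coproj π.shift c) at h3
    rw [LinearMap.sub_apply, LinearMap.sub_apply, map_sub, map_sub, h2, coproj_derCoext]
    change g c - _ - t _ = 0
    rw [← h3]
    simp only [LinearMap.smul_apply, LinearMap.comp_apply, map_smul]
    rw [h5]
    replace h1 : π.d (g (s c)) = -(sgn k n • g (π.ceQuad (s c))) := by
      rw [← neg_eq_iff_eq_neg]
      exact sub_eq_zero.1 h1
    rw [h1]
    simp only [sgn_add, sgn_one]
    rcases sgn_cases (k := k) n with h | h <;> simp only [h] <;> module

/-- Up to the commutator with the differential, a coderivation with commutator in the image of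
`sπ ♯ Der π` lies in that image. -/
theorem exists_coder_homotopy (hπ : ∀ i : ℤ, i ≤ 0 → π.gr i = ⊥) (hfree : π.IsFreeOn deg gen)
    {n : ℤ} {θ : Module.End k π.CESpace} (hθ : θ ∈ π.CE.coder n)
    (hdθ : π.ceCommutator n θ ∈ π.rhoType (n - 1)) :
    ∃ ξ ∈ π.CE.coder (n + 1), θ - π.ceCommutator (n + 1) ξ ∈ π.rhoType n := by
  have hcoder : ∀ ξ ∈ π.CE.coder (n + 1), π.ceCommutator (n + 1) ξ ∈ π.CE.coder n := fun ξ hξ => by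
    have h := π.ceCommutator_mem hξ
    rwa [add_sub_cancel_right] at h
  -- Subtracting multiplication by `x₀` makes the corestriction vanish on the unit, that is, in
  -- weight zero, where the iteration starts.
  let x₀ := coproj π.shift (θ 1)
  have hx₀ : x₀ ∈ π.shift.gr n := by
    have h := π.coproj_comp_mem hθ 0 1 (GSym.one_mem π.shift)
    rwa [add_zero] at h
  let Good : ℕ → Module.End k π.CESpace → Prop := fun p θ => θ ∈ π.CE.coder n ∧
    π.ceCommutator n θ ∈ π.rhoType (n - 1) ∧
    ∀ c ∈ weightFil π.toGrading p, coproj π.shift (θ c) = 0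
  have good₀ : Good 0 (θ - mulL π.shift x₀) := by
    refine ⟨Submodule.sub_mem _ hθ (π.mulL_mem_coder hx₀), ?_, fun c hc => ?_⟩
    · rw [map_sub]
      exact Submodule.sub_mem _ hdθ (π.ceCommutator_mulL_mem hx₀)
    · rw [weightFil_zero hc, map_smul, map_smul, LinearMap.sub_apply, map_sub, mulL_apply, mul_one,
        coproj_ι, sub_self, smul_zero]
  have step : ∀ (p : ℕ) (f : {θ // Good p θ}), ∃ (h : π.CESpace →ₗ[k] L) (t : π.der n),
      (∀ i, ∀ c ∈ GSym.deg π.shift i, h c ∈ π.shift.gr (n + 1 + i)) ∧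
      (∀ c ∈ weightFil π.toGrading p, h c = 0) ∧
      (∀ i, i ≤ (p : ℤ) → ∀ x ∈ π.gr i, (t : Module.End k L) x = 0) ∧
      Good (p + 1) (f.1 - π.ceCommutator (n + 1) (coLift h) - π.derCoext n t) := by
    rintro p ⟨f, hf, hf', hf0⟩
    obtain ⟨h, t, h1, h2, h3, h4⟩ := π.exists_coder_step hπ hfree (p := p + 1) (by omega) hf hf'
      (by rwa [add_sub_cancel_right])
    rw [add_sub_cancel_right] at h2
    refine ⟨h, t, h1, h2, fun i hi => h3 i (by omega), ?_, ?_, fun c hc => h4 c (by simpa using hc)⟩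
    · exact Submodule.sub_mem _ (Submodule.sub_mem _ hf (hcoder _ (π.coLift_mem_coder h1)))
        (π.derCoext_mem t)
    · rw [map_sub, map_sub, ceCommutator_ceCommutator, sub_zero]
      exact Submodule.sub_mem _ hf' (π.ceCommutator_derCoext_mem t)
  choose h t h1 h2 h3 h4 using step
  -- The successive corrections: the corestriction of `Θ p` vanishes in weight at most `p`.
  let Θ : ∀ p : ℕ, {θ // Good p θ} := fun p =>
    Nat.rec ⟨_, good₀⟩ (fun p f => ⟨_, h4 p f⟩) p
  have hΘ : ∀ m, (Θ m).1 = θ - mulL π.shift x₀ - ∑ j ∈ Finset.range m,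
      (π.ceCommutator (n + 1) (coLift (h j (Θ j))) + π.derCoext n (t j (Θ j))) := by
    intro m
    induction m with
    | zero =>
      rw [Finset.range_zero, Finset.sum_empty, sub_zero]
      rfl
    | succ m ih =>
      change (Θ m).1 - _ - _ = _
      rw [ih, Finset.sum_range_succ]
      abel
  -- The corrections are summed on the level of corestrictions, where the `j`-th one vanishes in
  -- weight at most `j`.
  obtain ⟨H, hH⟩ := exists_locally_finite_sum (F := fun m : ℕ => weightFil π.toGrading (m : ℤ))
    (fun a b hab => weightFil_mono (by exact_mod_cast hab))
    (fun x => exists_mem_weightFil hπ x) (fun j => h j (Θ j)) (fun j => h2 j (Θ j))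
  -- The `j`-th derivation vanishes in degree at most `j`, so in degree `i` the infinite sum stops
  -- before `i`. For negative `i`, `toNat` gives the empty sum and the component is zero.
  let φ : Module.End k L := π.glue fun i =>
    (∑ j ∈ Finset.range i.toNat, (t j (Θ j) : Module.End k L)) ∘ₗ (π.gr i).subtype
  have hφ : ∀ (m : ℕ) i, i ≤ (m : ℤ) → ∀ x ∈ π.gr i,
      φ x = ∑ j ∈ Finset.range m, (t j (Θ j) : Module.End k L) x := fun m i hi x hx => by
    simp only [φ]
    rw [π.glue_apply _ hx, LinearMap.comp_apply, LinearMap.sum_apply]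
    exact Finset.sum_subset (Finset.range_mono (by omega)) fun j _ hj =>
      h3 j (Θ j) i (by
        have := Finset.mem_range.not.1 hj
        omega) x hx
  have hφder : φ ∈ π.der n := by
    refine ⟨fun i x hx => ?_, fun i x hx y => ?_⟩
    · rw [hφ i.toNat i (by omega) x hx]
      exact Submodule.sum_mem _ fun j _ => (t j (Θ j)).2.1 i x hx
    · refine π.induction (P := fun y => φ (π.bracket x y) =
        π.bracket (φ x) y + sgn k (n * i) • π.bracket x (φ y)) (fun l y hy => ?_)
        (fun y z hy hz => ?_) y
      · rw [hφ (i.toNat + l.toNat) _ (by omega) _ (π.bracket_mem hx hy),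
          hφ (i.toNat + l.toNat) i (by omega) x hx, hφ (i.toNat + l.toNat) l (by omega) y hy,
          map_sum, LinearMap.sum_apply, map_sum, Finset.smul_sum, ← Finset.sum_add_distrib]
        exact Finset.sum_congr rfl fun j _ => (t j (Θ j)).2.2 i x hx y
      · simp only [map_add, hy, hz, smul_add]
        abel
  have hHdeg : ∀ i, ∀ c ∈ GSym.deg π.shift i, H c ∈ π.shift.gr (n + 1 + i) := fun i c hc => by
    obtain ⟨m, hm⟩ := exists_mem_weightFil hπ c
    rw [hH m c hm]
    exact Submodule.sum_mem _ fun j _ => h1 j (Θ j) i c hc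
  refine ⟨coLift H, π.coLift_mem_coder hHdeg, x₀, hx₀, φ, hφder, fun c => ?_⟩
  obtain ⟨m, hm⟩ := exists_mem_weightFil hπ c
  have e1 := (Θ m).2.2.2 c hm
  rw [hΘ m] at e1
  -- The tail of the sum vanishes in weight at most `m`, so the commutator of its coderivation with
  -- `d` has zero corestriction there. Hence in weight `m` the total correction may be replaced by
  -- the finite sum occurring in `Θ m`.
  let R : π.CESpace →ₗ[k] L := H - ∑ j ∈ Finset.range m, h j (Θ j)
  have hR : ∀ c ∈ weightFil π.toGrading m, R c = 0 := fun c hc => by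
    simp only [R]
    rw [LinearMap.sub_apply, hH m c hc, LinearMap.sum_apply, sub_self]
  have e2 := π.coproj_ceCommutator_coLift hπ (n + 1) (p := m + 1)
    (g := R) (by rwa [add_sub_cancel_right]) (weightFil_mono (by omega) hm)
  rw [hR c hm, hR _ (π.ceQuad_mem_weightFil hπ hm), map_zero, smul_zero, neg_zero, sub_zero] at e2
  have e3 : coLift H = coLift R + ∑ j ∈ Finset.range m, coLift (h j (Θ j)) := by
    rw [← coLift_sum, ← coLift_add, sub_add_cancel]
  have e4 : coproj π.shift c ∈
      LinearMap.eqLocus φ (∑ j ∈ Finset.range m, (t j (Θ j) : Module.End k L)) :=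
    coproj_mem_of_weightFil hm fun i _ hi x hx => by
      rw [LinearMap.mem_eqLocus, hφ m i hi x hx, LinearMap.sum_apply]
  rw [LinearMap.mem_eqLocus] at e4
  rw [e3, map_add, map_sum, e4, LinearMap.sub_apply, LinearMap.add_apply, map_sub, map_add, e2]
  simp only [LinearMap.sub_apply, LinearMap.sum_apply, LinearMap.add_apply, map_sub, map_sum,
    map_add, mulL_apply, coproj_ι_mul, coproj_derCoext, Finset.sum_add_distrib] at e1 ⊢
  rw [sub_sub, sub_eq_zero] at e1
  rw [e1]
  abel

end DGLieAlgebra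

end DGL

end

noncomputable section

namespace DGL

/-! ### A criterion for quasi-isomorphisms -/

theorem Grading.proj_comm {k : Type u} [Field k] {V : Type v} [AddCommGroup V] [Module k V]
    {W : Type w} [AddCommGroup W] [Module k W] (G : Grading k V) (H : Grading k W) {m : ℤ}
    {f : V →ₗ[k] W} (hf : ∀ i, ∀ x ∈ G.gr i, f x ∈ H.gr (i + m)) (n : ℤ) (x : V) :
    H.proj (n + m) (f x) = f (G.proj n x) := by
  refine LinearMap.congr_fun (f := H.proj (n + m) ∘ₗ f) (g := f ∘ₗ G.proj n)
    (G.ext_hom fun i y hy => ?_) x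
  simp only [LinearMap.comp_apply]
  by_cases h : i = n
  · subst h
    rw [H.proj_same (hf i y hy), G.proj_same hy]
  · rw [H.proj_ne (by omega) (hf i y hy), G.proj_ne h hy, map_zero]

namespace DGLieAlgebra

section Criterion

variable {k : Type u} [Field k] {L : Type v} [AddCommGroup L] [Module k L] {M : Type w}
  [AddCommGroup M] [Module k M] {A : DGLieAlgebra k L} {B : DGLieAlgebra k M} (f : Hom A B)

theorem Hom.proj_toLin (n : ℤ) (x : L) : B.proj n (f.toLin x) = f.toLin (A.proj n x) := by
  have h := A.proj_comm B.toGrading (m := 0) (f := f.toLin)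
    (fun i x hx => by rw [add_zero]; exact f.isHom.map_mem hx) n x
  rwa [add_zero] at h

theorem proj_d (n : ℤ) (x : L) : A.proj (n - 1) (A.d x) = A.d (A.proj n x) :=
  A.proj_comm A.toGrading (m := -1) (f := A.d) (fun _ _ hx => A.d_mem hx) n x

/-- The class of a cycle vanishes if and only if the cycle is a boundary. -/
theorem mkQ_eq_zero_iff (x : LinearMap.ker A.d) :
    (Submodule.Quotient.mk x : A.Homology) = 0 ↔ ∃ y, A.d y = x := by
  rw [Submodule.Quotient.mk_eq_zero]
  rfl

theorem Hom.isQuasiIso_iff : f.IsQuasiIso ↔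
    (∀ x, A.d x = 0 → (∃ y, B.d y = f.toLin x) → ∃ z, A.d z = x) ∧
    ∀ y, B.d y = 0 → ∃ x, A.d x = 0 ∧ ∃ z, B.d z = f.toLin x - y := by
  have hmk : ∀ x : LinearMap.ker A.d, ∀ hx : B.d (f.toLin x) = 0,
      f.homologyMap (Submodule.Quotient.mk x) =
        Submodule.Quotient.mk (⟨f.toLin x, hx⟩ : LinearMap.ker B.d) := fun x hx => rfl
  have hcyc : ∀ x : LinearMap.ker A.d, B.d (f.toLin x) = 0 := fun x => by
    rw [← f.map_d, LinearMap.mem_ker.1 x.2, map_zero]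
  refine and_congr ?_ ?_
  · rw [← LinearMap.ker_eq_bot, LinearMap.ker_eq_bot']
    refine ⟨fun h x hx hy => ?_, fun h z hz => ?_⟩
    · have h1 := h (Submodule.Quotient.mk ⟨x, hx⟩) (by
        rw [hmk _ (hcyc _), mkQ_eq_zero_iff]
        exact hy)
      exact (mkQ_eq_zero_iff _).1 h1
    · obtain ⟨x, rfl⟩ := Submodule.Quotient.mk_surjective _ z
      rw [hmk _ (hcyc _), mkQ_eq_zero_iff] at hz
      exact (mkQ_eq_zero_iff _).2 (h x x.2 hz)
  · refine ⟨fun h y hy => ?_, fun h z => ?_⟩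
    · obtain ⟨z, hz⟩ := h (Submodule.Quotient.mk ⟨y, hy⟩)
      obtain ⟨x, rfl⟩ := Submodule.Quotient.mk_surjective _ z
      rw [hmk _ (hcyc _), ← sub_eq_zero, ← Submodule.Quotient.mk_sub, mkQ_eq_zero_iff] at hz
      exact ⟨x, x.2, hz⟩
    · obtain ⟨y, rfl⟩ := Submodule.Quotient.mk_surjective _ z
      obtain ⟨x, hx, hz⟩ := h y y.2
      refine ⟨Submodule.Quotient.mk ⟨x, hx⟩, ?_⟩
      rw [hmk _ (hcyc _), ← sub_eq_zero, ← Submodule.Quotient.mk_sub, mkQ_eq_zero_iff]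
      exact hz

/-- An injective map of dg Lie algebras is a quasi-isomorphism if every homogeneous element with
boundary in the image lies in the image up to a boundary. -/
theorem Hom.isQuasiIso_of_injective (hf : ∀ n, ∀ x ∈ A.gr n, f.toLin x = 0 → x = 0)
    (h : ∀ n, ∀ y ∈ B.gr n, B.d y ∈ LinearMap.range f.toLin →
      ∃ z, y - B.d z ∈ LinearMap.range f.toLin) : f.IsQuasiIso := by
  have hf' : ∀ x, f.toLin x = 0 → x = 0 := fun x hx => A.eq_zero_of_proj fun n =>
    hf n _ (A.proj_mem n x) (by rw [← f.proj_toLin, hx, map_zero])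
  -- The homogeneous hypothesis extends to all elements: `f` and the differentials respect the
  -- gradings, so each component of `y` satisfies it.
  have h' : ∀ y, B.d y ∈ LinearMap.range f.toLin →
      ∃ z, y - B.d z ∈ LinearMap.range f.toLin := by
    rintro y ⟨x, hx⟩
    have h1 : ∀ n, ∃ z, B.proj n y - B.d z ∈ LinearMap.range f.toLin := fun n =>
      h n _ (B.proj_mem n y) ⟨A.proj (n - 1) x, by rw [← f.proj_toLin, hx, proj_d]⟩
    choose z hz using h1
    obtain ⟨s, hs⟩ := B.exists_finset_sum y
    refine ⟨∑ n ∈ s, z n, ?_⟩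
    rw [hs s (Finset.Subset.refl s), map_sum, ← Finset.sum_sub_distrib]
    exact Submodule.sum_mem _ fun n _ => hz n
  rw [Hom.isQuasiIso_iff]
  refine ⟨fun x _ ⟨y, hy⟩ => ?_, fun y hy => ?_⟩
  -- If `f x = d y`, then `y` is `f a` up to a boundary, so `f x = f (d a)` and injectivity gives `x
  -- = d a`.
  · obtain ⟨z, a, ha⟩ := h' y ⟨x, hy.symm⟩
    refine ⟨a, ?_⟩
    rw [← sub_eq_zero]
    refine hf' _ ?_
    rw [map_sub, f.map_d, ha, map_sub, B.d_d, sub_zero, hy, sub_self]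
  · obtain ⟨z, a, ha⟩ := h' y (by rw [hy]; exact Submodule.zero_mem _)
    refine ⟨a, hf' _ ?_, -z, ?_⟩
    · rw [f.map_d, ha, map_sub, B.d_d, hy, sub_zero]
    · rw [ha, map_neg]
      abel

end Criterion

open GSym

variable {k : Type u} [Field k] {L : Type v} [AddCommGroup L] [Module k L] (π : DGLieAlgebra k L)
  {X : Type v} {deg : X → ℤ} {gen : X → L}

/-- A preimage can be replaced by its component of degree `n`, for which the corestriction is read
off directly. -/
theorem mem_rhoType_of_mem_range {n : ℤ} (θ : π.CE.coder n)
    (h : Tot.of π.CE.coder n θ ∈ LinearMap.range π.rhoLin) :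
    (θ : Module.End k π.CESpace) ∈ π.rhoType n := by
  obtain ⟨a, ha⟩ := h
  have h1 : π.rhoLin (π.semidirect.proj n a) = Tot.of π.CE.coder n θ := by
    have h2 := π.rho.proj_toLin n a
    change π.CE.Coder.proj n (π.rhoLin a) = π.rhoLin _ at h2
    rw [← h2, ha]
    exact π.CE.Coder.proj_same ⟨θ, rfl⟩
  have h2 := π.semidirect.proj_mem n a
  generalize π.semidirect.proj n a = b at h1 h2
  obtain ⟨x, f⟩ := b
  obtain ⟨hx, φ, rfl⟩ := h2
  have h3 : ((x, Tot.of π.der n φ) : π.SemidirectSpace) = (x, 0) + (0, Tot.of π.der n φ) := by simp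
  rw [h3, map_add, π.rhoLin_s hx, π.rhoLin_der, ← map_add] at h1
  have h4 := congrArg π.CE.coderToEnd h1
  rw [coderToEnd_of, coderToEnd_of] at h4
  rw [← h4]
  exact Submodule.add_mem _ (π.mulL_mem_rhoType hx)
    (Submodule.smul_mem _ _ (π.derCoext_mem_rhoType φ))

/-- The corestriction recovers both summands: its value on the unit is `sx`, and its values on
single letters then give the derivation. -/
theorem rhoLin_injective {n : ℤ} {a : π.SemidirectSpace} (ha : a ∈ π.semidirect.gr n)
    (h : π.rhoLin a = 0) : a = 0 := by
  obtain ⟨x, f⟩ := a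
  obtain ⟨hx, φ, rfl⟩ := ha
  have h3 : ((x, Tot.of π.der n φ) : π.SemidirectSpace) = (x, 0) + (0, Tot.of π.der n φ) := by simp
  rw [h3, map_add, π.rhoLin_s hx, π.rhoLin_der, ← map_add] at h
  have h4 := congrArg π.CE.coderToEnd h
  rw [coderToEnd_of, map_zero] at h4
  have h5 : ∀ c, coproj π.shift (ι π.shift x * c + sgn k n • π.derCoext n φ c) = 0 := fun c =>
    (congrArg (coproj π.shift) (LinearMap.congr_fun h4 c)).trans (map_zero _)
  have hx0 : x = 0 := by
    have h6 := h5 1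
    rwa [derCoext_one, smul_zero, add_zero, mul_one, coproj_ι] at h6
  have hφ0 : φ = 0 := by
    refine Subtype.ext (LinearMap.ext fun y => ?_)
    have h6 := h5 (ι π.shift y)
    rw [hx0, map_zero, zero_mul, zero_add, map_smul, coproj_derCoext, coproj_ι] at h6
    rcases sgn_cases (k := k) n with h | h <;> rw [h] at h6 <;> simpa using h6
  rw [hx0, hφ0, map_zero]
  rfl

theorem rho_isQuasiIso [CharZero k] (hπ : ∀ i : ℤ, i ≤ 0 → π.gr i = ⊥)
    (hfree : π.IsFreeOn deg gen) : π.rho.IsQuasiIso := by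
  refine π.rho.isQuasiIso_of_injective (fun n x hx h => π.rhoLin_injective hx h) ?_
  rintro n _ ⟨θ, rfl⟩ h
  have hc : ∀ {n} (θ : π.CE.coder n), π.CE.Coder.d (Tot.of π.CE.coder n θ) =
      Tot.of π.CE.coder (n - 1) ⟨_, π.ceCommutator_mem θ.2⟩ := fun {n} θ => by
    rw [coder_d_of]
    refine Tot.of_congr _ (by ring) ?_
    simp only [neg_mul, one_mul, sgn_neg]
    rfl
  rw [hc] at h
  obtain ⟨ξ, hξ, hθ⟩ := π.exists_coder_homotopy hπ hfree θ.2 (π.mem_rhoType_of_mem_range _ h)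
  have hξ' : π.ceCommutator (n + 1) ξ ∈ π.CE.coder n := by
    have h := π.ceCommutator_mem hξ
    rwa [add_sub_cancel_right] at h
  obtain ⟨x, hx, φ, hφ⟩ := π.eq_of_mem_rhoType hπ (Submodule.sub_mem _ θ.2 hξ') hθ
  -- The sign cancels the factor `(-1)^n` in the definition of `rhoLin`.
  refine ⟨Tot.of π.CE.coder (n + 1) ⟨ξ, hξ⟩, (x, sgn k n • Tot.of π.der n φ), ?_⟩
  have h3 : ((x, sgn k n • Tot.of π.der n φ) : π.SemidirectSpace) =
      (x, 0) + sgn k n • (0, Tot.of π.der n φ) := by simp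
  have h4 : Tot.of π.CE.coder (n + 1 - 1) ⟨_, π.ceCommutator_mem hξ⟩ =
      Tot.of π.CE.coder n ⟨_, hξ'⟩ := Tot.of_congr _ (by ring) rfl
  change π.rhoLin _ = _
  rw [h3, map_add, map_smul, π.rhoLin_s hx, π.rhoLin_der, ← map_smul, ← map_add, hc, h4, ← map_sub]
  refine Tot.of_congr _ rfl (Eq.trans ?_ hφ.symm)
  change mulL π.shift x + sgn k n • sgn k n • π.derCoext n φ = _
  rw [smul_smul]
  rcases sgn_cases (k := k) n with h | h <;> rw [h] <;> simp

end DGLieAlgebra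

end DGL

end

noncomputable section

namespace DGL

/-! ### The centre of a free graded Lie algebra -/

theorem Grading.homDeg_commutator {k : Type u} [Field k] {V : Type v} [AddCommGroup V] [Module k V]
    (G : Grading k V) {i j : ℤ} {f g : Module.End k V} (hf : f ∈ G.homDeg i) (hg : g ∈ G.homDeg j) :
    f * g - sgn k (i * j) • (g * f) ∈ G.homDeg (i + j) := by
  refine Submodule.sub_mem _ (fun l x hx => ?_) (Submodule.smul_mem _ _ fun l x hx => ?_)
  · rw [add_assoc]
    exact hf _ _ (hg l x hx)
  · rw [add_comm i, add_assoc]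
    exact hg _ _ (hf l x hx)

section FreeModule

variable (k : Type u) [Field k] {X : Type v} (deg : X → ℤ)

/-- The grading of the free module on the words in `X` by the sum of the degrees of the letters. -/
def wordGrading : Grading k (List X →₀ k) where
  gr n := Submodule.span k {a | ∃ l : List X, (l.map deg).sum = n ∧ a = Finsupp.single l 1}
  internal := by
    have hs : ∀ n l, Finsupp.lift (List X →₀ k) k (List X)
        (fun l => if (l.map deg).sum = n then Finsupp.single l 1 else 0) (Finsupp.single l 1) =
          if (l.map deg).sum = n then Finsupp.single l (1 : k) else 0 := fun n l => by simp
    refine internal_of_proj _ (fun n => Finsupp.lift (List X →₀ k) k (List X)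
      fun l => if (l.map deg).sum = n then Finsupp.single l 1 else 0)
      (fun n x hx => ?_) (fun m n h x hx => ?_) fun x => ?_
    · refine Submodule.span_le (p := LinearMap.eqLocus (Finsupp.lift (List X →₀ k) k (List X)
        fun l => if (l.map deg).sum = n then Finsupp.single l 1 else 0) LinearMap.id).2 ?_ hx
      rintro _ ⟨l, hl, rfl⟩
      exact (hs n l).trans (if_pos hl)
    · refine Submodule.span_le (p := LinearMap.ker (Finsupp.lift (List X →₀ k) k (List X)
        fun l => if (l.map deg).sum = n then Finsupp.single l 1 else 0)).2 ?_ hx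
      rintro _ ⟨l, rfl, rfl⟩
      exact (hs n l).trans (if_neg h)
    · induction x using Finsupp.induction_linear with
      | zero => exact Submodule.zero_mem _
      | add x y hx hy => exact Submodule.add_mem _ hx hy
      | single l c =>
        rw [← mul_one c, ← smul_eq_mul, ← Finsupp.smul_single]
        exact Submodule.smul_mem _ c
          (Submodule.mem_iSup_of_mem _ (Submodule.subset_span ⟨l, rfl, rfl⟩))

theorem single_mem_wordGrading (l : List X) :
    Finsupp.single l 1 ∈ (wordGrading k deg).gr (l.map deg).sum :=
  Submodule.subset_span ⟨l, rfl, rfl⟩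

theorem cons_mem_homDeg (x : X) :
    Finsupp.lmapDomain k k (List.cons x) ∈ (wordGrading k deg).homDeg (deg x) := by
  intro i a ha
  refine Submodule.span_le (p := ((wordGrading k deg).gr (deg x + i)).comap
    (Finsupp.lmapDomain k k (List.cons x))).2 ?_ ha
  rintro _ ⟨l, rfl, rfl⟩
  change Finsupp.lmapDomain k k (List.cons x) (Finsupp.single l 1) ∈
    (wordGrading k deg).gr _
  rw [Finsupp.lmapDomain_apply, Finsupp.mapDomain_single]
  have h := single_mem_wordGrading k deg (x :: l)
  rwa [List.map_cons, List.sum_cons] at h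

end FreeModule

namespace GradedLieAlgebra

variable {k : Type u} [Field k] {L : Type v} [AddCommGroup L] [Module k L]
  {A : GradedLieAlgebra k L} {X : Type v} {deg : X → ℤ} {gen : X → L}

/-- A free graded Lie algebra acts on a graded vector space through arbitrary operators. -/
theorem IsFreeOn.exists_action (h : A.IsFreeOn deg gen) {M : Type (max u v)} [AddCommGroup M]
    [Module k M] (G : Grading k M) (r : X → Module.End k M) (hr : ∀ x, r x ∈ G.homDeg (deg x)) :
    ∃ act : L →ₗ[k] Module.End k M, (∀ x, act (gen x) = r x) ∧
      (∀ i, ∀ x ∈ A.gr i, act x ∈ G.homDeg i) ∧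
      ∀ i j x y, x ∈ A.gr i → y ∈ A.gr j →
        act (A.bracket x y) = act x * act y - sgn k (i * j) • (act y * act x) := by
  let B := commDGLie G.homDeg (fun hf hg => G.homDeg_commutator hf hg) 0 (Submodule.zero_mem _)
    (mul_zero 0)
  obtain ⟨f, ⟨hf, hfg⟩, -⟩ := h.2 _ B.toGradedLieAlgebra
    (fun x => Tot.of G.homDeg (deg x) ⟨r x, hr x⟩) (fun x => ⟨_, rfl⟩)
  refine ⟨Tot.toAmbient G.homDeg ∘ₗ f, fun x => ?_, fun i x hx => ?_, fun i j x y hx hy => ?_⟩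
  · rw [LinearMap.comp_apply, hfg, Tot.toAmbient_of]
  · obtain ⟨a, ha⟩ := hf.map_mem hx
    rw [LinearMap.comp_apply, ← ha, Tot.toAmbient_of]
    exact a.2
  · obtain ⟨a, ha⟩ := hf.map_mem hx
    obtain ⟨b, hb⟩ := hf.map_mem hy
    rw [LinearMap.comp_apply, LinearMap.comp_apply, LinearMap.comp_apply, hf.map_bracket, ← ha,
      ← hb, Tot.toAmbient_of, Tot.toAmbient_of]
    change Tot.toAmbient G.homDeg (commBracket _ _ _ _) = _
    rw [commBracket_lof, Tot.toAmbient_of]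

/-- The action `x (c, y) = (0, c E x + [x, y])` on `k × L` defined by a derivation `E`. -/
def derAct (A : GradedLieAlgebra k L) (E : Module.End k L) : L →ₗ[k] Module.End k (k × L) :=
  LinearMap.mk₂ k (fun x p => ((0 : k), p.1 • E x + A.bracket x p.2))
    (fun x y p => Prod.ext (by simp) (by simp; abel))
    (fun c x p => Prod.ext (by simp) (by simp [smul_comm c]))
    (fun x p q => Prod.ext (by simp) (by simp [add_smul]; abel))
    (fun c x p => Prod.ext (by simp) (by simp [mul_smul]))

theorem derAct_apply (E : Module.End k L) (x : L) (p : k × L) :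
    A.derAct E x p = (0, p.1 • E x + A.bracket x p.2) := rfl

/-- The action law is the Leibniz rule for `E` in the first coordinate and the Jacobi identity in
the second. -/
theorem derAct_bracket {E : Module.End k L} (hE : E ∈ A.der 0) {i j : ℤ} {x y : L}
    (hx : x ∈ A.gr i) (hy : y ∈ A.gr j) (p : k × L) : A.derAct E (A.bracket x y) p =
      A.derAct E x (A.derAct E y p) - sgn k (i * j) • A.derAct E y (A.derAct E x p) := by
  have hEx : E x ∈ A.gr i := by
    have h := hE.1 i x hx
    rwa [zero_add] at h
  have h1 : A.bracket y (E x) = _ := A.skew hy hEx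
  have h2 := A.jacobi hx hy p.2
  simp only [derAct_apply]
  refine Prod.ext (by simp) ?_
  simp only [Prod.snd_sub, Prod.smul_snd, zero_smul, zero_add, map_add, map_smul, h1, h2,
    A.der_zero_bracket hE, mul_comm j i, smul_add, smul_neg, smul_smul]
  rcases sgn_cases (k := k) (i * j) with h | h <;> simp only [h] <;> module

/-- The centre of a free graded Lie algebra on at least two generators is trivial. -/
theorem IsFreeOn.eq_zero_of_central [CharZero k] [Nontrivial X] (h : A.IsFreeOn deg gen) {i : ℤ}
    {z : L} (hz : z ∈ A.gr i) (hc : ∀ y, A.bracket z y = 0) : z = 0 := by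
  classical
  obtain ⟨E, hE, hgen, -, hpos, -, -⟩ := h.exists_euler
  obtain ⟨v, w, hvw⟩ := exists_pair_ne X
  let G := wordGrading k deg
  -- The free Lie algebra acts on words, the generator `x` by prefixing the letter `x`; this is left
  -- multiplication in the tensor algebra.
  obtain ⟨act, hact, hdeg, hbr⟩ := h.exists_action G (fun x => Finsupp.lmapDomain k k (List.cons x))
    (cons_mem_homDeg k deg)
  have hz0 : act z (Finsupp.single [] 1) = 0 := by
    -- The analogue of a Fox derivative: it takes the generator `w` to the empty word and the other
    -- generators to zero. The translation by `-deg w` makes it preserve degrees.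
    obtain ⟨Q, -, hQg, hQb⟩ := h.exists_cocycle_lift (G.translate (-deg w)) act 0
      (fun i j x m hx hm => by
        have h1 := hdeg i x hx (-deg w + j) m hm
        rwa [add_left_comm] at h1)
      (fun i j x y hx hy m => by
        rw [hbr i j x y hx hy]
        simp)
      (by simp) (by simp) (by simp) (fun x => if x = w then Finsupp.single [] 1 else 0)
      (fun x => by
        by_cases hx : x = w
        · subst hx
          rw [if_pos rfl]
          change _ ∈ G.gr (-deg x + deg x)
          rw [neg_add_cancel]
          exact single_mem_wordGrading k deg []
        · rw [if_neg hx]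
          exact Submodule.zero_mem _)
    have h1 := hQb _ _ z (gen v) hz (h.1 v)
    have h2 := hQb _ _ z (gen w) hz (h.1 w)
    rw [hc, map_zero, hQg, hact] at h1 h2
    -- Applying `Q` to `[z, v] = 0` gives `v · Q z = 0`, and prefixing a letter is injective. Then
    -- `[z, w] = 0` leaves only `z` acting on the empty word.
    have h3 : Q z = 0 := by
      refine Finsupp.mapDomain_injective (List.cons_injective (a := v)) ?_
      rw [Finsupp.mapDomain_zero]
      rw [if_neg hvw] at h1
      rcases sgn_cases (k := k) (i * deg v) with hs | hs <;> rw [hs] at h1 <;>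
        simpa using h1.symm
    rw [h3, if_pos rfl] at h2
    simpa using h2.symm
  -- A word acts letter by letter on `(1, 0)`. The resulting map is equivariant and plays the part
  -- of Dynkin's operator: it turns the action of `z` on the empty word into `E z`.
  let T : (List X →₀ k) →ₗ[k] k × L := Finsupp.lift (k × L) k (List X)
    fun l => l.foldr (fun x p => A.derAct E (gen x) p) (1, 0)
  have hT : ∀ x a, T (Finsupp.lmapDomain k k (List.cons x) a) = A.derAct E (gen x) (T a) :=
    fun x a => by
      induction a using Finsupp.induction_linear with
      | zero => simp
      | add a b ha hb => simp only [map_add, ha, hb]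
      | single l c => simp [T, Finsupp.mapDomain_single]
  have hTact : ∀ a, T (act z a) = A.derAct E z (T a) := by
    refine h.induction (P := fun _ x => ∀ a, T (act x a) = A.derAct E x (T a)) ?_ ?_ ?_ ?_ ?_ hz
    · intro i a; simp
    · intro i x y hx hy a; simp only [map_add, LinearMap.add_apply, hx, hy]
    · intro i c x hx a; simp only [map_smul, LinearMap.smul_apply, hx]
    · intro x a; rw [hact, hT]
    · intro i j x y hx hy h1 h2 a
      rw [hbr i j x y hx hy, A.derAct_bracket hE hx hy, ← h2, ← h1, ← h1, ← h2]
      simp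
  have h1 := hTact (Finsupp.single [] 1)
  rw [hz0, map_zero] at h1
  have h2 : T (Finsupp.single [] 1) = (1, 0) := by simp [T]
  rw [h2, derAct_apply] at h1
  have h3 := congrArg Prod.snd h1
  simp only [one_smul, map_zero, add_zero, Prod.snd_zero] at h3
  -- All eigenvalues of `E` are positive, so `E z = 0` forces `z = 0`.
  exact hpos 0 le_rfl z (by rw [← h3, Int.cast_zero, zero_smul])

end GradedLieAlgebra

/-! ### Injectivity of `ad` and the projection to outer derivations -/

namespace DGLieAlgebra

variable {k : Type u} [Field k] {L : Type v} [AddCommGroup L] [Module k L] (π : DGLieAlgebra k L)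

/-- `ad` respects the gradings, so every homogeneous component of an element of its kernel is
central. -/
theorem ad_injective_of_isFreeOn [CharZero k] {X : Type v} {deg : X → ℤ} {gen : X → L}
    [Nontrivial X] (hfree : π.IsFreeOn deg gen) {x : L} (hx : π.ad x = 0) : x = 0 := by
  refine π.eq_zero_of_proj fun n => hfree.eq_zero_of_central (π.proj_mem n x) fun y => ?_
  have h := π.proj_ad n x
  rw [hx, map_zero] at h
  rw [← π.derToEnd_ad, ← h, map_zero, LinearMap.zero_apply]

/-- The kernel of the projection is the cone of `ad : π → ad π`, which is acyclic when `ad` is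
injective. The proof chases elements instead of using the long exact sequence. -/
theorem toOuter_isQuasiIso (h : ∀ x, π.ad x = 0 → x = 0) : π.toOuter.IsQuasiIso := by
  have hd : ∀ f, π.outer.d (π.adRange.mkQ f) = π.adRange.mkQ (π.Der.d f) := fun f => rfl
  rw [Hom.isQuasiIso_iff]
  refine ⟨?_, fun y hy => ?_⟩
  · rintro ⟨x, f⟩ hx ⟨y, hy⟩
    obtain ⟨g, rfl⟩ := π.adRange.mkQ_surjective y
    have h1 : π.adRange.mkQ (f - π.Der.d g) = 0 := by
      rw [map_sub, ← hd, hy]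
      exact sub_self _
    rw [Submodule.mkQ_apply, Submodule.Quotient.mk_eq_zero] at h1
    obtain ⟨z, hz⟩ := h1
    -- With `ad z = f - [d, g]`, the derivation part of the differential of `sz + g` is `f`; the
    -- cycle condition and injectivity of `ad` give `x = -d z`.
    refine ⟨(z, g), ?_⟩
    have h2 : π.ad x + π.Der.d f = 0 := congrArg Prod.snd hx
    have h3 := congrArg π.Der.d hz
    rw [d_ad, map_sub, π.Der.d_d, sub_zero] at h3
    have h4 : x + π.d z = 0 := h _ (by rw [map_add, h3, h2])
    change (-π.d z, π.ad z + π.Der.d g) = (x, f)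
    rw [hz, sub_add_cancel, ← eq_neg_of_add_eq_zero_left h4]
  · obtain ⟨g, rfl⟩ := π.adRange.mkQ_surjective y
    rw [hd, Submodule.mkQ_apply, Submodule.Quotient.mk_eq_zero] at hy
    obtain ⟨z, hz⟩ := hy
    -- As `[d, g] = ad z`, adding `-sz` cancels the derivation part, and `d z = 0` follows from `ad
    -- (d z) = 0`.
    refine ⟨(-z, g), ?_, 0, ?_⟩
    · have h1 := congrArg π.Der.d hz
      rw [d_ad, π.Der.d_d] at h1
      change (-π.d (-z), π.ad (-z) + π.Der.d g) = 0
      rw [map_neg, map_neg, h _ h1, hz, neg_add_cancel, neg_zero, neg_zero]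
      rfl
    · rw [map_zero]
      exact (sub_self _).symm

end DGLieAlgebra

end DGL

end

theorem mainTheorem10 {k : Type u} [Field k] [CharZero k] {L : Type v} [AddCommGroup L] [Module k L]
    (π : DGL.DGLieAlgebra k L) (hπ : ∀ i : ℤ, i ≤ 0 → π.gr i = ⊥) :
    (∃! ρ : DGL.DGLieAlgebra.Hom π.semidirect π.CE.Coder, π.IsCanonical ρ) ∧
    (∀ ρ : DGL.DGLieAlgebra.Hom π.semidirect π.CE.Coder, π.IsCanonical ρ →
      ∀ (X : Type v) (deg : X → ℤ) (gen : X → L), π.IsFreeOn deg gen → ρ.IsQuasiIso) ∧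
    (∀ (X : Type v) (deg : X → ℤ) (gen : X → L), Nontrivial X → π.IsFreeOn deg gen →
      π.toOuter.IsQuasiIso) := by
  refine ⟨⟨π.rho, π.rho_isCanonical, fun ρ hρ => π.eq_rho hπ hρ⟩, ?_, ?_⟩
  · intro ρ hρ X deg gen hfree
    rw [π.eq_rho hπ hρ]
    exact π.rho_isQuasiIso hπ hfree
  · intro X deg gen hX hfree
    exact π.toOuter_isQuasiIso fun x hx => π.ad_injective_of_isFreeOn hfree hx
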